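/- **Setting.** Let $U\subset\mathbb R^p$, $Y\subset\mathbb R^m$, $Z\subset\mathbb R^k$ be compact and $C>0$. Let $f,g:U\times\mathbb R^m\to\mathbb R^m$ and $r:U\times\mathbb R^m\to\mathbb R$ be continuous and Lipschitz in $y$ uniformly in $u\in U$. Let $F:\mathbb R^m\to\mathbb R^k$ have Lipschitz continuous first derivatives in a neighbourhood of $Y$, with $F'(y)f(u,y)=0$ for all $(u,y)\in U\times Y$. Put $Y_z=\{y\in\mathbb R^m: F(y)=z\}$ and $h(u,y)=F'(y)g(u,y)$. Assume that $Y_z\subset Y$ for $z\in Z$ and that $z\mapsto Y_z$ is Lipschitz on $Z$ in the Hausdorff metric. Controls are measurable functions $u:[0,\infty)\to U$; solutions are absolutely continuous. *Perturbed problem.* For $\epsilon>0$ and $y_0\in\mathbb R^m$ let $$R^*(\epsilon,y_0)=\inf_{u(\cdot)}\int_0^\infty e^{-Ct}r(u(t),y_\epsilon(t))\,dt ,\qquad y_\epsilon'(t)=\tfrac1\epsilon f(u(t),y_\epsilon(t))+g(u(t),y_\epsilon(t)),\quad y_\epsilon(0)=y_0, \tag{1}$$ where the infimum is over all controls and corresponding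 solutions for which the integral exists as a finite or infinite limit of $\int_0^T$ as $T\to\infty$. The augmented perturbed system is (1) together with $z_\epsilon'(t)=h(u(t),y_\epsilon(t))$, $z_\epsilon(0)=F(y_0)$. *Averaged problem.* For $z\in Z$ let $W(z)$ be the set of Borel probability measures $\mu$ on $U\times Y$ with support in $U\times Y_z$ such that $\int_{U\times Y_z}\nabla\phi(y)^Tf(u,y)\,\mu(du,dy)=0$ for all $\phi\in C^1(\mathbb R^m)$. Put $\tilde h(\mu)=\int_{U\times Y} h\,d\mu$ and $\tilde r(\mu)=\int_{U\times Y} r\,d\mu$. A solution of the averaged system is a pair $(\mu(\cdot),z(\cdot))$ on $[0,\infty)$, with $\mu(\cdot)$ measurable and $z(t)\in Z$ for all $t\ge 0$, such that $z'(t)=\tilde h(\mu(t))$ and $\mu(t)\in W(z(t))$ for almost all $t$. Let $$\tilde R^*(y_0)=\inf\int_0^\infty e^{-Ct}\tilde r(\mu(t))\,dt$$ over all solutions of the averaged system with $z(0)=F(y_0)$. *Assumption 1.* On $Z$, the multivalued map $W(\cdot)$ is continuous (in the Hausdorff metric induced by a metric $\rho$ of weak convergence of probability measures), and $V(z)=\{(\tilde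 h(\mu),\tilde r(\mu)):\mu\in W(z)\}$ is Lipschitz continuous in the Hausdorff metric. *Assumption 2.* There is a function $\beta$ with $\lim_{S\to\infty}\beta(S)=0$ such that $\rho(\mu,\mathcal M_z(S,y(0)))\le\beta(S)$ for all $S>0$, $z\in Z$, $y(0)\in Y_z$ and $\mu\in W(z)$. Here $\mathcal M_z(S,y(0))$ is the set of occupational measures $Q\mapsto\frac1S\int_0^S 1_Q(u(t),y(t))\,dt$ generated by all controls $u(\cdot)$ and the corresponding solutions of the reduced system $y'=f(u,y)$ that start at $y(0)$. *Viability.* The averaged system is viable in $Z$ if for every $z_0\in Z$ it has a solution with $z(0)=z_0$ and $z(t)\in Z$ for all $t\ge0$. The augmented perturbed system is viable in $Y\times Z$ if, for all sufficiently small $\epsilon>0$ and every $y_0'\in Y$ with $F(y_0')\in Z$, some control gives a solution with $y_\epsilon(0)=y_0'$, $z_\epsilon(0)=F(y_0')$ and $(y_\epsilon(t),z_\epsilon(t))\in Y\times Z$ for all $t\ge0$. **Statement.** Fix $y_0\in\mathbb R^m$. Suppose that Assumption 1 holds, that the averaged system is viable in $Z$, and that there are a compact set $\check Z\subset \operatorname{int}Z$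 and controls $u_\epsilon(\cdot)$ with corresponding solutions $y_\epsilon(\cdot)$ of (1) such that, for all sufficiently small $\epsilon>0$, $y_\epsilon(t)\in Y$ and $F(y_\epsilon(t))\in\check Z$ for all $t\ge0$, and $$\liminf_{\epsilon\to0}\int_0^\infty e^{-Ct}r(u_\epsilon(t),y_\epsilon(t))\,dt=\liminf_{\epsilon\to0}R^*(\epsilon,y_0).$$ (a) Then $\liminf_{\epsilon\to0}R^*(\epsilon,y_0)\ge\tilde R^*(y_0)$. (b) Suppose in addition that Assumption 2 holds, that the augmented perturbed system is viable in $Y\times Z$, and that there are an optimal solution $(\mu(\cdot),z(\cdot))$ of the averaged problem and compact sets $\check Z_1\subset\operatorname{int}Z$ and $\check Y\subset\operatorname{int}Y$ such that $z(t)\in\check Z_1$ and $Y_{z(t)}\subset\check Y$ for all $t\ge0$. Then $\tilde R^*(y_0)$ is finite, and $\lim_{\epsilon\to0}R^*(\epsilon,y_0)$ exists and equals $\tilde R^*(y_0)$. -/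

import Mathlib

open MeasureTheory Filter Topology Set
open scoped ENNReal NNReal

noncomputable section

/-- The data of a control system with slow observables, with the standing assumptions on them:
`U` is the control set, `f + ε g` the dynamics, `F` the vector of constants of motion of the
reduced system `y' = f(u, y)`, `r` the running cost and `C` the discount rate. -/
structure SlowObservableSystem (p m k : ℕ) where
  U : Set (EuclideanSpace ℝ (Fin p))
  f : EuclideanSpace ℝ (Fin p) → EuclideanSpace ℝ (Fin m) → EuclideanSpace ℝ (Fin m)
  g : EuclideanSpace ℝ (Fin p) → EuclideanSpace ℝ (Fin m) → EuclideanSpace ℝ (Fin m)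
  r : EuclideanSpace ℝ (Fin p) → EuclideanSpace ℝ (Fin m) → ℝ
  C : ℝ
  F : EuclideanSpace ℝ (Fin m) → EuclideanSpace ℝ (Fin k)
  Y : Set (EuclideanSpace ℝ (Fin m))
  Z : Set (EuclideanSpace ℝ (Fin k))
  isCompact_U : IsCompact U
  continuousOn_f : ContinuousOn (Function.uncurry f) (U ×ˢ univ)
  continuousOn_g : ContinuousOn (Function.uncurry g) (U ×ˢ univ)
  continuousOn_r : ContinuousOn (Function.uncurry r) (U ×ˢ univ)
  lipschitz_f : ∃ K : ℝ≥0, ∀ u ∈ U, LipschitzWith K (f u)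
  lipschitz_g : ∃ K : ℝ≥0, ∀ u ∈ U, LipschitzWith K (g u)
  lipschitz_r : ∃ K : ℝ≥0, ∀ u ∈ U, LipschitzWith K (r u)
  C_pos : 0 < C
  isCompact_Y : IsCompact Y
  /-- The first derivatives of `F` exist and are Lipschitz in a neighbourhood of `Y`. -/
  regular_F : ∃ O : Set (EuclideanSpace ℝ (Fin m)), IsOpen O ∧ Y ⊆ O ∧
    DifferentiableOn ℝ F O ∧ ∃ K : ℝ≥0, LipschitzOnWith K (fderiv ℝ F) O
  /-- `F` is a vector of constants of motion: `F'(y) f(u, y) = 0` on `U × Y`. -/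
  constant_of_motion : ∀ u ∈ U, ∀ y ∈ Y, fderiv ℝ F y (f u y) = 0
  isCompact_Z : IsCompact Z
  level_subset : ∀ z ∈ Z, {y | F y = z} ⊆ Y
  /-- The multivalued map `z ↦ Y_z = {y | F y = z}` is Lipschitz on `Z`. -/
  level_lipschitz : ∃ L : ℝ≥0, ∀ z' ∈ Z, ∀ z'' ∈ Z,
    Metric.hausdorffEDist {y | F y = z'} {y | F y = z''} ≤ L * edist z' z''

/-- `J` is the discounted cost `∫₀^∞ e^{-Ct} c(t) dt`: the limit, finite or infinite, of the
integrals over `[0, T]` as `T → ∞`. -/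
def HasDiscountedCost (C : ℝ) (c : ℝ → ℝ) (J : EReal) : Prop :=
  Tendsto (fun T : ℝ => ((∫ t in (0 : ℝ)..T, Real.exp (-C * t) * c t : ℝ) : EReal)) atTop (𝓝 J)

/-- Distance from a measure to a set of measures, in the Lévy–Prokhorov metric, which metrizes
weak convergence of probability measures. -/
def distToSet {Ω : Type*} [MeasurableSpace Ω] [PseudoEMetricSpace Ω]
    (γ : Measure Ω) (Γ : Set (Measure Ω)) : ℝ≥0∞ :=
  ⨅ γ' ∈ Γ, levyProkhorovEDist γ γ'

/-- The Hausdorff (semi)metric on sets of measures induced by the Lévy–Prokhorov metric. -/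
def rhoH {Ω : Type*} [MeasurableSpace Ω] [PseudoEMetricSpace Ω]
    (Γ₁ Γ₂ : Set (Measure Ω)) : ℝ≥0∞ :=
  max (⨆ γ ∈ Γ₁, distToSet γ Γ₂) (⨆ γ ∈ Γ₂, distToSet γ Γ₁)

/-- The occupational measure `Q ↦ S⁻¹ ∫₀^S 1_Q(w(t)) dt` of `w` on `[0, S]`. -/
def occupationalMeasure {Ω : Type*} [MeasurableSpace Ω] (w : ℝ → Ω) (S : ℝ) : Measure Ω :=
  (ENNReal.ofReal S)⁻¹ • Measure.map w (volume.restrict (Icc 0 S))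

namespace SlowObservableSystem

variable {p m k : ℕ} (P : SlowObservableSystem p m k)

/-- The level set `Y_z`. -/
def level (z : EuclideanSpace ℝ (Fin k)) : Set (EuclideanSpace ℝ (Fin m)) := {y | P.F y = z}

/-- `h(u, y) = F'(y) g(u, y)`. -/
def h (u : EuclideanSpace ℝ (Fin p)) (y : EuclideanSpace ℝ (Fin m)) : EuclideanSpace ℝ (Fin k) :=
  fderiv ℝ P.F y (P.g u y)

/-- Controls: measurable functions of time `t ≥ 0` with values in `U`. -/
def IsControl (u : ℝ → EuclideanSpace ℝ (Fin p)) : Prop :=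
  Measurable u ∧ ∀ t, 0 ≤ t → u t ∈ P.U

/-- `y` is the solution on `[0, ∞)` of the reduced system `y' = f(u, y)`, `y(0) = y₀`
(in integral form, that is, absolutely continuous and satisfying the equation a.e.). -/
def IsReducedSolution (u : ℝ → EuclideanSpace ℝ (Fin p)) (y₀ : EuclideanSpace ℝ (Fin m))
    (y : ℝ → EuclideanSpace ℝ (Fin m)) : Prop :=
  ContinuousOn y (Ici 0) ∧ ∀ t, 0 ≤ t → y t = y₀ + ∫ s in (0 : ℝ)..t, P.f (u s) (y s)

/-- `y` is the solution on `[0, ∞)` of the perturbed system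
`y' = ε⁻¹ f(u, y) + g(u, y)`, `y(0) = y₀`. -/
def IsPerturbedSolution (ε : ℝ) (u : ℝ → EuclideanSpace ℝ (Fin p))
    (y₀ : EuclideanSpace ℝ (Fin m)) (y : ℝ → EuclideanSpace ℝ (Fin m)) : Prop :=
  ContinuousOn y (Ici 0) ∧ ∀ t, 0 ≤ t →
    y t = y₀ + ∫ s in (0 : ℝ)..t, (ε⁻¹ • P.f (u s) (y s) + P.g (u s) (y s))

/-- `z` solves the equation of the observables `z' = h(u, y)`, `z(0) = z₀`, along `(u, y)`. -/
def IsObservable (u : ℝ → EuclideanSpace ℝ (Fin p)) (y : ℝ → EuclideanSpace ℝ (Fin m))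
    (z₀ : EuclideanSpace ℝ (Fin k)) (z : ℝ → EuclideanSpace ℝ (Fin k)) : Prop :=
  ContinuousOn z (Ici 0) ∧ ∀ t, 0 ≤ t → z t = z₀ + ∫ s in (0 : ℝ)..t, P.h (u s) (y s)

/-- The optimal value `R*(ε, y₀)` of the perturbed problem: the infimum of the discounted cost
over all controls and corresponding solutions of the perturbed system. -/
def perturbedValue (ε : ℝ) (y₀ : EuclideanSpace ℝ (Fin m)) : EReal :=
  sInf {J : EReal | ∃ (u : ℝ → EuclideanSpace ℝ (Fin p)) (y : ℝ → EuclideanSpace ℝ (Fin m)),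
    P.IsControl u ∧ P.IsPerturbedSolution ε u y₀ y ∧
    HasDiscountedCost P.C (fun t => P.r (u t) (y t)) J}

/-- `W(z)`: the probability measures `μ` on `U × Y` with support in `U × Y_z` such that
`∫ ∇φ(y)ᵀ f(u, y) dμ = 0` for all `φ ∈ C¹`. Measures on `U × Y` are measures on the ambient
space that are supported in `U × Y`. -/
def W (z : EuclideanSpace ℝ (Fin k)) :
    Set (Measure (EuclideanSpace ℝ (Fin p) × EuclideanSpace ℝ (Fin m))) :=
  {μ | IsProbabilityMeasure μ ∧ μ.support ⊆ P.U ×ˢ P.Y ∧ μ.support ⊆ P.U ×ˢ P.level z ∧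
    ∀ φ : EuclideanSpace ℝ (Fin m) → ℝ, ContDiff ℝ 1 φ →
      ∫ q in P.U ×ˢ P.level z, fderiv ℝ φ q.2 (P.f q.1 q.2) ∂μ = 0}

/-- `h̃(μ) = ∫_{U × Y} h dμ`. -/
def hAve (μ : Measure (EuclideanSpace ℝ (Fin p) × EuclideanSpace ℝ (Fin m))) :
    EuclideanSpace ℝ (Fin k) :=
  ∫ q in P.U ×ˢ P.Y, P.h q.1 q.2 ∂μ

/-- `r̃(μ) = ∫_{U × Y} r dμ`. -/
def rAve (μ : Measure (EuclideanSpace ℝ (Fin p) × EuclideanSpace ℝ (Fin m))) : ℝ :=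
  ∫ q in P.U ×ˢ P.Y, P.r q.1 q.2 ∂μ

/-- `V(z) = {(h̃(μ), r̃(μ)) | μ ∈ W(z)}`. -/
def V (z : EuclideanSpace ℝ (Fin k)) : Set (EuclideanSpace ℝ (Fin k) × ℝ) :=
  (fun μ => (P.hAve μ, P.rAve μ)) '' P.W z

/-- `(μ, z)` is a solution on `[0, ∞)` of the averaged system `z' = h̃(μ)`, `μ(t) ∈ W(z(t))`,
`z(0) = z₀`. The map `W` is considered on `Z`, so that `z(t) ∈ Z`. -/
def IsAveragedSolution (z₀ : EuclideanSpace ℝ (Fin k))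
    (μ : ℝ → Measure (EuclideanSpace ℝ (Fin p) × EuclideanSpace ℝ (Fin m)))
    (z : ℝ → EuclideanSpace ℝ (Fin k)) : Prop :=
  Measurable μ ∧ ContinuousOn z (Ici 0) ∧ (∀ t, 0 ≤ t → z t ∈ P.Z) ∧
  (∀ᵐ t ∂(volume.restrict (Ici (0 : ℝ))), μ t ∈ P.W (z t)) ∧
  ∀ t, 0 ≤ t → z t = z₀ + ∫ s in (0 : ℝ)..t, P.hAve (μ s)

/-- The optimal value `R̃*(y₀)` of the averaged problem, in which `z(0) = F(y₀)`. -/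
def averagedValue (y₀ : EuclideanSpace ℝ (Fin m)) : EReal :=
  sInf {J : EReal | ∃ (μ : ℝ → Measure (EuclideanSpace ℝ (Fin p) × EuclideanSpace ℝ (Fin m)))
    (z : ℝ → EuclideanSpace ℝ (Fin k)),
    P.IsAveragedSolution (P.F y₀) μ z ∧ HasDiscountedCost P.C (fun t => P.rAve (μ t)) J}

/-- `W` is continuous and `V` is Lipschitz continuous on `Z`. -/
def ContinuityOfW : Prop :=
  (∀ z ∈ P.Z, Tendsto (fun z' => rhoH (P.W z') (P.W z)) (𝓝[P.Z] z) (𝓝 0)) ∧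
  ∃ L : ℝ≥0, ∀ z' ∈ P.Z, ∀ z'' ∈ P.Z,
    Metric.hausdorffEDist (P.V z') (P.V z'') ≤ L * edist z' z''

/-- The set of occupational measures on `[0, S]` generated by the controls and the corresponding
solutions of the reduced system that start at `y₀`. -/
def reducedOccupational (S : ℝ) (y₀ : EuclideanSpace ℝ (Fin m)) :
    Set (Measure (EuclideanSpace ℝ (Fin p) × EuclideanSpace ℝ (Fin m))) :=
  {γ | ∃ (u : ℝ → EuclideanSpace ℝ (Fin p)) (y : ℝ → EuclideanSpace ℝ (Fin m)),
    P.IsControl u ∧ P.IsReducedSolution u y₀ y ∧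
    γ = occupationalMeasure (fun t => (u t, y t)) S}

/-- Every measure in `W(z)` is approximated by occupational measures on `[0, S]`, uniformly in
`μ ∈ W(z)`, `y₀ ∈ Y_z` and `z ∈ Z`, as `S → ∞`. -/
def OccupationalApproximation : Prop :=
  ∃ β : ℝ → ℝ, Tendsto β atTop (𝓝 0) ∧
    ∀ S, 0 < S → ∀ z ∈ P.Z, ∀ y₀ ∈ P.level z, ∀ μ ∈ P.W z,
      distToSet μ (P.reducedOccupational S y₀) ≤ ENNReal.ofReal (β S)

/-- The averaged system is viable in `Z`. -/
def AveragedViable : Prop :=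
  ∀ z₀ ∈ P.Z, ∃ (μ : ℝ → Measure (EuclideanSpace ℝ (Fin p) × EuclideanSpace ℝ (Fin m)))
    (z : ℝ → EuclideanSpace ℝ (Fin k)),
    P.IsAveragedSolution z₀ μ z ∧ ∀ t, 0 ≤ t → z t ∈ P.Z

/-- The augmented perturbed system, in which `z(0) = F(y(0))`, is viable in `Y × Z` for all
sufficiently small `ε > 0`. -/
def AugmentedViable : Prop :=
  ∀ᶠ ε in 𝓝[>] (0 : ℝ), ∀ y₀ ∈ P.Y, P.F y₀ ∈ P.Z →
    ∃ (u : ℝ → EuclideanSpace ℝ (Fin p)) (y : ℝ → EuclideanSpace ℝ (Fin m))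
      (z : ℝ → EuclideanSpace ℝ (Fin k)),
      P.IsControl u ∧ P.IsPerturbedSolution ε u y₀ y ∧ P.IsObservable u y (P.F y₀) z ∧
      ∀ t, 0 ≤ t → y t ∈ P.Y ∧ z t ∈ P.Z

/-- There is a family of controls `u_ε` whose trajectories `y_ε` satisfy, for all sufficiently
small `ε > 0`, `y_ε(t) ∈ Y` and `F(y_ε(t)) ∈ Ž` for a compact set `Ž ⊆ int Z` independent of `ε`,
and whose costs have the same lower limit as the optimal values. -/
def HasAsymptoticMinimizer (y₀ : EuclideanSpace ℝ (Fin m)) : Prop :=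
  ∃ (u : ℝ → ℝ → EuclideanSpace ℝ (Fin p)) (y : ℝ → ℝ → EuclideanSpace ℝ (Fin m))
    (Zc : Set (EuclideanSpace ℝ (Fin k))),
    IsCompact Zc ∧ Zc ⊆ interior P.Z ∧
    (∀ᶠ ε in 𝓝[>] (0 : ℝ), P.IsControl (u ε) ∧ P.IsPerturbedSolution ε (u ε) y₀ (y ε) ∧
      ∀ t, 0 ≤ t → y ε t ∈ P.Y ∧ P.F (y ε t) ∈ Zc) ∧
    liminf (fun ε : ℝ =>
        ((∫ t in Ioi (0 : ℝ), Real.exp (-P.C * t) * P.r (u ε t) (y ε t) : ℝ) : EReal))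
        (𝓝[>] (0 : ℝ)) =
      liminf (fun ε : ℝ => P.perturbedValue ε y₀) (𝓝[>] (0 : ℝ))

/-- There is an optimal solution `(μ, z)` of the averaged problem with `z(t) ∈ Ž ⊆ int Z` and
`Y_{z(t)} ⊆ Y̌ ⊆ int Y` for all `t ≥ 0`, where `Ž` and `Y̌` are compact. -/
def HasInteriorOptimalSolution (y₀ : EuclideanSpace ℝ (Fin m)) : Prop :=
  ∃ (μ : ℝ → Measure (EuclideanSpace ℝ (Fin p) × EuclideanSpace ℝ (Fin m)))
    (z : ℝ → EuclideanSpace ℝ (Fin k))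
    (Zc : Set (EuclideanSpace ℝ (Fin k))) (Yc : Set (EuclideanSpace ℝ (Fin m))),
    P.IsAveragedSolution (P.F y₀) μ z ∧
    HasDiscountedCost P.C (fun t => P.rAve (μ t)) (P.averagedValue y₀) ∧
    IsCompact Zc ∧ Zc ⊆ interior P.Z ∧ IsCompact Yc ∧ Yc ⊆ interior P.Y ∧
    ∀ t, 0 ≤ t → z t ∈ Zc ∧ P.level (z t) ⊆ Yc

end SlowObservableSystem

end

/-! Along a perturbed trajectory in `Y` the singular term `ε⁻¹ f` drops out of the derivative of
`F(y)`, because `F' f = 0`. The observables therefore move with bounded velocity `h` while `y` moves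
fast on slowly varying level sets. As `ε → 0` only the local statistics of `(u, y)` matter, and the
possible statistics at `z` are the elements of `W(z)`.

Lower bound (`averagedValue_le_of_seq`). The pairs `(u_ε, y_ε)` take values in the compact set `U ×
Y`, so by compactness of Young measures (`exists_subseq_tendsto_kernel_Ioi`) a subsequence generates
a measurable family `μ(t)`. The integrated equation `z' = h` passes to the limit. Testing against
`‖F(y) - z(t)‖` shows that `μ(t)` lives on the level set of `z(t)`. For `φ ∈ C¹` the chain rule for
`φ(y)` gives `∫ φ' f = O(ε)`, which is the stationarity condition. The limit is thus an averaged
solution, and its cost is the limit of the perturbed costs.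

Upper bound (`eventually_perturbedValue_le`). An averaged solution that stays in the interior is
followed in steps of length `ε S`. Over one step, the mean of `(h̃, r̃)` is nearly attained by a
single `ν ∈ W(F(y))`, because `V` is Lipschitz with convex values (`exists_mem_W_near_average`).
Pairing `h` with `r` lets one `ν` serve the velocity and the cost together. Assumption 2 provides a
reduced trajectory on `[0, S]` with statistics close to `ν`, and in the fast time the perturbed
trajectory with the same control is `O(ε)` close to it (`exists_perturbed_near_measure`). The errors
obey a discrete Gronwall inequality (`Tracks.step`, `eventually_tracks`). After a long time,
viability keeps the trajectory in `Y`, and discounting makes the rest of the cost negligible. -/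

/-! ### Measurability of compositions and the chain rule along absolutely continuous curves. -/

theorem measurable_indicator_of_continuousOn {A B : Type*} [TopologicalSpace A] [MeasurableSpace A]
    [BorelSpace A] [Zero B] [TopologicalSpace B] [MeasurableSpace B] [BorelSpace B] {φ : A → B}
    {S : Set A} (hφ : ContinuousOn φ S) (hS : MeasurableSet S) : Measurable (S.indicator φ) := by
  classical
  have := hφ.measurable_piecewise (g := fun _ => (0 : B)) continuousOn_const hS
  exact this

/-- The data of the system are continuous only over `U` or over `U × Y`. Extension by zero makes
such a function Borel without changing it along `w`. -/
theorem aestronglyMeasurable_comp_of_continuousOn {T A B : Type*} [MeasurableSpace T]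
    [TopologicalSpace A] [MeasurableSpace A] [BorelSpace A]
    [NormedAddCommGroup B] [SecondCountableTopology B]
    {μ : Measure T} {φ : A → B} {S : Set A} (hφ : ContinuousOn φ S) (hS : MeasurableSet S)
    {w : T → A} (hw : AEMeasurable w μ) (hwS : ∀ᵐ t ∂μ, w t ∈ S) :
    AEStronglyMeasurable (fun t => φ (w t)) μ := by
  borelize B
  have h1 := measurable_indicator_of_continuousOn hφ hS
  have h2 : AEMeasurable (fun t => S.indicator φ (w t)) μ := h1.comp_aemeasurable hw
  refine (h2.congr ?_).aestronglyMeasurable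
  filter_upwards [hwS] with t ht
  simp [ht]

/-- The chain rule along an absolutely continuous curve with bounded derivative. -/
theorem sub_eq_integral_of_hasFDerivAt {E G : Type*} [NormedAddCommGroup E] [NormedSpace ℝ E]
    [CompleteSpace E] [NormedAddCommGroup G] [NormedSpace ℝ G] [CompleteSpace G]
    {F : E → G} {F' : E → E →L[ℝ] G} {y v : ℝ → E} {a b M : ℝ} (hab : a ≤ b)
    (hvi : IntervalIntegrable v volume a b) (hv : ∀ t ∈ Icc a b, ‖v t‖ ≤ M)
    (hy : ∀ t ∈ Icc a b, y t = y a + ∫ s in a..t, v s)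
    (hF : ∀ t ∈ Icc a b, HasFDerivAt F (F' (y t)) (y t))
    (hF' : ContinuousOn (fun t => F' (y t)) (Icc a b)) :
    IntervalIntegrable (fun s => F' (y s) (v s)) volume a b ∧
      F (y b) - F (y a) = ∫ s in a..b, F' (y s) (v s) := by
  have huI : uIcc a b = Icc a b := uIcc_of_le hab
  have hint : IntervalIntegrable (fun s => F' (y s) (v s)) volume a b := by
    obtain ⟨B, hB⟩ := isCompact_Icc.exists_bound_of_continuousOn hF'
    have hvi' := hvi
    rw [intervalIntegrable_iff_integrableOn_Icc_of_le hab] at hvi' ⊢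
    have hm : AEStronglyMeasurable (fun s => F' (y s)) (volume.restrict (Icc a b)) :=
      hF'.aestronglyMeasurable measurableSet_Icc
    refine Integrable.mono' (g := fun s => B * ‖v s‖) (hvi'.norm.const_mul B) ?_ ?_
    · exact (ContinuousLinearMap.apply ℝ G).flip.aestronglyMeasurable_comp₂ hm
        hvi'.aestronglyMeasurable
    · filter_upwards [ae_restrict_mem measurableSet_Icc] with s hs
      exact (ContinuousLinearMap.le_opNorm _ _).trans
        (mul_le_mul_of_nonneg_right (hB s hs) (norm_nonneg _))
  refine ⟨hint, ?_⟩
  have hM : 0 ≤ M := (norm_nonneg _).trans (hv a (left_mem_Icc.2 hab))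
  have hsub : ∀ s ∈ Icc a b, ∀ t ∈ Icc a b, IntervalIntegrable v volume s t := fun s hs t ht =>
    hvi.mono_set (by rw [huI]; exact uIcc_subset_Icc hs ht)
  have hsub' : ∀ s ∈ Icc a b, ∀ t ∈ Icc a b,
      IntervalIntegrable (fun s => F' (y s) (v s)) volume s t := fun s hs t ht =>
    hint.mono_set (by rw [huI]; exact uIcc_subset_Icc hs ht)
  have ha : a ∈ Icc a b := left_mem_Icc.2 hab
  have hyd : ∀ s ∈ Icc a b, ∀ t ∈ Icc a b, y t - y s = ∫ τ in s..t, v τ := by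
    intro s hs t ht
    rw [hy t ht, hy s hs, add_sub_add_left_eq_sub,
      intervalIntegral.integral_interval_sub_left (hsub a ha t ht) (hsub a ha s hs)]
  have hyl : ∀ s ∈ Icc a b, ∀ t ∈ Icc a b, ‖y t - y s‖ ≤ M * |t - s| := by
    intro s hs t ht
    rw [hyd s hs t ht]
    exact intervalIntegral.norm_integral_le_of_norm_le_const fun τ hτ =>
      hv τ (uIcc_subset_Icc hs ht (uIoc_subset_uIcc hτ))
  have hyc : ContinuousOn y (Icc a b) := by
    refine LipschitzOnWith.continuousOn (K := M.toNNReal) (LipschitzOnWith.of_dist_le_mul ?_)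
    intro t ht s hs
    rw [dist_eq_norm, Real.dist_eq, Real.coe_toNNReal _ hM]
    exact hyl s hs t ht
  set Φ : ℝ → G := fun t => F (y t) - ∫ s in a..t, F' (y s) (v s) with hΦ
  have hΦc : ContinuousOn Φ (Icc a b) := by
    refine ContinuousOn.sub ?_ ?_
    · intro t ht
      exact (hF t ht).continuousAt.comp_continuousWithinAt (hyc t ht)
    · rw [← huI]
      refine intervalIntegral.continuousOn_primitive_interval ?_
      rw [huI]
      exact (intervalIntegrable_iff_integrableOn_Icc_of_le hab).1 hint
  have hder : ∀ t ∈ Ico a b, HasDerivWithinAt Φ 0 (Ici t) t := by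
    intro t ht
    have htI : t ∈ Icc a b := Ico_subset_Icc_self ht
    have hnb : Icc t b ∈ 𝓝[≥] t := Icc_mem_nhdsGE ht.2
    rw [hasDerivWithinAt_iff_isLittleO]
    have key : (fun s => F (y s) - F (y t) - F' (y t) (y s - y t)) =o[𝓝[≥] t] fun s => s - t := by
      have h1 := (hF t htI).isLittleO
      have h2 : Tendsto y (𝓝[≥] t) (𝓝 (y t)) :=
        ((hyc t htI).mono (Icc_subset_Icc_left ht.1)).mono_left (le_of_eq (by
          rw [nhdsWithin_Icc_eq_nhdsGE ht.2]))
      refine (h1.comp_tendsto h2).trans_isBigO ?_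
      refine Asymptotics.IsBigO.of_bound M ?_
      filter_upwards [hnb] with s hs
      exact hyl t htI s ⟨ht.1.trans hs.1, hs.2⟩
    have key2 : (fun s => ∫ τ in t..s, (F' (y t) - F' (y τ)) (v τ)) =o[𝓝[≥] t]
        fun s => s - t := by
      rw [Asymptotics.isLittleO_iff]
      intro c hc
      have hc' : 0 < c / (M + 1) := by positivity
      have h3 : Tendsto (fun s => F' (y s)) (𝓝[≥] t) (𝓝 (F' (y t))) := by
        have := ((hF' t htI).mono (Icc_subset_Icc_left ht.1))
        rwa [ContinuousWithinAt, nhdsWithin_Icc_eq_nhdsGE ht.2] at this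
      have h4 : ∀ᶠ s in 𝓝[≥] t, ‖F' (y t) - F' (y s)‖ ≤ c / (M + 1) := by
        have := h3 (Metric.closedBall_mem_nhds _ hc')
        filter_upwards [this] with s hs
        rw [← dist_eq_norm, dist_comm]; exact hs
      obtain ⟨w, hw, hwI⟩ := (mem_nhdsGE_iff_exists_Icc_subset).1 (Filter.inter_mem h4 hnb)
      filter_upwards [Icc_mem_nhdsGE hw] with s hs
      rw [Real.norm_eq_abs]
      refine intervalIntegral.norm_integral_le_of_norm_le_const fun τ hτ => ?_
      have hτ' : τ ∈ Icc t s := by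
        rw [uIoc_of_le hs.1] at hτ; exact Ioc_subset_Icc_self hτ
      obtain ⟨h5, h6⟩ := hwI ⟨hτ'.1, hτ'.2.trans hs.2⟩
      calc _ ≤ ‖F' (y t) - F' (y τ)‖ * ‖v τ‖ := ContinuousLinearMap.le_opNorm _ _
        _ ≤ c / (M + 1) * M := by
          gcongr
          · exact h5
          · exact hv τ ⟨ht.1.trans h6.1, h6.2⟩
        _ ≤ c := by
          rw [div_mul_eq_mul_div, div_le_iff₀ (by positivity)]
          nlinarith
    refine (key.add key2).congr' ?_ EventuallyEq.rfl
    filter_upwards [hnb] with s hs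
    have hsI : s ∈ Icc a b := ⟨ht.1.trans hs.1, hs.2⟩
    simp only [hΦ, smul_zero, sub_zero, sub_apply]
    rw [intervalIntegral.integral_sub _ (hsub' t htI s hsI),
      ContinuousLinearMap.intervalIntegral_comp_comm _ (hsub t htI s hsI), ← hyd t htI s hsI,
      ← intervalIntegral.integral_interval_sub_left (hsub' a ha s hsI) (hsub' a ha t htI)]
    · abel
    · exact ⟨(F' (y t)).integrable_comp (hsub t htI s hsI).1,
        (F' (y t)).integrable_comp (hsub t htI s hsI).2⟩
  have := constant_of_has_deriv_right_zero hΦc hder b (right_mem_Icc.2 hab)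
  simp only [hΦ, intervalIntegral.integral_same, sub_zero] at this
  rw [← this]; abel

/-! ### Discounted costs with bounded integrand. -/

theorem integrableOn_exp_mul_of_bounded {C : ℝ} (hC : 0 < C) {c : ℝ → ℝ} {M : ℝ}
    (hcm : AEStronglyMeasurable c (volume.restrict (Ioi 0)))
    (hc : ∀ᵐ t ∂(volume.restrict (Ioi (0 : ℝ))), |c t| ≤ M) :
    IntegrableOn (fun t => Real.exp (-C * t) * c t) (Ioi 0) := by
  have h1 : IntegrableOn (fun t => Real.exp (-C * t)) (Ioi 0) := integrableOn_exp_mul_Ioi (by linarith) 0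
  exact Integrable.mul_bdd (c := M) h1 hcm hc

theorem hasDiscountedCost_integral {C : ℝ} {c : ℝ → ℝ}
    (h : IntegrableOn (fun t => Real.exp (-C * t) * c t) (Ioi 0)) :
    HasDiscountedCost C c ((∫ t in Ioi (0 : ℝ), Real.exp (-C * t) * c t : ℝ) : EReal) :=
  (continuous_coe_real_ereal.tendsto _).comp
    (intervalIntegral_tendsto_integral_Ioi 0 h tendsto_id)

theorem HasDiscountedCost.unique {C : ℝ} {c : ℝ → ℝ} {J J' : EReal}
    (h : HasDiscountedCost C c J) (h' : HasDiscountedCost C c J') : J = J' :=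
  tendsto_nhds_unique h h'

/-! ### Young measures. -/

/-- Weak convergence with a fixed first marginal extends to products `ψ(t) φ(x)` with `ψ`
integrable. -/
theorem tendsto_integral_mul_of_fst_eq {X : Type*} [TopologicalSpace X] [MeasurableSpace X]
    [BorelSpace X] [SecondCountableTopology X] {m : Measure ℝ} [IsProbabilityMeasure m]
    {ι : Type*} {l : Filter ι}
    {ν : ι → ProbabilityMeasure (ℝ × X)} {ν₀ : ProbabilityMeasure (ℝ × X)}
    (hν : Tendsto ν l (𝓝 ν₀)) (h : ∀ i, (ν i : Measure (ℝ × X)).fst = m)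
    (h₀ : (ν₀ : Measure (ℝ × X)).fst = m) {ψ : ℝ → ℝ} (hψ : Integrable ψ m)
    (φ : BoundedContinuousFunction X ℝ) :
    Tendsto (fun i => ∫ q, ψ q.1 * φ q.2 ∂(ν i : Measure (ℝ × X))) l
      (𝓝 (∫ q, ψ q.1 * φ q.2 ∂(ν₀ : Measure (ℝ × X)))) := by
  -- Replacing `ψ` by a bounded continuous `g` costs at most `‖φ‖` times their `L¹(m)` distance,
  -- uniformly over all measures with first marginal `m`.
  have key : ∀ g : BoundedContinuousFunction ℝ ℝ, ∀ ρ : ProbabilityMeasure (ℝ × X),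
      (ρ : Measure (ℝ × X)).fst = m →
      dist (∫ q, g q.1 * φ q.2 ∂(ρ : Measure (ℝ × X))) (∫ q, ψ q.1 * φ q.2 ∂(ρ : Measure (ℝ × X)))
        ≤ ‖φ‖ * ∫ t, ‖ψ t - g t‖ ∂m := by
    intro g ρ hρ
    have hint : ∀ η : ℝ → ℝ, Integrable η m →
        Integrable (fun q : ℝ × X => η q.1 * φ q.2) (ρ : Measure (ℝ × X)) := by
      intro η hη
      refine Integrable.mul_bdd (c := ‖φ‖) ?_
        (φ.continuous.comp continuous_snd).aestronglyMeasurable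
        (Eventually.of_forall fun q => φ.norm_coe_le_norm _)
      have : Integrable η ((ρ : Measure (ℝ × X)).map Prod.fst) := by
        rw [← Measure.fst, hρ]; exact hη
      exact this.comp_measurable measurable_fst
    have hd : Integrable (fun t => ‖ψ t - g t‖) m := (hψ.sub (g.integrable m)).norm
    rw [dist_comm, dist_eq_norm, ← integral_sub (hint _ hψ) (hint _ (g.integrable m))]
    have e1 : ∫ t, ‖ψ t - g t‖ ∂m = ∫ q, ‖ψ q.1 - g q.1‖ ∂(ρ : Measure (ℝ × X)) := by
      rw [← hρ, Measure.fst, integral_map measurable_fst.aemeasurable]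
      rw [← Measure.fst, hρ]; exact hd.aestronglyMeasurable
    rw [e1, ← integral_const_mul]
    refine norm_integral_le_of_norm_le (Integrable.const_mul ?_ _)
      (Eventually.of_forall fun q => ?_)
    · have : Integrable (fun t => ‖ψ t - g t‖) ((ρ : Measure (ℝ × X)).map Prod.fst) := by
        rw [← Measure.fst, hρ]; exact hd
      exact this.comp_measurable measurable_fst
    · rw [← sub_mul, norm_mul, mul_comm]
      exact mul_le_mul_of_nonneg_right (φ.norm_coe_le_norm _) (norm_nonneg _)
  rw [Metric.tendsto_nhds]
  intro ε hε
  have hpos : 0 < ε / 3 / (‖φ‖ + 1) := by positivity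
  obtain ⟨g, hg, -⟩ := hψ.exists_boundedContinuous_integral_sub_le hpos
  have hsmall : ‖φ‖ * ∫ t, ‖ψ t - g t‖ ∂m ≤ ε / 3 := by
    calc ‖φ‖ * ∫ t, ‖ψ t - g t‖ ∂m ≤ ‖φ‖ * (ε / 3 / (‖φ‖ + 1)) := by gcongr
      _ ≤ ε / 3 := by
        rw [mul_div_assoc', div_le_iff₀ (by positivity)]; nlinarith [norm_nonneg φ]
  let G : BoundedContinuousFunction (ℝ × X) ℝ :=
    (g.compContinuous ⟨Prod.fst, continuous_fst⟩) * (φ.compContinuous ⟨Prod.snd, continuous_snd⟩)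
  have hG := (ProbabilityMeasure.tendsto_iff_forall_integral_tendsto.1 hν) G
  rw [Metric.tendsto_nhds] at hG
  filter_upwards [hG (ε / 3) (by positivity)] with i hi
  have h1 := key g (ν i) (h i)
  have h2 := key g ν₀ h₀
  have hi' : dist (∫ q, g q.1 * φ q.2 ∂(ν i : Measure (ℝ × X)))
    (∫ q, g q.1 * φ q.2 ∂(ν₀ : Measure (ℝ × X))) < ε / 3 := hi
  have h3 := dist_triangle4_left (∫ q, g q.1 * φ q.2 ∂(ν i : Measure (ℝ × X)))
    (∫ q, g q.1 * φ q.2 ∂(ν₀ : Measure (ℝ × X))) (∫ q, ψ q.1 * φ q.2 ∂(ν i : Measure (ℝ × X)))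
    (∫ q, ψ q.1 * φ q.2 ∂(ν₀ : Measure (ℝ × X)))
  linarith

/-- Compactness of Young measures: a sequence of measurable functions with values in a compact
metric space has a subsequence that generates a measurable family of probability measures. -/
theorem exists_subseq_tendsto_kernel {X : Type*} [MetricSpace X] [CompactSpace X] [Nonempty X]
    [MeasurableSpace X] [BorelSpace X] {m : Measure ℝ} [IsProbabilityMeasure m]
    {w : ℕ → ℝ → X} (hw : ∀ n, Measurable (w n)) :
    ∃ (κ : ProbabilityTheory.Kernel ℝ X) (θ : ℕ → ℕ), ProbabilityTheory.IsMarkovKernel κ ∧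
      StrictMono θ ∧
      (∀ ψ : ℝ → ℝ, Integrable ψ m → ∀ φ : X → ℝ, Continuous φ →
        Tendsto (fun n => ∫ t, ψ t * φ (w (θ n) t) ∂m) atTop
          (𝓝 (∫ t, ψ t * ∫ x, φ x ∂(κ t) ∂m))) ∧
      ∀ G : BoundedContinuousFunction (ℝ × X) ℝ,
        Tendsto (fun n => ∫ t, G (t, w (θ n) t) ∂m) atTop
          (𝓝 (∫ t, ∫ x, G (t, x) ∂(κ t) ∂m)) ∧
        Integrable (fun t => ∫ x, G (t, x) ∂(κ t)) m := by
  have hmeas : ∀ n, Measurable fun t => (t, w n t) := fun n => measurable_id.prodMk (hw n)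
  -- The measures carried by the graphs of `w n`. Their first marginal is always `m` and `X` is
  -- compact, so they are tight and Prokhorov's theorem applies.
  let ν : ℕ → ProbabilityMeasure (ℝ × X) := fun n =>
    ⟨m.map fun t => (t, w n t), Measure.isProbabilityMeasure_map (hmeas n).aemeasurable⟩
  have hfst : ∀ n, (ν n : Measure (ℝ × X)).fst = m := by
    intro n
    change (m.map fun t => (t, w n t)).fst = m
    rw [Measure.fst, Measure.map_map measurable_fst (hmeas n)]
    exact Measure.map_id
  have htight : IsTightMeasureSet {((μ : ProbabilityMeasure (ℝ × X)) : Measure (ℝ × X)) |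
      μ ∈ range ν} := by
    refine IsTightMeasureSet.prodMk ?_ IsTightMeasureSet.of_compactSpace
    refine (isTightMeasureSet_singleton (μ := m)).subset ?_
    rintro _ ⟨_, ⟨_, ⟨n, rfl⟩, rfl⟩, rfl⟩
    exact hfst n
  obtain ⟨ν₀, -, θ, hθ, hlim⟩ := (isCompact_closure_of_isTightMeasureSet htight).tendsto_subseq
    (fun n => subset_closure (mem_range_self n))
  have h₀ : (ν₀ : Measure (ℝ × X)).fst = m := by
    have hc := (ProbabilityMeasure.continuous_map (Ω := ℝ × X) (Ω' := ℝ) continuous_fst).tendsto ν₀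
    have h2 := hc.comp hlim
    let mP : ProbabilityMeasure ℝ := ⟨m, inferInstance⟩
    have h3 : Tendsto (fun _ : ℕ => mP) atTop
        (𝓝 (ν₀.map continuous_fst.measurable.aemeasurable)) := by
      refine h2.congr fun n => ?_
      apply Subtype.ext
      exact hfst (θ n)
    have h4 := tendsto_nhds_unique h3 tendsto_const_nhds
    exact congrArg Subtype.val h4
  -- The marginal `m` survives in the limit, so the limit disintegrates over `m`; the conditional
  -- kernel is the Young measure.
  have hdis : m.compProd (ν₀ : Measure (ℝ × X)).condKernel = (ν₀ : Measure (ℝ × X)) := by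
    have := (ν₀ : Measure (ℝ × X)).disintegrate (ν₀ : Measure (ℝ × X)).condKernel
    rwa [h₀] at this
  refine ⟨(ν₀ : Measure (ℝ × X)).condKernel, θ, inferInstance, hθ, ?_, ?_⟩
  · intro ψ hψ φ hφ
    let φ' : BoundedContinuousFunction X ℝ := BoundedContinuousFunction.mkOfCompact ⟨φ, hφ⟩
    have h1 := tendsto_integral_mul_of_fst_eq hlim (fun n => hfst (θ n)) h₀ hψ φ'
    have hint : Integrable (fun q : ℝ × X => ψ q.1 * φ q.2) (ν₀ : Measure (ℝ × X)) := by
      refine Integrable.mul_bdd (c := ‖φ'‖) ?_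
        (hφ.comp continuous_snd).aestronglyMeasurable
        (Eventually.of_forall fun q => φ'.norm_coe_le_norm _)
      have : Integrable ψ ((ν₀ : Measure (ℝ × X)).map Prod.fst) := by
        rw [← Measure.fst, h₀]; exact hψ
      exact this.comp_measurable measurable_fst
    have h2 : ∫ q, ψ q.1 * φ' q.2 ∂(ν₀ : Measure (ℝ × X)) =
        ∫ t, ψ t * ∫ x, φ x ∂((ν₀ : Measure (ℝ × X)).condKernel t) ∂m := by
      conv_lhs => rw [← hdis]
      rw [Measure.integral_compProd (by rw [hdis]; exact hint)]
      simp only [integral_const_mul]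
      rfl
    rw [h2] at h1
    refine h1.congr fun n => ?_
    change ∫ q, ψ q.1 * φ q.2 ∂(m.map fun t => (t, w (θ n) t)) = _
    rw [integral_map (hmeas _).aemeasurable]
    have hfs : (m.map fun t => (t, w (θ n) t)).map Prod.fst = m := hfst (θ n)
    have : Integrable ψ ((m.map fun t => (t, w (θ n) t)).map Prod.fst) := by rw [hfs]; exact hψ
    exact (this.comp_measurable measurable_fst).aestronglyMeasurable.mul
      (hφ.comp continuous_snd).aestronglyMeasurable
  · intro G
    have hint : Integrable G (m.compProd (ν₀ : Measure (ℝ × X)).condKernel) := G.integrable _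
    refine ⟨?_, Integrable.of_bound
      (StronglyMeasurable.integral_kernel_prod_right' G.continuous.stronglyMeasurable).aestronglyMeasurable
      ‖G‖ (Eventually.of_forall fun t => ?_)⟩
    · have h1 := (ProbabilityMeasure.tendsto_iff_forall_integral_tendsto.1 hlim) G
      have h2 : ∫ q, G q ∂(ν₀ : Measure (ℝ × X)) =
          ∫ t, ∫ x, G (t, x) ∂((ν₀ : Measure (ℝ × X)).condKernel t) ∂m := by
        conv_lhs => rw [← hdis]
        rw [Measure.integral_compProd hint]
      rw [h2] at h1
      refine h1.congr fun n => ?_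
      change ∫ q, G q ∂(m.map fun t => (t, w (θ n) t)) = _
      rw [integral_map (hmeas _).aemeasurable G.continuous.aestronglyMeasurable]
    · exact (norm_integral_le_of_norm_le_const (Eventually.of_forall fun x => G.norm_coe_le_norm _)).trans
        (by simp)

/-- By Lebesgue differentiation, `H` is almost everywhere the derivative of its primitive, which
vanishes on the half-line. -/
theorem ae_eq_zero_of_intervalIntegral_eq_zero {H : ℝ → ℝ} (hH : LocallyIntegrable H volume)
    (h : ∀ t, 0 ≤ t → ∫ s in (0 : ℝ)..t, H s = 0) :
    ∀ᵐ t ∂(volume.restrict (Ioi (0 : ℝ))), H t = 0 := by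
  rw [ae_restrict_iff' measurableSet_Ioi]
  filter_upwards [_root_.LocallyIntegrable.ae_hasDerivAt_integral hH] with x hx hx0
  have h2 : HasDerivAt (fun t => ∫ s in (0 : ℝ)..t, H s) 0 x := by
    refine (hasDerivAt_const x (0 : ℝ)).congr_of_eventuallyEq ?_
    filter_upwards [Ioi_mem_nhds hx0] with t ht
    exact h t (le_of_lt ht)
  exact (hx 0).unique h2

theorem locallyIntegrable_of_bounded {H : ℝ → ℝ} (hm : StronglyMeasurable H) {M : ℝ}
    (hM : ∀ t, ‖H t‖ ≤ M) : LocallyIntegrable H volume := by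
  refine (locallyIntegrable_const M).mono hm.aestronglyMeasurable (Eventually.of_forall fun t => ?_)
  exact (hM t).trans (le_abs_self M)

/-- Compactness of Young measures on the half-line, tested against Lebesgue measure on bounded
intervals and against discounted Lebesgue measure. -/
theorem exists_subseq_tendsto_kernel_Ioi {X : Type*} [MetricSpace X] [CompactSpace X] [Nonempty X]
    [MeasurableSpace X] [BorelSpace X] {C : ℝ} (hC : 0 < C)
    {w : ℕ → ℝ → X} (hw : ∀ n, Measurable (w n)) :
    ∃ (κ : ProbabilityTheory.Kernel ℝ X) (θ : ℕ → ℕ), ProbabilityTheory.IsMarkovKernel κ ∧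
      StrictMono θ ∧
      (∀ φ : X → ℝ, Continuous φ → ∀ t, 0 ≤ t →
        Tendsto (fun n => ∫ s in (0 : ℝ)..t, φ (w (θ n) s)) atTop
          (𝓝 (∫ s in (0 : ℝ)..t, ∫ x, φ x ∂(κ s)))) ∧
      (∀ φ : X → ℝ, Continuous φ →
        Tendsto (fun n => ∫ s in Ioi (0 : ℝ), Real.exp (-C * s) * φ (w (θ n) s)) atTop
          (𝓝 (∫ s in Ioi (0 : ℝ), Real.exp (-C * s) * ∫ x, φ x ∂(κ s)))) ∧
      ∀ G : BoundedContinuousFunction (ℝ × X) ℝ,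
        Tendsto (fun n => ∫ s in Ioi (0 : ℝ), Real.exp (-C * s) * G (s, w (θ n) s)) atTop
          (𝓝 (∫ s in Ioi (0 : ℝ), Real.exp (-C * s) * ∫ x, G (s, x) ∂(κ s))) := by
  -- Normalizing `e^{-Ct} dt` by `C` gives a probability measure on the half-line, which serves as
  -- the reference measure `m`.
  set d : ℝ → ℝ≥0 := fun t => (C * Real.exp (-C * t)).toNNReal with hd
  have hdm : Measurable d := by fun_prop
  have hdc : ∀ t, (d t : ℝ) = C * Real.exp (-C * t) := fun t =>
    Real.coe_toNNReal _ (by positivity)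
  set m : Measure ℝ := (volume.restrict (Ioi 0)).withDensity fun t => (d t : ℝ≥0∞) with hm
  have hexp : IntegrableOn (fun t => C * Real.exp (-C * t)) (Ioi 0) :=
    (integrableOn_exp_mul_Ioi (by linarith) 0).const_mul C
  have hint1 : ∫ t in Ioi (0 : ℝ), C * Real.exp (-C * t) = 1 := by
    rw [integral_const_mul, integral_exp_mul_Ioi (by linarith)]
    simp [hC.ne']
  have hprob : IsProbabilityMeasure m := by
    refine ⟨?_⟩
    rw [hm, withDensity_apply _ MeasurableSet.univ, Measure.restrict_univ]
    change ∫⁻ t in Ioi (0 : ℝ), ENNReal.ofReal (C * Real.exp (-C * t)) = 1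
    rw [← ofReal_integral_eq_lintegral_ofReal hexp (Eventually.of_forall fun t => by positivity),
      hint1, ENNReal.ofReal_one]
  have hmi : ∀ Ψ : ℝ → ℝ, ∫ t, Ψ t ∂m = ∫ t in Ioi (0 : ℝ), C * Real.exp (-C * t) * Ψ t := by
    intro Ψ
    rw [hm, integral_withDensity_eq_integral_smul hdm]
    simp only [NNReal.smul_def, hdc, smul_eq_mul]
  have hmi' : ∀ Ψ : ℝ → ℝ,
      ∫ t in Ioi (0 : ℝ), Real.exp (-C * t) * Ψ t = C⁻¹ * ∫ t, Ψ t ∂m := by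
    intro Ψ
    rw [hmi, ← integral_const_mul]
    refine integral_congr_ae (Eventually.of_forall fun t => ?_)
    simp only []
    field_simp
  obtain ⟨κ, θ, hκ, hθ, h1, h2⟩ := exists_subseq_tendsto_kernel (m := m) hw
  refine ⟨κ, θ, hκ, hθ, ?_, ?_, ?_⟩
  · intro φ hφ t ht
    -- This weight cancels the density of `m` on `(0, t]`, so that testing against `ψ` recovers the
    -- Lebesgue integral over that interval.
    set ψ : ℝ → ℝ := (Ioc 0 t).indicator fun s => C⁻¹ * Real.exp (C * s) with hψ
    have hψi : Integrable ψ m := by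
      refine Integrable.of_bound (C := C⁻¹ * Real.exp (C * t)) ?_ (Eventually.of_forall fun s => ?_)
      · exact ((by fun_prop : Measurable fun s => C⁻¹ * Real.exp (C * s)).indicator
          measurableSet_Ioc).aestronglyMeasurable
      · by_cases hs : s ∈ Ioc 0 t
        · rw [hψ, indicator_of_mem hs, Real.norm_of_nonneg (by positivity)]
          gcongr
          exact hs.2
        · rw [hψ, indicator_of_notMem hs, norm_zero]; positivity
    have e : ∀ Ψ : ℝ → ℝ, ∫ s, ψ s * Ψ s ∂m = ∫ s in (0 : ℝ)..t, Ψ s := by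
      intro Ψ
      rw [hmi, intervalIntegral.integral_of_le ht,
        ← integral_indicator (measurableSet_Ioi (a := (0 : ℝ))),
        ← integral_indicator (measurableSet_Ioc (a := (0 : ℝ)) (b := t))]
      refine integral_congr_ae (Eventually.of_forall fun s => ?_)
      by_cases hs : s ∈ Ioc 0 t
      · have hs' : s ∈ Ioi (0 : ℝ) := hs.1
        simp only [hψ, indicator_of_mem hs, indicator_of_mem hs']
        rw [show C * Real.exp (-C * s) * (C⁻¹ * Real.exp (C * s) * Ψ s) =
          (C * C⁻¹) * (Real.exp (-C * s) * Real.exp (C * s)) * Ψ s by ring, ← Real.exp_add,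
          mul_inv_cancel₀ hC.ne']
        simp
      · simp [hψ, indicator_of_notMem hs]
    simpa only [e] using h1 ψ hψi φ hφ
  · intro φ hφ
    have h3 := (h1 (fun _ => 1) (integrable_const _) φ hφ).const_mul C⁻¹
    simpa only [one_mul, ← hmi'] using h3
  · intro G
    have h3 := (h2 G).1.const_mul C⁻¹
    simpa only [← hmi'] using h3

/-! ### Regularity of the data, trajectories in `Y`, and membership in `W(z)`. -/

namespace SlowObservableSystem

variable {p m k : ℕ} (P : SlowObservableSystem p m k)

theorem isCompact_prod : IsCompact (P.U ×ˢ P.Y) := P.isCompact_U.prod P.isCompact_Y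

theorem measurableSet_prod : MeasurableSet (P.U ×ˢ P.Y) := P.isCompact_prod.isClosed.measurableSet

theorem hasFDerivAt_F {y : EuclideanSpace ℝ (Fin m)} (hy : y ∈ P.Y) :
    HasFDerivAt P.F (fderiv ℝ P.F y) y := by
  obtain ⟨O, hO, hYO, hd, -⟩ := P.regular_F
  exact ((hd y (hYO hy)).differentiableAt (hO.mem_nhds (hYO hy))).hasFDerivAt

theorem continuousOn_fderiv_F : ContinuousOn (fderiv ℝ P.F) P.Y := by
  obtain ⟨O, -, hYO, -, K, hK⟩ := P.regular_F
  exact hK.continuousOn.mono hYO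

theorem continuousOn_F : ContinuousOn P.F P.Y := fun _ hy =>
  (P.hasFDerivAt_F hy).continuousAt.continuousWithinAt

/-- Continuity of `F` is known only near `Y`; for `z ∈ Z` the level set lies in `Y`, which suffices.
-/
theorem isClosed_level {z : EuclideanSpace ℝ (Fin k)} (hz : z ∈ P.Z) : IsClosed (P.level z) := by
  have h : P.level z = P.Y ∩ P.F ⁻¹' {z} := by
    ext y
    exact ⟨fun hy => ⟨P.level_subset z hz hy, hy⟩, fun hy => hy.2⟩
  rw [h]
  exact P.continuousOn_F.preimage_isClosed_of_isClosed P.isCompact_Y.isClosed isClosed_singleton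

theorem continuousOn_clm_apply {G : Type*} [NormedAddCommGroup G] [NormedSpace ℝ G]
    {D : EuclideanSpace ℝ (Fin m) → EuclideanSpace ℝ (Fin m) →L[ℝ] G}
    (hD : ContinuousOn D P.Y)
    {v : EuclideanSpace ℝ (Fin p) → EuclideanSpace ℝ (Fin m) → EuclideanSpace ℝ (Fin m)}
    (hv : ContinuousOn (Function.uncurry v) (P.U ×ˢ univ)) :
    ContinuousOn (fun q : EuclideanSpace ℝ (Fin p) × EuclideanSpace ℝ (Fin m) =>
      D q.2 (v q.1 q.2)) (P.U ×ˢ P.Y) :=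
  (hD.comp continuousOn_snd fun _ hq => hq.2).clm_apply
    (hv.mono (prod_mono_right (subset_univ _)))

theorem continuousOn_h : ContinuousOn (Function.uncurry P.h) (P.U ×ˢ P.Y) :=
  P.continuousOn_clm_apply P.continuousOn_fderiv_F P.continuousOn_g

theorem continuousOn_r' : ContinuousOn (Function.uncurry P.r) (P.U ×ˢ P.Y) :=
  P.continuousOn_r.mono (prod_mono_right (subset_univ _))

variable {P} in
theorem IsControl.aestronglyMeasurable_comp {B : Type*} [NormedAddCommGroup B]
    [SecondCountableTopology B]
    {φ : EuclideanSpace ℝ (Fin p) → EuclideanSpace ℝ (Fin m) → B}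
    {D : Set (EuclideanSpace ℝ (Fin m))} (hD : IsClosed D)
    (hφ : ContinuousOn (Function.uncurry φ) (P.U ×ˢ D)) {u : ℝ → EuclideanSpace ℝ (Fin p)}
    (hu : P.IsControl u) {y : ℝ → EuclideanSpace ℝ (Fin m)} {s : Set ℝ} (hs : MeasurableSet s)
    (hs0 : s ⊆ Ici 0) (hy : ContinuousOn y (Ici 0)) (hyD : ∀ t ∈ s, y t ∈ D) :
    AEStronglyMeasurable (fun t => φ (u t) (y t)) (volume.restrict s) := by
  refine aestronglyMeasurable_comp_of_continuousOn (w := fun t => (u t, y t)) hφ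
    (P.isCompact_U.isClosed.prod hD).measurableSet
    (hu.1.aemeasurable.prodMk ((hy.mono hs0).aemeasurable hs)) ?_
  filter_upwards [ae_restrict_mem hs] with t ht
  exact ⟨hu.2 t (hs0 ht), hyD t ht⟩

variable {P} in
theorem IsControl.intervalIntegrable_comp {B : Type*} [NormedAddCommGroup B]
    [SecondCountableTopology B]
    {φ : EuclideanSpace ℝ (Fin p) → EuclideanSpace ℝ (Fin m) → B}
    {D : Set (EuclideanSpace ℝ (Fin m))} (hD : IsClosed D)
    (hφ : ContinuousOn (Function.uncurry φ) (P.U ×ˢ D)) {u : ℝ → EuclideanSpace ℝ (Fin p)}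
    (hu : P.IsControl u) {y : ℝ → EuclideanSpace ℝ (Fin m)} {a b : ℝ} (ha : 0 ≤ a) (hab : a ≤ b)
    (hy : ContinuousOn y (Ici 0)) (hyD : ∀ t ∈ Icc a b, y t ∈ D) :
    IntervalIntegrable (fun t => φ (u t) (y t)) volume a b := by
  have hsub : Icc a b ⊆ Ici 0 := fun t ht => ha.trans ht.1
  have hK : IsCompact (P.U ×ˢ (y '' Icc a b)) :=
    P.isCompact_U.prod (isCompact_Icc.image_of_continuousOn (hy.mono hsub))
  obtain ⟨M, hM⟩ := hK.exists_bound_of_continuousOn (hφ.mono (prod_mono_right (by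
    rintro _ ⟨t, ht, rfl⟩; exact hyD t ht)))
  rw [intervalIntegrable_iff_integrableOn_Icc_of_le hab]
  refine IntegrableOn.of_bound measure_Icc_lt_top
    (hu.aestronglyMeasurable_comp hD hφ measurableSet_Icc hsub hy hyD) M ?_
  filter_upwards [ae_restrict_mem measurableSet_Icc] with t ht
  exact hM (u t, y t) ⟨hu.2 t (hsub ht), mem_image_of_mem y ht⟩

variable {P} in
theorem IsPerturbedSolution.apply_zero {ε : ℝ} {u : ℝ → EuclideanSpace ℝ (Fin p)}
    {y₀ : EuclideanSpace ℝ (Fin m)} {y : ℝ → EuclideanSpace ℝ (Fin m)}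
    (h : P.IsPerturbedSolution ε u y₀ y) : y 0 = y₀ := by
  simpa using h.2 0 le_rfl

/-- The velocity of the perturbed system is continuous. -/
theorem continuousOn_perturbed (a b : ℝ) :
    ContinuousOn (Function.uncurry fun u y => a • P.f u y + b • P.g u y) (P.U ×ˢ univ) :=
  (P.continuousOn_f.const_smul a).add (P.continuousOn_g.const_smul b)

/-- The chain rule along a trajectory of `y' = a f(u, y) + b g(u, y)` that stays in `Y`. -/
theorem sub_eq_integral_of_trajectory {G : Type*} [NormedAddCommGroup G] [NormedSpace ℝ G]
    [CompleteSpace G] {φ : EuclideanSpace ℝ (Fin m) → G}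
    {D : EuclideanSpace ℝ (Fin m) → EuclideanSpace ℝ (Fin m) →L[ℝ] G}
    (hD : ContinuousOn D P.Y) (hφ : ∀ y ∈ P.Y, HasFDerivAt φ (D y) y)
    {u : ℝ → EuclideanSpace ℝ (Fin p)} (hu : P.IsControl u)
    {y : ℝ → EuclideanSpace ℝ (Fin m)} (hy : ContinuousOn y (Ici 0)) {α β : ℝ}
    {y₀ : EuclideanSpace ℝ (Fin m)}
    (hsol : ∀ t, 0 ≤ t → y t = y₀ + ∫ s in (0 : ℝ)..t, (α • P.f (u s) (y s) + β • P.g (u s) (y s)))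
    {a b : ℝ} (ha : 0 ≤ a) (hab : a ≤ b) (hyY : ∀ t ∈ Icc a b, y t ∈ P.Y) :
    φ (y b) - φ (y a) =
      ∫ s in a..b, (α • D (y s) (P.f (u s) (y s)) + β • D (y s) (P.g (u s) (y s))) := by
  have hint : ∀ s t : ℝ, 0 ≤ s → s ≤ t → IntervalIntegrable
      (fun s => α • P.f (u s) (y s) + β • P.g (u s) (y s)) volume s t := fun s t hs hst =>
    hu.intervalIntegrable_comp (φ := fun u y => α • P.f u y + β • P.g u y) isClosed_univ
      (P.continuousOn_perturbed α β) hs hst hy fun _ _ => mem_univ _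
  obtain ⟨M, hM⟩ := P.isCompact_prod.exists_bound_of_continuousOn
    ((P.continuousOn_perturbed α β).mono (prod_mono_right (subset_univ _)))
  have h := (sub_eq_integral_of_hasFDerivAt (F := φ) (F' := D) (y := y)
    (v := fun s => α • P.f (u s) (y s) + β • P.g (u s) (y s)) (M := M) hab (hint a b ha hab)
    (fun t ht => hM (u t, y t) ⟨hu.2 t (ha.trans ht.1), hyY t ht⟩) ?_
    (fun t ht => hφ _ (hyY t ht))
    (hD.comp (hy.mono fun t ht => ha.trans ht.1) fun t ht => hyY t ht)).2
  · simpa only [map_add, map_smul] using h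
  · intro t ht
    rw [hsol t (ha.trans ht.1), hsol a ha, add_assoc,
      intervalIntegral.integral_add_adjacent_intervals (hint 0 a le_rfl ha) (hint a t ha ht.1)]

variable {P} in
/-- Along a perturbed trajectory in `Y`, the observables satisfy `z' = h(u, y)`. -/
theorem IsPerturbedSolution.F_sub_eq {ε : ℝ} {u : ℝ → EuclideanSpace ℝ (Fin p)}
    (hu : P.IsControl u) {y₀ : EuclideanSpace ℝ (Fin m)} {y : ℝ → EuclideanSpace ℝ (Fin m)}
    (h : P.IsPerturbedSolution ε u y₀ y) {a b : ℝ} (ha : 0 ≤ a) (hab : a ≤ b)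
    (hyY : ∀ t ∈ Icc a b, y t ∈ P.Y) :
    P.F (y b) - P.F (y a) = ∫ s in a..b, P.h (u s) (y s) := by
  rw [P.sub_eq_integral_of_trajectory P.continuousOn_fderiv_F (fun y hy => P.hasFDerivAt_F hy) hu h.1
    (α := ε⁻¹) (β := 1) (y₀ := y₀) (by simpa only [one_smul] using h.2) ha hab hyY]
  refine intervalIntegral.integral_congr fun s hs => ?_
  rw [uIcc_of_le hab] at hs
  simp only [P.constant_of_motion (u s) (hu.2 s (ha.trans hs.1)) (y s) (hyY s hs), smul_zero,
    zero_add, one_smul]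
  rfl

/-- A reduced trajectory conserves the observables while it stays in `Y`. -/
theorem F_eq_of_reduced {u : ℝ → EuclideanSpace ℝ (Fin p)}
    (hu : P.IsControl u) {y₀ : EuclideanSpace ℝ (Fin m)} {y : ℝ → EuclideanSpace ℝ (Fin m)}
    (h : P.IsReducedSolution u y₀ y) {a b : ℝ} (ha : 0 ≤ a) (hab : a ≤ b)
    (hyY : ∀ t ∈ Icc a b, y t ∈ P.Y) : P.F (y b) = P.F (y a) := by
  rw [← sub_eq_zero,
    P.sub_eq_integral_of_trajectory P.continuousOn_fderiv_F (fun y hy => P.hasFDerivAt_F hy) hu h.1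
    (α := 1) (β := 0) (y₀ := y₀) (by simpa only [one_smul, zero_smul, add_zero] using h.2) ha hab
    hyY, ← intervalIntegral.integral_zero (a := a) (b := b) (E := EuclideanSpace ℝ (Fin k))]
  refine intervalIntegral.integral_congr fun s hs => ?_
  rw [uIcc_of_le hab] at hs
  simp only [P.constant_of_motion (u s) (hu.2 s (ha.trans hs.1)) (y s) (hyY s hs), smul_zero,
    zero_add, zero_smul]

/-- The support has full measure, and it lies in any closed set of full measure. As `U × Y_z` is
closed for `z ∈ Z`, the conditions on the support become an almost-everywhere statement, and the
restriction of the integral can be dropped. -/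
theorem mem_W_iff {z : EuclideanSpace ℝ (Fin k)} (hz : z ∈ P.Z)
    {μ : Measure (EuclideanSpace ℝ (Fin p) × EuclideanSpace ℝ (Fin m))} :
    μ ∈ P.W z ↔ IsProbabilityMeasure μ ∧ (∀ᵐ q ∂μ, q ∈ P.U ×ˢ P.level z) ∧
      ∀ φ : EuclideanSpace ℝ (Fin m) → ℝ, ContDiff ℝ 1 φ →
        ∫ q, fderiv ℝ φ q.2 (P.f q.1 q.2) ∂μ = 0 := by
  have hcl : IsClosed (P.U ×ˢ P.level z) := P.isCompact_U.isClosed.prod (P.isClosed_level hz)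
  have hsub : P.U ×ˢ P.level z ⊆ P.U ×ˢ P.Y := prod_mono_right (P.level_subset z hz)
  constructor
  · rintro ⟨h1, -, h3, h4⟩
    have hae : ∀ᵐ q ∂μ, q ∈ P.U ×ˢ P.level z := by
      filter_upwards [Measure.support_mem_ae (μ := μ)] with q hq using h3 hq
    refine ⟨h1, hae, fun φ hφ => ?_⟩
    have := h4 φ hφ
    rwa [Measure.restrict_eq_self_of_ae_mem hae] at this
  · rintro ⟨h1, hae, h4⟩
    have h3 := Measure.support_subset_of_isClosed hcl hae
    refine ⟨h1, h3.trans hsub, h3, fun φ hφ => ?_⟩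
    rw [Measure.restrict_eq_self_of_ae_mem hae]
    exact h4 φ hφ

end SlowObservableSystem

/-! ### The lower bound: Young measure limits are averaged solutions. -/

theorem tendsto_intervalIntegral_of_coord {k : ℕ} {c : ℕ → ℝ → EuclideanSpace ℝ (Fin k)}
    {c₀ : ℝ → EuclideanSpace ℝ (Fin k)} {a b : ℝ} (hc : ∀ n, IntervalIntegrable (c n) volume a b)
    (hc₀ : IntervalIntegrable c₀ volume a b)
    (h : ∀ i, Tendsto (fun n => ∫ s in a..b, c n s i) atTop (𝓝 (∫ s in a..b, c₀ s i))) :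
    Tendsto (fun n => ∫ s in a..b, c n s) atTop (𝓝 (∫ s in a..b, c₀ s)) := by
  have e : ∀ c : ℝ → EuclideanSpace ℝ (Fin k), IntervalIntegrable c volume a b → ∀ i,
      (∫ s in a..b, c s) i = ∫ s in a..b, c s i := fun c hc i =>
    ((EuclideanSpace.proj i : EuclideanSpace ℝ (Fin k) →L[ℝ] ℝ).intervalIntegral_comp_comm hc).symm
  rw [(PiLp.homeomorph 2 fun _ : Fin k => ℝ).isInducing.tendsto_nhds_iff, tendsto_pi_nhds]
  intro i
  have h2 := h i
  simp only [← e _ (hc _), ← e _ hc₀] at h2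
  exact h2

/-- The gradients of the `C¹` functions form a separable set for uniform convergence on a compact
set. -/
theorem exists_countable_dense_fderiv {m : ℕ} {Y : Set (EuclideanSpace ℝ (Fin m))}
    (hY : IsCompact Y) :
    ∃ φ : ℕ → EuclideanSpace ℝ (Fin m) → ℝ, (∀ n, ContDiff ℝ 1 (φ n)) ∧
      ∀ ψ : EuclideanSpace ℝ (Fin m) → ℝ, ContDiff ℝ 1 ψ → ∀ δ > 0, ∃ n, ∀ y ∈ Y,
        ‖fderiv ℝ ψ y - fderiv ℝ (φ n) y‖ ≤ δ := by
  have := isCompact_iff_compactSpace.1 hY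
  let I := {φ : EuclideanSpace ℝ (Fin m) → ℝ // ContDiff ℝ 1 φ}
  let T : I → C(Y, EuclideanSpace ℝ (Fin m) →L[ℝ] ℝ) := fun φ =>
    ⟨fun y => fderiv ℝ φ.1 y, (φ.2.continuous_fderiv one_ne_zero).comp continuous_subtype_val⟩
  have : Nonempty (range T) := ⟨⟨T ⟨fun _ => 0, contDiff_const⟩, mem_range_self _⟩⟩
  -- The space `C(Y, ·)` is separable and metrizable, so the subset of gradients is itself
  -- separable: the dense sequence can be taken among gradients.
  choose φ hφ using fun n => (TopologicalSpace.denseSeq (range T) n).2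
  refine ⟨fun n => (φ n).1, fun n => (φ n).2, fun ψ hψ δ hδ => ?_⟩
  have hopen : IsOpen {x : range T | dist (T ⟨ψ, hψ⟩) x.1 < δ} :=
    isOpen_lt (continuous_const.dist continuous_subtype_val) continuous_const
  obtain ⟨n, hn⟩ := (TopologicalSpace.denseRange_denseSeq (range T)).exists_mem_open hopen
    ⟨⟨T ⟨ψ, hψ⟩, mem_range_self _⟩, by simpa using hδ⟩
  refine ⟨n, fun y hy => ?_⟩
  have hn' : dist (T ⟨ψ, hψ⟩) (T (φ n)) < δ := by rw [hφ n]; exact hn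
  have := (ContinuousMap.dist_lt_iff hδ).1 hn' ⟨y, hy⟩
  rw [dist_eq_norm] at this
  exact this.le

namespace SlowObservableSystem

variable {p m k : ℕ} (P : SlowObservableSystem p m k)

theorem setIntegral_map_val {B : Type*} [NormedAddCommGroup B] [NormedSpace ℝ B]
    (κ : Measure (P.U ×ˢ P.Y : Set (EuclideanSpace ℝ (Fin p) × EuclideanSpace ℝ (Fin m))))
    (H : EuclideanSpace ℝ (Fin p) × EuclideanSpace ℝ (Fin m) → B) :
    ∫ q in P.U ×ˢ P.Y, H q ∂(κ.map Subtype.val) = ∫ x, H x ∂κ := by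
  rw [(MeasurableEmbedding.subtype_coe P.measurableSet_prod).setIntegral_map]
  simp

/-- The lower bound: costs along a sequence `ε n → 0` of trajectories in `Y` whose observables stay
in a compact subset of `Z` are asymptotically bounded below by the averaged value. -/
theorem averagedValue_le_of_seq {y₀ : EuclideanSpace ℝ (Fin m)} {ε : ℕ → ℝ} (hε0 : ∀ n, 0 < ε n)
    (hε : Tendsto ε atTop (𝓝 0)) {u : ℕ → ℝ → EuclideanSpace ℝ (Fin p)}
    {y : ℕ → ℝ → EuclideanSpace ℝ (Fin m)} {Zc : Set (EuclideanSpace ℝ (Fin k))}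
    (hZc : IsCompact Zc) (hZcZ : Zc ⊆ P.Z) (hu : ∀ n, P.IsControl (u n))
    (hy : ∀ n, P.IsPerturbedSolution (ε n) (u n) y₀ (y n))
    (hyY : ∀ n t, 0 ≤ t → y n t ∈ P.Y) (hyZ : ∀ n t, 0 ≤ t → P.F (y n t) ∈ Zc) {a : EReal}
    (ha : ∀ n, ((∫ t in Ioi (0 : ℝ), Real.exp (-P.C * t) * P.r (u n t) (y n t) : ℝ) : EReal) ≤ a) :
    P.averagedValue y₀ ≤ a := by
  let K : Set (EuclideanSpace ℝ (Fin p) × EuclideanSpace ℝ (Fin m)) := P.U ×ˢ P.Y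
  have hKc : CompactSpace K := isCompact_iff_compactSpace.1 P.isCompact_prod
  have hmem : ∀ n t, (u n (max t 0), y n (max t 0)) ∈ K := fun n t =>
    ⟨(hu n).2 _ (le_max_right _ _), hyY n _ (le_max_right _ _)⟩
  -- Times are clipped at `0`, because controls and trajectories are constrained only for `t ≥ 0`
  -- while a Young measure needs values in `K` at all times.
  let w : ℕ → ℝ → K := fun n t => ⟨(u n (max t 0), y n (max t 0)), hmem n t⟩
  have hKne : Nonempty K := ⟨w 0 0⟩
  have hmaxm : Continuous fun t : ℝ => max t 0 := by fun_prop
  have hycont : ∀ n, Continuous fun t => y n (max t 0) := fun n =>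
    (hy n).1.comp_continuous hmaxm fun t => mem_Ici.2 (le_max_right _ _)
  have hw : ∀ n, Measurable (w n) := fun n =>
    (((hu n).1.comp hmaxm.measurable).prodMk (hycont n).measurable).subtype_mk
  have hwt : ∀ n t, 0 ≤ t → (w n t : _ × _) = (u n t, y n t) := fun n t ht => by
    simp only [w, max_eq_left ht]
  obtain ⟨κ, θ, hκ, hθ, hI, hD, hG⟩ := exists_subseq_tendsto_kernel_Ioi P.C_pos hw
  set μ : ℝ → Measure (EuclideanSpace ℝ (Fin p) × EuclideanSpace ℝ (Fin m)) :=
    fun t => (κ t).map Subtype.val with hμ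
  have hμm : Measurable μ := (Measure.measurable_map _ measurable_subtype_coe).comp κ.measurable
  -- continuous functions on `K`
  have hhc : Continuous fun x : K => P.h x.1.1 x.1.2 :=
    continuousOn_iff_continuous_domRestrict.1 P.continuousOn_h
  have hrc : Continuous fun x : K => P.r x.1.1 x.1.2 :=
    continuousOn_iff_continuous_domRestrict.1 P.continuousOn_r'
  have hFc : Continuous fun x : K => P.F x.1.2 :=
    P.continuousOn_F.comp_continuous (continuous_snd.comp continuous_subtype_val) fun x => x.2.2
  have hhAve : ∀ t, P.hAve (μ t) = ∫ x : K, P.h x.1.1 x.1.2 ∂(κ t) := fun t =>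
    P.setIntegral_map_val (κ t) fun q => P.h q.1 q.2
  have hrAve : ∀ t, P.rAve (μ t) = ∫ x : K, P.r x.1.1 x.1.2 ∂(κ t) := fun t =>
    P.setIntegral_map_val (κ t) fun q => P.r q.1 q.2
  have hbd : ∀ {B : Type} [NormedAddCommGroup B] {φ : K → B}, Continuous φ →
      ∃ M, ∀ x, ‖φ x‖ ≤ M := by
    intro B _ φ hφ
    obtain ⟨M, hM⟩ := isCompact_univ.exists_bound_of_continuousOn hφ.continuousOn
    exact ⟨M, fun x => hM x (mem_univ x)⟩
  have hbdI : ∀ {B : Type} [NormedAddCommGroup B] [NormedSpace ℝ B] {φ : K → B} {M : ℝ},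
      (∀ x, ‖φ x‖ ≤ M) → ∀ t, ‖∫ x, φ x ∂(κ t)‖ ≤ M := by
    intro B _ _ φ M hM t
    refine (norm_integral_le_of_norm_le_const (Eventually.of_forall hM)).trans (by simp)
  obtain ⟨Mh, hMh⟩ := hbd hhc
  obtain ⟨Mr, hMr⟩ := hbd hrc
  have hhsm : StronglyMeasurable fun t => P.hAve (μ t) := by
    simp only [hhAve]; exact hhc.stronglyMeasurable.integral_kernel
  have hrsm : StronglyMeasurable fun t => P.rAve (μ t) := by
    simp only [hrAve]; exact hrc.stronglyMeasurable.integral_kernel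
  have hhii : ∀ s t : ℝ, IntervalIntegrable (fun τ => P.hAve (μ τ)) volume s t := fun s t => by
    refine (intervalIntegrable_const (c := Mh)).mono_fun hhsm.aestronglyMeasurable
      (Eventually.of_forall fun τ => ?_)
    simp only [hhAve]
    exact (hbdI hMh τ).trans (le_abs_self _)
  set z : ℝ → EuclideanSpace ℝ (Fin k) := fun t => P.F y₀ + ∫ s in (0 : ℝ)..t, P.hAve (μ s) with hz
  have hzc : Continuous z := continuous_const.add (intervalIntegral.continuous_primitive hhii 0)
  have hFy : ∀ n t, 0 ≤ t → P.F (y n t) = P.F y₀ + ∫ s in (0 : ℝ)..t, P.h (w n s).1.1 (w n s).1.2 := by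
    intro n t ht
    have h1 := (hy n).F_sub_eq (hu n) le_rfl ht fun s hs => hyY n s hs.1
    rw [(hy n).apply_zero, sub_eq_iff_eq_add'] at h1
    rw [h1]
    congr 1
    refine intervalIntegral.integral_congr fun s hs => ?_
    rw [uIcc_of_le ht] at hs
    simp only [hwt n s hs.1]
  have hzlim : ∀ t, 0 ≤ t → Tendsto (fun n => P.F (y (θ n) t)) atTop (𝓝 (z t)) := by
    intro t ht
    simp only [fun n => hFy (θ n) t ht, hz]
    refine tendsto_const_nhds.add (tendsto_intervalIntegral_of_coord ?_ (hhii 0 t) ?_)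
    · intro n
      refine (intervalIntegrable_const (c := Mh)).mono_fun
        (hhc.measurable.comp (hw _)).aestronglyMeasurable (Eventually.of_forall fun τ => ?_)
      exact (hMh _).trans (le_abs_self _)
    · intro i
      have h1 := hI (fun x => P.h x.1.1 x.1.2 i)
        ((EuclideanSpace.proj i : EuclideanSpace ℝ (Fin k) →L[ℝ] ℝ).continuous.comp hhc) t ht
      have e : ∀ s, (P.hAve (μ s)) i = ∫ x : K, P.h x.1.1 x.1.2 i ∂(κ s) := fun s => by
        rw [hhAve]
        exact ((EuclideanSpace.proj i : EuclideanSpace ℝ (Fin k) →L[ℝ] ℝ).integral_comp_comm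
          (Integrable.of_bound hhc.aestronglyMeasurable Mh (Eventually.of_forall hMh))).symm
      simp only [e]
      exact h1
  have hzZc : ∀ t, 0 ≤ t → z t ∈ Zc := fun t ht =>
    hZc.isClosed.mem_of_tendsto (hzlim t ht) (Eventually.of_forall fun n => hyZ _ t ht)
  -- the limit measures are supported in the level sets
  have hsupp : ∀ᵐ t ∂(volume.restrict (Ioi (0 : ℝ))), ∀ᵐ x ∂(κ t), P.F x.1.2 = z t := by
    obtain ⟨MF, hMF⟩ := hbd hFc
    obtain ⟨Mz, hMz⟩ := hZc.isBounded.exists_norm_le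
    -- A test function of time and state jointly, measuring the distance of the observables from the
    -- limit path. Along the trajectories its discounted integral tends to `0`; its limit is the
    -- same integral against `κ`, and since `G ≥ 0` almost every `κ t` is carried by `{F = z t}`.
    let G : BoundedContinuousFunction (ℝ × K) ℝ :=
      BoundedContinuousFunction.ofNormedAddCommGroup
        (fun q : ℝ × K => ‖P.F q.2.1.2 - z (max q.1 0)‖)
        ((hFc.comp continuous_snd).sub (hzc.comp (hmaxm.comp continuous_fst))).norm (MF + Mz)
        (fun q => by
          rw [norm_norm]
          exact (norm_sub_le _ _).trans (add_le_add (hMF _) (hMz _ (hzZc _ (le_max_right _ _)))))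
    have hGdef : ∀ q, G q = ‖P.F q.2.1.2 - z (max q.1 0)‖ := fun _ => rfl
    have hexp : IntegrableOn (fun t => Real.exp (-P.C * t)) (Ioi 0) :=
      integrableOn_exp_mul_Ioi (by linarith [P.C_pos]) 0
    have h0 : Tendsto (fun n => ∫ s in Ioi (0 : ℝ), Real.exp (-P.C * s) * G (s, w (θ n) s)) atTop
        (𝓝 (∫ s in Ioi (0 : ℝ), (0 : ℝ))) := by
      refine tendsto_integral_of_dominated_convergence
        (fun t => Real.exp (-P.C * t) * (MF + Mz)) ?_ (hexp.mul_const _) ?_ ?_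
      · intro n
        exact (by fun_prop : Continuous fun s => Real.exp (-P.C * s)).aestronglyMeasurable.mul
          (G.continuous.measurable.comp (measurable_id.prodMk (hw _))).aestronglyMeasurable
      · intro n
        refine Eventually.of_forall fun s => ?_
        rw [norm_mul, Real.norm_of_nonneg (Real.exp_pos _).le]
        gcongr
        rw [hGdef, norm_norm]
        exact (norm_sub_le _ _).trans (add_le_add (hMF _) (hMz _ (hzZc _ (le_max_right _ _))))
      · filter_upwards [ae_restrict_mem measurableSet_Ioi] with s hs
        have hs0 : (0 : ℝ) ≤ s := le_of_lt hs
        have h1 : Tendsto (fun n => ‖P.F (y (θ n) s) - z s‖) atTop (𝓝 ‖z s - z s‖) :=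
          ((hzlim s hs0).sub tendsto_const_nhds).norm
        simp only [hGdef, hwt _ s hs0, max_eq_left hs0]
        simpa using h1.const_mul (Real.exp (-P.C * s))
    have h1 := tendsto_nhds_unique (hG G) h0
    rw [integral_zero] at h1
    have hGm : StronglyMeasurable fun s => ∫ x, G (s, x) ∂(κ s) :=
      StronglyMeasurable.integral_kernel_prod_right' G.continuous.stronglyMeasurable
    have hGb : ∀ s, ‖∫ x, G (s, x) ∂(κ s)‖ ≤ ‖G‖ := fun s =>
      hbdI (fun x => G.norm_coe_le_norm (s, x)) s
    have hGint : IntegrableOn (fun s => Real.exp (-P.C * s) * ∫ x, G (s, x) ∂(κ s)) (Ioi 0) :=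
      integrableOn_exp_mul_of_bounded P.C_pos hGm.aestronglyMeasurable
        (Eventually.of_forall hGb)
    have hG0 : ∀ q, 0 ≤ G q := fun q => by rw [hGdef]; exact norm_nonneg _
    rw [integral_eq_zero_iff_of_nonneg (fun s => mul_nonneg (Real.exp_pos _).le
      (integral_nonneg fun x => hG0 (s, x))) hGint] at h1
    filter_upwards [h1, ae_restrict_mem measurableSet_Ioi] with s hs hs0
    have hs1 : ∫ x, G (s, x) ∂(κ s) = 0 := by
      simpa [(Real.exp_pos _).ne'] using hs
    rw [integral_eq_zero_iff_of_nonneg (fun x => hG0 (s, x))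
      (Integrable.of_bound (G.continuous.comp (Continuous.prodMk_right s)).aestronglyMeasurable ‖G‖
        (Eventually.of_forall fun x => G.norm_coe_le_norm _))] at hs1
    filter_upwards [hs1] with x hx
    have hx' : ‖P.F x.1.2 - z (max s 0)‖ = 0 := hx
    rw [max_eq_left (le_of_lt hs0), norm_eq_zero, sub_eq_zero] at hx'
    exact hx'
  -- the limit measures satisfy the stationarity condition
  have hinv : ∀ φ : EuclideanSpace ℝ (Fin m) → ℝ, ContDiff ℝ 1 φ →
      ∀ᵐ t ∂(volume.restrict (Ioi (0 : ℝ))),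
        ∫ x : K, fderiv ℝ φ x.1.2 (P.f x.1.1 x.1.2) ∂(κ t) = 0 := by
    intro φ hφ
    have hDc : Continuous (fderiv ℝ φ) := hφ.continuous_fderiv one_ne_zero
    have hΦ : Continuous fun x : K => fderiv ℝ φ x.1.2 (P.f x.1.1 x.1.2) :=
      continuousOn_iff_continuous_domRestrict.1
        (P.continuousOn_clm_apply hDc.continuousOn P.continuousOn_f)
    have hΨ : Continuous fun x : K => fderiv ℝ φ x.1.2 (P.g x.1.1 x.1.2) :=
      continuousOn_iff_continuous_domRestrict.1
        (P.continuousOn_clm_apply hDc.continuousOn P.continuousOn_g)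
    obtain ⟨MΦ, hMΦ⟩ := hbd hΦ
    obtain ⟨MΨ, hMΨ⟩ := hbd hΨ
    obtain ⟨Mφ, hMφ⟩ := P.isCompact_Y.exists_bound_of_continuousOn hφ.continuous.continuousOn
    refine ae_eq_zero_of_intervalIntegral_eq_zero
      (locallyIntegrable_of_bounded hΦ.stronglyMeasurable.integral_kernel (hbdI hMΦ)) ?_
    intro t ht
    refine tendsto_nhds_unique (hI _ hΦ t ht) ?_
    have hii : ∀ n (φ : K → ℝ) (M : ℝ), Continuous φ → (∀ x, ‖φ x‖ ≤ M) →
        IntervalIntegrable (fun s => φ (w n s)) volume 0 t := fun n φ M hφ hM =>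
      (intervalIntegrable_const (c := M)).mono_fun
        (hφ.measurable.comp (hw _)).aestronglyMeasurable
        (Eventually.of_forall fun τ => (hM _).trans (le_abs_self _))
    -- The chain rule for `φ(y)` multiplied by `ε n`: everything except the integral of `φ' f` is
    -- bounded on `[0, t]` uniformly in `n`, so this integral is `O(ε n)`.
    have hid : ∀ n, ∫ s in (0 : ℝ)..t, fderiv ℝ φ (w n s).1.2 (P.f (w n s).1.1 (w n s).1.2) =
        ε n * (φ (y n t) - φ (y n 0) -
          ∫ s in (0 : ℝ)..t, fderiv ℝ φ (w n s).1.2 (P.g (w n s).1.1 (w n s).1.2)) := by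
      intro n
      have h1 := P.sub_eq_integral_of_trajectory (φ := φ) hDc.continuousOn
        (fun y _ => (hφ.differentiable one_ne_zero y).hasFDerivAt) (hu n) (hy n).1
        (α := (ε n)⁻¹) (β := 1) (y₀ := y₀) (by simpa only [one_smul] using (hy n).2) le_rfl ht
        fun s hs => hyY n s hs.1
      have h2 : ∫ s in (0 : ℝ)..t, ((ε n)⁻¹ • fderiv ℝ φ (y n s) (P.f (u n s) (y n s)) +
          (1 : ℝ) • fderiv ℝ φ (y n s) (P.g (u n s) (y n s))) =
          ∫ s in (0 : ℝ)..t, ((ε n)⁻¹ * fderiv ℝ φ (w n s).1.2 (P.f (w n s).1.1 (w n s).1.2) +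
            fderiv ℝ φ (w n s).1.2 (P.g (w n s).1.1 (w n s).1.2)) := by
        refine intervalIntegral.integral_congr fun s hs => ?_
        rw [uIcc_of_le ht] at hs
        simp only [hwt n s hs.1, smul_eq_mul, one_mul]
      rw [h2, intervalIntegral.integral_add ((hii n _ MΦ hΦ hMΦ).const_mul _) (hii n _ MΨ hΨ hMΨ),
        intervalIntegral.integral_const_mul] at h1
      rw [h1, add_sub_cancel_right, mul_inv_cancel_left₀ (hε0 n).ne']
    simp only [hid]
    have hεθ : Tendsto (fun n => ε (θ n) * (Mφ + Mφ + MΨ * |t - 0|)) atTop (𝓝 0) := by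
      simpa using (hε.comp hθ.tendsto_atTop).mul_const (Mφ + Mφ + MΨ * |t - 0|)
    refine squeeze_zero_norm (fun n => ?_) hεθ
    rw [norm_mul, Real.norm_of_nonneg (hε0 _).le]
    refine mul_le_mul_of_nonneg_left ?_ (hε0 _).le
    refine (norm_sub_le _ _).trans (add_le_add ((norm_sub_le _ _).trans
      (add_le_add (hMφ _ (hyY _ _ ht)) (hMφ _ (hyY _ _ le_rfl)))) ?_)
    exact intervalIntegral.norm_integral_le_of_norm_le_const fun s _ => hMΨ _
  -- The exceptional null set of `hinv` depends on the test function. A countable family with dense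
  -- gradients gives one null set, and `hMf` carries the identity over to every `C¹` function.
  obtain ⟨φ, hφ, hdense⟩ := exists_countable_dense_fderiv P.isCompact_Y
  have hinv' : ∀ᵐ t ∂(volume.restrict (Ioi (0 : ℝ))),
      ∀ n, ∫ x : K, fderiv ℝ (φ n) x.1.2 (P.f x.1.1 x.1.2) ∂(κ t) = 0 :=
    ae_all_iff.2 fun n => hinv (φ n) (hφ n)
  have hfc : Continuous fun x : K => P.f x.1.1 x.1.2 :=
    continuousOn_iff_continuous_domRestrict.1
      (P.continuousOn_f.mono (prod_mono_right (subset_univ _)))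
  obtain ⟨Mf, hMf⟩ := hbd hfc
  have hWae : ∀ᵐ t ∂(volume.restrict (Ioi (0 : ℝ))), μ t ∈ P.W (z t) := by
    filter_upwards [hsupp, hinv', ae_restrict_mem measurableSet_Ioi] with t h1 h2 ht
    have hemb := MeasurableEmbedding.subtype_coe P.measurableSet_prod
    have hK' : ∀ᵐ q ∂(μ t), q ∈ P.U ×ˢ P.level (z t) := by
      rw [hμ, hemb.ae_map_iff]
      filter_upwards [h1] with x hx
      exact ⟨x.2.1, hx⟩
    refine (P.mem_W_iff (hZcZ (hzZc t (le_of_lt ht)))).2 ⟨Measure.isProbabilityMeasure_map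
      measurable_subtype_coe.aemeasurable, hK', fun ψ hψ => ?_⟩
    rw [hμ, hemb.integral_map]
    have hMf0 : 0 ≤ Mf := (norm_nonneg _).trans (hMf (w 0 0))
    refine norm_le_zero_iff.1 (le_of_forall_pos_le_add fun δ hδ => ?_)
    rw [zero_add]
    obtain ⟨n, hn⟩ := hdense ψ hψ (δ / (Mf + 1)) (by positivity)
    have hci : ∀ χ : EuclideanSpace ℝ (Fin m) → ℝ, ContDiff ℝ 1 χ →
        Integrable (fun x : K => fderiv ℝ χ x.1.2 (P.f x.1.1 x.1.2)) (κ t) := by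
      intro χ hχ
      have hc : Continuous fun x : K => fderiv ℝ χ x.1.2 (P.f x.1.1 x.1.2) :=
        continuousOn_iff_continuous_domRestrict.1
          (P.continuousOn_clm_apply (hχ.continuous_fderiv one_ne_zero).continuousOn
            P.continuousOn_f)
      obtain ⟨M, hM⟩ := hbd hc
      exact Integrable.of_bound hc.aestronglyMeasurable M (Eventually.of_forall hM)
    rw [← sub_zero (∫ x : K, fderiv ℝ ψ x.1.2 (P.f x.1.1 x.1.2) ∂(κ t)), ← h2 n,
      ← integral_sub (hci ψ hψ) (hci _ (hφ n))]
    refine hbdI (fun x => ?_) t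
    rw [← sub_apply]
    calc _ ≤ ‖fderiv ℝ ψ x.1.2 - fderiv ℝ (φ n) x.1.2‖ * ‖P.f x.1.1 x.1.2‖ :=
          ContinuousLinearMap.le_opNorm _ _
      _ ≤ δ / (Mf + 1) * Mf := by
          gcongr
          · exact hn _ x.2.2
          · exact hMf x
      _ ≤ δ := by
          rw [div_mul_eq_mul_div, div_le_iff₀ (by positivity)]; nlinarith
  have hcost : Tendsto (fun n => ((∫ t in Ioi (0 : ℝ),
      Real.exp (-P.C * t) * P.r (u (θ n) t) (y (θ n) t) : ℝ) : EReal)) atTop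
      (𝓝 ((∫ t in Ioi (0 : ℝ), Real.exp (-P.C * t) * P.rAve (μ t) : ℝ) : EReal)) := by
    refine (continuous_coe_real_ereal.tendsto _).comp ?_
    have h1 := hD _ hrc
    simp only [← hrAve] at h1
    refine h1.congr fun n => setIntegral_congr_fun measurableSet_Ioi fun t ht => ?_
    simp only [hwt _ t (le_of_lt ht)]
  refine le_trans (sInf_le ⟨μ, z, ⟨hμm, hzc.continuousOn, fun t ht => hZcZ (hzZc t ht), ?_,
    fun t _ => rfl⟩, hasDiscountedCost_integral (integrableOn_exp_mul_of_bounded P.C_pos (M := Mr)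
      hrsm.aestronglyMeasurable (Eventually.of_forall fun t => ?_))⟩)
    (le_of_tendsto hcost (Eventually.of_forall fun n => ha _))
  · rw [← Measure.restrict_congr_set (Ioi_ae_eq_Ici (a := (0 : ℝ)))]; exact hWae
  · rw [hrAve]; exact hbdI hMr t

/-- For any `a` above the lower limit, costs below `a` occur for arbitrarily small `ε`. A sequence
of such `ε` gives the bound `a`, and `a` is arbitrary. -/
theorem averagedValue_le_liminf {y₀ : EuclideanSpace ℝ (Fin m)} (hu : P.HasAsymptoticMinimizer y₀) :
    P.averagedValue y₀ ≤ liminf (fun ε : ℝ => P.perturbedValue ε y₀) (𝓝[>] (0 : ℝ)) := by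
  obtain ⟨u, y, Zc, hZc, hZcZ, hev, hlim⟩ := hu
  rw [← hlim]
  refine le_of_forall_gt_imp_ge_of_dense fun a ha => ?_
  have hev0 : ∀ᶠ ε in 𝓝[>] (0 : ℝ), 0 < ε := eventually_mem_nhdsWithin
  obtain ⟨ε, hε, hεn⟩ := exists_seq_forall_of_frequently
    ((frequently_lt_of_liminf_lt isCobounded_ge_of_top ha).and_eventually (hev.and hev0))
  exact P.averagedValue_le_of_seq (fun n => (hεn n).2.2) (hε.mono_right nhdsWithin_le_nhds) hZc
    (hZcZ.trans interior_subset) (fun n => (hεn n).2.1.1) (fun n => (hεn n).2.1.2.1)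
    (fun n t ht => ((hεn n).2.1.2.2 t ht).1) (fun n t ht => ((hεn n).2.1.2.2 t ht).2)
    fun n => (hεn n).1.le

end SlowObservableSystem

/-! ### Carathéodory solutions and the integral Gronwall inequality. -/

/-- Global existence for `x' = G(t, x)` with `G` measurable in time and uniformly Lipschitz in
space. -/
theorem exists_caratheodory_solution {E : Type*} [NormedAddCommGroup E] [NormedSpace ℝ E]
    [CompleteSpace E] {G : ℝ → E → E} {K B : ℝ} (hK : 0 ≤ K)
    (hG : ∀ s x y, ‖G s x - G s y‖ ≤ K * ‖x - y‖) (hB : ∀ s, ‖G s 0‖ ≤ B)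
    (hm : ∀ x : ℝ → E, Continuous x → ∀ a b, IntervalIntegrable (fun s => G s (x s)) volume a b)
    (x₀ : E) :
    ∃ x : ℝ → E, Continuous x ∧ ∀ t, 0 ≤ t → x t = x₀ + ∫ s in (0 : ℝ)..t, G s (x s) := by
  -- Weighted supremum norm: with `x = e^{lt} w`, the Picard map contracts by `K / l ≤ 1 / 2`, hence
  -- has a fixed point on the whole half-line. The summand `1` gives `l ≥ 1`, used in `hzero`.
  set l : ℝ := 2 * K + 1 with hl
  have hlpos : 0 < l := by positivity
  have hB0 : 0 ≤ B := (norm_nonneg _).trans (hB 0)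
  have hmax : Continuous fun t : ℝ => max t 0 := by fun_prop
  let e : (BoundedContinuousFunction ℝ E) → ℝ → E := fun w s => Real.exp (l * s) • w s
  have he : ∀ w, Continuous (e w) := fun w => by
    have := w.continuous
    fun_prop
  have hGe : ∀ s w w', ‖G s (e w s) - G s (e w' s)‖ ≤
      K * ‖w - w'‖ * Real.exp (l * s) := by
    intro s w w'
    refine (hG s _ _).trans ?_
    rw [← smul_sub, norm_smul, Real.norm_of_nonneg (Real.exp_pos _).le]
    have := (w - w').norm_coe_le_norm s
    have h2 : ‖w s - w' s‖ ≤ ‖w - w'‖ := this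
    calc K * (Real.exp (l * s) * ‖w s - w' s‖) ≤ K * (Real.exp (l * s) * ‖w - w'‖) := by gcongr
      _ = _ := by ring
  have hexpint : ∀ t, ∫ s in (0 : ℝ)..t, Real.exp (l * s) = (Real.exp (l * t) - 1) / l := by
    intro t
    rw [intervalIntegral.integral_comp_mul_left (fun x => Real.exp x) hlpos.ne', integral_exp]
    simp [div_eq_inv_mul]
  have hdiff : ∀ w w' t, 0 ≤ t →
      ‖(∫ s in (0 : ℝ)..t, G s (e w s)) - ∫ s in (0 : ℝ)..t, G s (e w' s)‖ ≤
        2⁻¹ * ‖w - w'‖ * Real.exp (l * t) := by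
    intro w w' t ht
    rw [← intervalIntegral.integral_sub (hm _ (he w) 0 t) (hm _ (he w') 0 t)]
    have h1 := intervalIntegral.norm_integral_le_of_norm_le ht
      (Eventually.of_forall fun s _ => hGe s w w')
      (Continuous.intervalIntegrable (μ := volume) (by fun_prop) 0 t)
    refine h1.trans ?_
    rw [intervalIntegral.integral_const_mul, hexpint]
    have h2 : K * ((Real.exp (l * t) - 1) / l) ≤ 2⁻¹ * Real.exp (l * t) := by
      rw [mul_div_assoc', div_le_iff₀ hlpos]
      nlinarith [Real.exp_pos (l * t)]
    calc K * ‖w - w'‖ * ((Real.exp (l * t) - 1) / l)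
        = ‖w - w'‖ * (K * ((Real.exp (l * t) - 1) / l)) := by ring
      _ ≤ ‖w - w'‖ * (2⁻¹ * Real.exp (l * t)) := by gcongr
      _ = _ := by ring
  have hzero : ∀ t, 0 ≤ t → ‖∫ s in (0 : ℝ)..t, G s (e 0 s)‖ ≤ B * Real.exp (l * t) := by
    intro t ht
    have h1 : ‖∫ s in (0 : ℝ)..t, G s (e 0 s)‖ ≤ B * |t - 0| :=
      intervalIntegral.norm_integral_le_of_norm_le_const fun s _ => by
        simpa [e] using hB s
    refine h1.trans ?_
    rw [sub_zero, abs_of_nonneg ht]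
    gcongr
    have := Real.add_one_le_exp (l * t)
    nlinarith
  -- Clipping at `0` gives a map on functions defined on all of `ℝ`; only `t ≥ 0` matters, and only
  -- there does the weight produce a contraction.
  let T₀ : BoundedContinuousFunction ℝ E → ℝ → E := fun w t =>
    Real.exp (-(l * max t 0)) • (x₀ + ∫ s in (0 : ℝ)..max t 0, G s (e w s))
  have hT₀c : ∀ w, Continuous (T₀ w) := by
    intro w
    have h1 : Continuous fun t => ∫ s in (0 : ℝ)..t, G s (e w s) :=
      intervalIntegral.continuous_primitive (hm _ (he w)) 0
    have h2 := h1.comp hmax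
    have h3 : Continuous fun t : ℝ => Real.exp (-(l * max t 0)) := by fun_prop
    exact h3.smul (continuous_const.add h2)
  have hexp1 : ∀ t, Real.exp (-(l * t)) * Real.exp (l * t) = 1 := fun t => by
    rw [← Real.exp_add]; simp
  have hT₀b : ∀ w t, ‖T₀ w t‖ ≤ ‖x₀‖ + (2⁻¹ * ‖w‖ + B) := by
    intro w t
    have ht : 0 ≤ max t 0 := le_max_right _ _
    have h1 := hdiff w 0 _ ht
    have h2 := norm_le_norm_add_norm_sub' (∫ s in (0 : ℝ)..max t 0, G s (e w s))
      (∫ s in (0 : ℝ)..max t 0, G s (e 0 s))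
    have h3 := hzero _ ht
    rw [sub_zero] at h1
    simp only [T₀]
    rw [norm_smul, Real.norm_of_nonneg (Real.exp_pos _).le]
    have hE : 1 ≤ Real.exp (l * max t 0) := Real.one_le_exp (by positivity)
    calc Real.exp (-(l * max t 0)) * ‖x₀ + ∫ s in (0 : ℝ)..max t 0, G s (e w s)‖
        ≤ Real.exp (-(l * max t 0)) *
          ((‖x₀‖ + (2⁻¹ * ‖w‖ + B)) * Real.exp (l * max t 0)) := by
          gcongr
          refine (norm_add_le _ _).trans ?_
          nlinarith [norm_nonneg x₀]
      _ = (‖x₀‖ + (2⁻¹ * ‖w‖ + B)) *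
          (Real.exp (-(l * max t 0)) * Real.exp (l * max t 0)) := by ring
      _ = _ := by rw [hexp1, mul_one]
  let T : BoundedContinuousFunction ℝ E → BoundedContinuousFunction ℝ E := fun w =>
    BoundedContinuousFunction.ofNormedAddCommGroup (T₀ w) (hT₀c w) _ (hT₀b w)
  have hT : ContractingWith 2⁻¹ T := by
    refine ⟨by norm_num, LipschitzWith.of_dist_le_mul fun w w' => ?_⟩
    rw [BoundedContinuousFunction.dist_le (by positivity)]
    intro t
    have ht : 0 ≤ max t 0 := le_max_right _ _
    rw [dist_eq_norm, dist_eq_norm]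
    change ‖T₀ w t - T₀ w' t‖ ≤ _
    simp only [T₀]
    rw [← smul_sub, add_sub_add_left_eq_sub, norm_smul, Real.norm_of_nonneg (Real.exp_pos _).le]
    calc _ ≤ Real.exp (-(l * max t 0)) * (2⁻¹ * ‖w - w'‖ * Real.exp (l * max t 0)) := by
          gcongr
          exact hdiff w w' _ ht
      _ = 2⁻¹ * ‖w - w'‖ * (Real.exp (-(l * max t 0)) * Real.exp (l * max t 0)) := by ring
      _ ≤ _ := by rw [hexp1]; simp
  set w := hT.fixedPoint T with hw
  have hfix : T w = w := hT.fixedPoint_isFixedPt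
  refine ⟨e w, he w, fun t ht => ?_⟩
  have h1 : w t = T₀ w t := by conv_lhs => rw [← hfix]
                               rfl
  change Real.exp (l * t) • w t = _
  rw [h1]
  simp only [T₀]
  rw [max_eq_left ht, smul_smul, mul_comm, hexp1, one_smul]

/-- The right-hand side `ψ` of the hypothesis is differentiable with `ψ' = κ D ≤ κ ψ`, so the
differential form of Gronwall's inequality applies to `ψ`. -/
theorem le_mul_exp_of_le_integral {D : ℝ → ℝ} {c κ S : ℝ} (hκ : 0 ≤ κ)
    (hD : Continuous D)
    (h : ∀ t ∈ Icc 0 S, D t ≤ c + κ * ∫ s in (0 : ℝ)..t, D s) :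
    ∀ t ∈ Icc 0 S, D t ≤ c * Real.exp (κ * t) := by
  set ψ : ℝ → ℝ := fun t => c + κ * ∫ s in (0 : ℝ)..t, D s with hψ
  have hder : ∀ t, HasDerivAt ψ (κ * D t) t := fun t =>
    ((hD.integral_hasStrictDerivAt 0 t).hasDerivAt.const_mul κ).const_add c
  have hg := le_gronwallBound_of_liminf_deriv_right_le (f := ψ) (f' := fun t => κ * D t) (δ := c)
    (K := κ) (ε := 0) (a := 0) (b := S) (fun t _ => (hder t).continuousAt.continuousWithinAt)
    (fun t _ r hr => (hder t).hasDerivWithinAt.liminf_right_slope_le hr) (by simp [hψ])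
    (fun t ht => by
      rw [add_zero]
      exact mul_le_mul_of_nonneg_left (h t (Ico_subset_Icc_self ht)) hκ)
  intro t ht
  refine (h t ht).trans ((hg t ht).trans ?_)
  rw [gronwallBound_ε0, sub_zero]

/-! ### Integrals as uniformly continuous functions of the measure. -/

/-- On probability measures carried by a compact set, the integral of a continuous function is
uniformly continuous for the Lévy–Prokhorov distance. -/
theorem exists_levyProkhorov_modulus_real {Ω : Type*} [MetricSpace Ω]
    [SecondCountableTopology Ω] [MeasurableSpace Ω] [BorelSpace Ω] {K : Set Ω} (hK : IsCompact K)
    {φ : Ω → ℝ} (hφ : ContinuousOn φ K) {η : ℝ} (hη : 0 < η) :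
    ∀ᶠ δ in 𝓝[>] (0 : ℝ), ∀ μ ν : Measure Ω, IsProbabilityMeasure μ → IsProbabilityMeasure ν →
      (∀ᵐ q ∂μ, q ∈ K) → (∀ᵐ q ∂ν, q ∈ K) → levyProkhorovEDist μ ν < ENNReal.ofReal δ →
      |∫ q, φ q ∂μ - ∫ q, φ q ∂ν| ≤ η := by
  have := isCompact_iff_compactSpace.1 hK
  let φK : BoundedContinuousFunction K ℝ :=
    BoundedContinuousFunction.mkOfCompact ⟨K.domRestrict φ, continuousOn_iff_continuous_domRestrict.1 hφ⟩
  -- Tietze extension: weak convergence on `Ω` is tested by functions on all of `Ω`.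
  obtain ⟨g, -, hg⟩ := BoundedContinuousFunction.exists_norm_eq_domRestrict_eq_of_closed φK hK.isClosed
  have hgφ : ∀ q ∈ K, g q = φ q := fun q hq => by
    have := congrArg (fun f : BoundedContinuousFunction K ℝ => f ⟨q, hq⟩) hg
    exact this
  let A : Set (ProbabilityMeasure Ω) := {μ | ∀ᵐ q ∂(μ : Measure Ω), q ∈ K}
  have hA : IsCompact (closure A) := by
    refine isCompact_closure_of_isTightMeasureSet
      (isTightMeasureSet_iff_exists_isCompact_measure_compl_le.2 fun ε hε => ⟨K, hK, ?_⟩)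
    rintro _ ⟨μ, hμ, rfl⟩
    have h0 : (μ : Measure Ω) Kᶜ = 0 := hμ
    rw [h0]; exact zero_le
  let e := LevyProkhorov.probabilityMeasureHomeomorph (Ω := Ω)
  have hcont : Continuous fun μ : LevyProkhorov (ProbabilityMeasure Ω) =>
      ∫ q, g q ∂((e.symm μ : ProbabilityMeasure Ω) : Measure Ω) := by
    refine Continuous.comp (g := fun μ : ProbabilityMeasure Ω => ∫ q, g q ∂(μ : Measure Ω)) ?_
      e.symm.continuous
    exact continuous_iff_continuousAt.2 fun μ =>
      (ProbabilityMeasure.tendsto_iff_forall_integral_tendsto.1 tendsto_id) g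
  -- Measures carried by `K` form a tight family, hence a relatively compact one. The Lévy–Prokhorov
  -- metric induces the weak topology, so the integral of `g` is continuous, and uniformly
  -- continuous on the compact closure.
  have huc := (hA.image e.continuous).uniformContinuousOn_of_continuous hcont.continuousOn
  obtain ⟨δ, hδ, hδK⟩ := Metric.uniformContinuousOn_iff.1 huc η hη
  filter_upwards [Ioo_mem_nhdsGT hδ] with δ' hδ' μ ν hμ hν hμK hνK hd
  have h1 := hδK (e ⟨μ, hμ⟩) (mem_image_of_mem _ (subset_closure hμK)) (e ⟨ν, hν⟩)
    (mem_image_of_mem _ (subset_closure hνK)) (by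
      rw [dist_edist]
      refine lt_of_lt_of_le ?_ hδ'.2.le
      exact (ENNReal.lt_ofReal_iff_toReal_lt (hd.ne_top)).1 hd)
  rw [Real.dist_eq] at h1
  have h2 : ∀ ρ : Measure Ω, (∀ᵐ q ∂ρ, q ∈ K) → ∫ q, φ q ∂ρ = ∫ q, g q ∂ρ := fun ρ hρ =>
    integral_congr_ae (hρ.mono fun q hq => (hgφ q hq).symm)
  rw [h2 μ hμK, h2 ν hνK]
  exact h1.le

/-- The scalar case is applied to each coordinate; the norm of `e.symm` converts the bound on
coordinates into a bound in `B`. -/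
theorem exists_levyProkhorov_modulus {Ω : Type*} [MetricSpace Ω]
    [SecondCountableTopology Ω] [MeasurableSpace Ω] [BorelSpace Ω] {K : Set Ω} (hK : IsCompact K)
    {B : Type*} [NormedAddCommGroup B] [NormedSpace ℝ B] [FiniteDimensional ℝ B]
    {φ : Ω → B} (hφ : ContinuousOn φ K) {η : ℝ} (hη : 0 < η) :
    ∀ᶠ δ in 𝓝[>] (0 : ℝ), ∀ μ ν : Measure Ω, IsProbabilityMeasure μ → IsProbabilityMeasure ν →
      (∀ᵐ q ∂μ, q ∈ K) → (∀ᵐ q ∂ν, q ∈ K) → levyProkhorovEDist μ ν < ENNReal.ofReal δ →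
      ‖∫ q, φ q ∂μ - ∫ q, φ q ∂ν‖ ≤ η := by
  let e : B ≃L[ℝ] (Fin (Module.finrank ℝ B) → ℝ) := (Module.finBasis ℝ B).equivFunL
  have hpos : 0 < η / (‖(e.symm : (Fin (Module.finrank ℝ B) → ℝ) →L[ℝ] B)‖ + 1) := by positivity
  obtain ⟨M, hM⟩ := hK.exists_bound_of_continuousOn hφ
  have hi := fun i => exists_levyProkhorov_modulus_real hK
    (((continuous_apply i).comp e.continuous).comp_continuousOn hφ) hpos
  filter_upwards [eventually_all.2 hi] with δ hδ μ ν hμ hν hμK hνK hd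
  have hint : ∀ ρ : Measure Ω, IsProbabilityMeasure ρ → (∀ᵐ q ∂ρ, q ∈ K) → Integrable φ ρ :=
    fun ρ _ hρK => Integrable.of_bound
      (aestronglyMeasurable_comp_of_continuousOn hφ hK.isClosed.measurableSet aemeasurable_id hρK) M
      (hρK.mono fun q hq => hM q hq)
  set v := ∫ q, φ q ∂μ - ∫ q, φ q ∂ν with hv
  have hev : ‖e v‖ ≤ η / (‖(e.symm : (Fin (Module.finrank ℝ B) → ℝ) →L[ℝ] B)‖ + 1) := by
    rw [pi_norm_le_iff_of_nonneg hpos.le]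
    intro i
    have h1 := hδ i μ ν hμ hν hμK hνK hd
    let pr : B →L[ℝ] ℝ := (ContinuousLinearMap.proj (R := ℝ) (φ := fun _ => ℝ) i).comp (e : B →L[ℝ] _)
    have h2 : ∀ ρ : Measure Ω, IsProbabilityMeasure ρ → (∀ᵐ q ∂ρ, q ∈ K) →
        ∫ q, e (φ q) i ∂ρ = e (∫ q, φ q ∂ρ) i := fun ρ hρ hρK =>
      pr.integral_comp_comm (hint ρ hρ hρK)
    simp only [Function.comp_apply] at h1
    rw [h2 μ hμ hμK, h2 ν hν hνK] at h1
    rw [hv, map_sub]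
    exact h1
  calc ‖v‖ = ‖(e.symm : (Fin (Module.finrank ℝ B) → ℝ) →L[ℝ] B) (e v)‖ := by simp
    _ ≤ _ := ContinuousLinearMap.le_opNorm _ _
    _ ≤ ‖(e.symm : (Fin (Module.finrank ℝ B) → ℝ) →L[ℝ] B)‖ *
        (η / (‖(e.symm : (Fin (Module.finrank ℝ B) → ℝ) →L[ℝ] B)‖ + 1)) := by gcongr
    _ ≤ η := by
      rw [mul_div_assoc', div_le_iff₀ (by positivity)]
      nlinarith [norm_nonneg (e.symm : (Fin (Module.finrank ℝ B) → ℝ) →L[ℝ] B)]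

/-! ### Convexity of `V(z)` and time averages of averaged solutions. -/

namespace SlowObservableSystem

variable {p m k : ℕ} (P : SlowObservableSystem p m k)

/-- The pair `(h(u, y), r(u, y))` of the velocity of the observables and the running cost. -/
noncomputable def hr (u : EuclideanSpace ℝ (Fin p)) (y : EuclideanSpace ℝ (Fin m)) :
    EuclideanSpace ℝ (Fin k) × ℝ := (P.h u y, P.r u y)

/-- The pair `(h̃(μ), r̃(μ))`. -/
noncomputable def hrAve (μ : Measure (EuclideanSpace ℝ (Fin p) × EuclideanSpace ℝ (Fin m))) :
    EuclideanSpace ℝ (Fin k) × ℝ := (P.hAve μ, P.rAve μ)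

theorem continuousOn_hr : ContinuousOn (Function.uncurry P.hr) (P.U ×ˢ P.Y) :=
  P.continuousOn_h.prodMk P.continuousOn_r'

theorem exists_bound_hr : ∃ M : ℝ, 0 ≤ M ∧ ∀ u ∈ P.U, ∀ y ∈ P.Y, ‖P.hr u y‖ ≤ M := by
  obtain ⟨M, hM⟩ := P.isCompact_prod.exists_bound_of_continuousOn P.continuousOn_hr
  exact ⟨max M 0, le_max_right _ _, fun u hu y hy => (hM (u, y) ⟨hu, hy⟩).trans (le_max_left _ _)⟩

variable {P} in
theorem ae_mem_prod_of_mem_W {z : EuclideanSpace ℝ (Fin k)} (hz : z ∈ P.Z)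
    {μ : Measure (EuclideanSpace ℝ (Fin p) × EuclideanSpace ℝ (Fin m))} (hμ : μ ∈ P.W z) :
    ∀ᵐ q ∂μ, q ∈ P.U ×ˢ P.Y := by
  filter_upwards [((P.mem_W_iff hz).1 hμ).2.1] with q hq using ⟨hq.1, P.level_subset z hz hq.2⟩

theorem integrable_hr {μ : Measure (EuclideanSpace ℝ (Fin p) × EuclideanSpace ℝ (Fin m))}
    [IsFiniteMeasure μ] (hμ : ∀ᵐ q ∂μ, q ∈ P.U ×ˢ P.Y) :
    Integrable (Function.uncurry P.hr) μ := by
  obtain ⟨M, -, hM⟩ := P.exists_bound_hr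
  exact Integrable.of_bound (aestronglyMeasurable_comp_of_continuousOn P.continuousOn_hr
    P.measurableSet_prod aemeasurable_id hμ) M (hμ.mono fun q hq => hM q.1 hq.1 q.2 hq.2)

theorem hrAve_eq {μ : Measure (EuclideanSpace ℝ (Fin p) × EuclideanSpace ℝ (Fin m))}
    [IsFiniteMeasure μ] (hμ : ∀ᵐ q ∂μ, q ∈ P.U ×ˢ P.Y) :
    P.hrAve μ = ∫ q, Function.uncurry P.hr q ∂μ := by
  have hi := P.integrable_hr hμ
  have h1 : ∫ q, Function.uncurry P.hr q ∂μ = (∫ q, P.h q.1 q.2 ∂μ, ∫ q, P.r q.1 q.2 ∂μ) :=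
    integral_pair hi.fst hi.snd
  rw [h1, hrAve, hAve, rAve, Measure.restrict_eq_self_of_ae_mem hμ]

theorem convex_W {z : EuclideanSpace ℝ (Fin k)} (hz : z ∈ P.Z)
    {μ ν : Measure (EuclideanSpace ℝ (Fin p) × EuclideanSpace ℝ (Fin m))} (hμ : μ ∈ P.W z)
    (hν : ν ∈ P.W z) {a b : ℝ} (ha : 0 ≤ a) (hb : 0 ≤ b) (hab : a + b = 1) :
    ENNReal.ofReal a • μ + ENNReal.ofReal b • ν ∈ P.W z := by
  rw [mem_W_iff P hz] at hμ hν ⊢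
  obtain ⟨hμ1, hμ2, hμ3⟩ := hμ
  obtain ⟨hν1, hν2, hν3⟩ := hν
  have hsub : P.U ×ˢ P.level z ⊆ P.U ×ˢ P.Y := prod_mono_right (P.level_subset z hz)
  refine ⟨⟨?_⟩, ?_, fun φ hφ => ?_⟩
  · simp [← ENNReal.ofReal_add ha hb, hab]
  · rw [ae_add_measure_iff]
    exact ⟨Measure.ae_smul_measure hμ2 _, Measure.ae_smul_measure hν2 _⟩
  · have hc := P.continuousOn_clm_apply (hφ.continuous_fderiv one_ne_zero).continuousOn
      P.continuousOn_f
    obtain ⟨M, hM⟩ := P.isCompact_prod.exists_bound_of_continuousOn hc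
    have hi : ∀ ρ : Measure (EuclideanSpace ℝ (Fin p) × EuclideanSpace ℝ (Fin m)),
        IsProbabilityMeasure ρ → (∀ᵐ q ∂ρ, q ∈ P.U ×ˢ P.level z) →
        Integrable (fun q => fderiv ℝ φ q.2 (P.f q.1 q.2)) ρ := fun ρ _ hρ =>
      Integrable.of_bound (aestronglyMeasurable_comp_of_continuousOn hc
        P.measurableSet_prod aemeasurable_id (hρ.mono fun q hq => hsub hq)) M
        (hρ.mono fun q hq => hM q (hsub hq))
    rw [integral_add_measure ((hi μ hμ1 hμ2).smul_measure ENNReal.ofReal_ne_top)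
      ((hi ν hν1 hν2).smul_measure ENNReal.ofReal_ne_top), integral_smul_measure,
      integral_smul_measure, hμ3 φ hφ, hν3 φ hφ]
    simp

/-- The conditions defining `W(z)` and the map `(h̃, r̃)` are affine in the measure. Convexity is
what allows a time average of values to be replaced by the value at one measure. -/
theorem convex_V {z : EuclideanSpace ℝ (Fin k)} (hz : z ∈ P.Z) : Convex ℝ (P.V z) := by
  rintro _ ⟨μ, hμ, rfl⟩ _ ⟨ν, hν, rfl⟩ a b ha hb hab
  have hW := P.convex_W hz hμ hν ha hb hab
  refine ⟨_, hW, ?_⟩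
  have := ((P.mem_W_iff hz).1 hμ).1
  have := ((P.mem_W_iff hz).1 hν).1
  have := ((P.mem_W_iff hz).1 hW).1
  have hμK := ae_mem_prod_of_mem_W hz hμ
  have hνK := ae_mem_prod_of_mem_W hz hν
  change P.hrAve _ = a • P.hrAve μ + b • P.hrAve ν
  rw [P.hrAve_eq hμK, P.hrAve_eq hνK, P.hrAve_eq (ae_mem_prod_of_mem_W hz hW),
    integral_add_measure ((P.integrable_hr hμK).smul_measure ENNReal.ofReal_ne_top)
      ((P.integrable_hr hνK).smul_measure ENNReal.ofReal_ne_top), integral_smul_measure,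
    integral_smul_measure, ENNReal.toReal_ofReal ha, ENNReal.toReal_ofReal hb]

theorem stronglyMeasurable_hrAve
    {μ : ℝ → Measure (EuclideanSpace ℝ (Fin p) × EuclideanSpace ℝ (Fin m))} (hμ : Measurable μ) :
    StronglyMeasurable fun t => P.hrAve (μ t) := by
  let κ : ProbabilityTheory.Kernel ℝ (EuclideanSpace ℝ (Fin p) × EuclideanSpace ℝ (Fin m)) :=
    ⟨μ, hμ⟩
  have key : ∀ {B : Type} [NormedAddCommGroup B] [NormedSpace ℝ B] [SecondCountableTopology B]
      {φ : EuclideanSpace ℝ (Fin p) × EuclideanSpace ℝ (Fin m) → B},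
      ContinuousOn φ (P.U ×ˢ P.Y) → StronglyMeasurable fun t => ∫ q in P.U ×ˢ P.Y, φ q ∂(μ t) := by
    intro B _ _ _ φ hφ
    have h1 : StronglyMeasurable ((P.U ×ˢ P.Y).indicator φ) := by
      borelize B
      exact (measurable_indicator_of_continuousOn hφ P.measurableSet_prod).stronglyMeasurable
    have h2 := h1.integral_kernel (κ := κ)
    simp only [integral_indicator P.measurableSet_prod] at h2
    exact h2
  exact (key P.continuousOn_h).prodMk (key P.continuousOn_r')

theorem hrAve_mem_V {z : EuclideanSpace ℝ (Fin k)}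
    {μ : Measure (EuclideanSpace ℝ (Fin p) × EuclideanSpace ℝ (Fin m))} (hμ : μ ∈ P.W z) :
    P.hrAve μ ∈ P.V z := ⟨μ, hμ, rfl⟩

theorem norm_hrAve_le {M : ℝ} (hM : ∀ u ∈ P.U, ∀ y ∈ P.Y, ‖P.hr u y‖ ≤ M)
    {z : EuclideanSpace ℝ (Fin k)} (hz : z ∈ P.Z)
    {μ : Measure (EuclideanSpace ℝ (Fin p) × EuclideanSpace ℝ (Fin m))} (hμ : μ ∈ P.W z) :
    ‖P.hrAve μ‖ ≤ M := by
  have := ((P.mem_W_iff hz).1 hμ).1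
  have hμK := ae_mem_prod_of_mem_W hz hμ
  rw [P.hrAve_eq hμK]
  exact (norm_integral_le_of_norm_le_const (hμK.mono fun q hq => hM q.1 hq.1 q.2 hq.2)).trans
    (by simp)

variable {P} in
theorem IsAveragedSolution.ae_norm_hrAve_le {z₀ : EuclideanSpace ℝ (Fin k)}
    {μ : ℝ → Measure (EuclideanSpace ℝ (Fin p) × EuclideanSpace ℝ (Fin m))}
    {z : ℝ → EuclideanSpace ℝ (Fin k)} (h : P.IsAveragedSolution z₀ μ z) {M : ℝ}
    (hM : ∀ u ∈ P.U, ∀ y ∈ P.Y, ‖P.hr u y‖ ≤ M) :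
    ∀ᵐ t ∂(volume.restrict (Ici (0 : ℝ))), ‖P.hrAve (μ t)‖ ≤ M := by
  filter_upwards [h.2.2.2.1, ae_restrict_mem measurableSet_Ici] with t ht ht0
  exact P.norm_hrAve_le hM (h.2.2.1 t ht0) ht

variable {P} in
theorem IsAveragedSolution.intervalIntegrable_hrAve {z₀ : EuclideanSpace ℝ (Fin k)}
    {μ : ℝ → Measure (EuclideanSpace ℝ (Fin p) × EuclideanSpace ℝ (Fin m))}
    {z : ℝ → EuclideanSpace ℝ (Fin k)} (h : P.IsAveragedSolution z₀ μ z) {a b : ℝ} (ha : 0 ≤ a)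
    (hab : a ≤ b) : IntervalIntegrable (fun t => P.hrAve (μ t)) volume a b := by
  obtain ⟨M, -, hM⟩ := P.exists_bound_hr
  rw [intervalIntegrable_iff_integrableOn_Icc_of_le hab]
  exact IntegrableOn.of_bound measure_Icc_lt_top
    (P.stronglyMeasurable_hrAve h.1).aestronglyMeasurable M
    (ae_restrict_of_ae_restrict_of_subset (fun t ht => ha.trans ht.1) (h.ae_norm_hrAve_le hM))

/-- The mean velocity and cost of an averaged solution over a short interval are nearly attained
at a measure in `W(z')` with `z'` near the trajectory. -/
theorem exists_mem_W_near_average {L : ℝ≥0}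
    (hL : ∀ z' ∈ P.Z, ∀ z'' ∈ P.Z,
      Metric.hausdorffEDist (P.V z') (P.V z'') ≤ L * edist z' z'')
    {z₀ : EuclideanSpace ℝ (Fin k)}
    {μ : ℝ → Measure (EuclideanSpace ℝ (Fin p) × EuclideanSpace ℝ (Fin m))}
    {z : ℝ → EuclideanSpace ℝ (Fin k)} (h : P.IsAveragedSolution z₀ μ z) {a b : ℝ} (ha : 0 ≤ a)
    (hab : a < b) {z' : EuclideanSpace ℝ (Fin k)} (hz' : z' ∈ P.Z) {d : ℝ}
    (hd : ∀ t ∈ Icc a b, ‖z t - z'‖ ≤ d) {η : ℝ} (hη : 0 < η) :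
    ∃ ν ∈ P.W z', ‖(b - a) • P.hrAve ν - ∫ t in a..b, P.hrAve (μ t)‖ ≤ (b - a) * (L * d + η) := by
  have hd0 : 0 ≤ d := (norm_nonneg _).trans (hd a (left_mem_Icc.2 hab.le))
  -- Every value of the integrand lies in some `V(z t)`, hence within `L * d` of `V(z')`. The closed
  -- thickening of the convex set `V(z')` is convex, so it contains the mean. The extra `η` selects
  -- a point of `V(z')`, as the distance need not be attained.
  have hmean : (⨍ t in Icc a b, P.hrAve (μ t)) ∈ Metric.cthickening (L * d) (P.V z') := by
    refine ((P.convex_V hz').cthickening _).set_average_mem Metric.isClosed_cthickening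
      (by simp [hab]) measure_Icc_lt_top.ne ?_
      ((intervalIntegrable_iff_integrableOn_Icc_of_le hab.le).1
        (h.intervalIntegrable_hrAve ha hab.le))
    filter_upwards [ae_restrict_of_ae_restrict_of_subset (fun t ht => ha.trans ht.1) h.2.2.2.1,
      ae_restrict_mem measurableSet_Icc] with t ht htI
    rw [Metric.mem_cthickening_iff]
    refine (Metric.infEDist_le_hausdorffEDist_of_mem (P.hrAve_mem_V ht)).trans
      ((hL _ (h.2.2.1 t (ha.trans htI.1)) _ hz').trans ?_)
    rw [edist_dist, dist_eq_norm, ENNReal.ofReal_mul (by positivity), ENNReal.ofReal_coe_nnreal]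
    gcongr
    exact hd t htI
  rw [Metric.mem_cthickening_iff] at hmean
  obtain ⟨_, ⟨ν, hν, rfl⟩, hν2⟩ := Metric.infEDist_lt_iff.1 (hmean.trans_lt
    ((ENNReal.ofReal_lt_ofReal_iff (by positivity)).2 (lt_add_of_pos_right _ hη)))
  refine ⟨ν, hν, ?_⟩
  rw [edist_dist, ENNReal.ofReal_lt_ofReal_iff (by positivity), dist_comm, dist_eq_norm] at hν2
  change ‖P.hrAve ν - _‖ < _ at hν2
  have e : ∫ t in a..b, P.hrAve (μ t) = (b - a) • ⨍ t in Icc a b, P.hrAve (μ t) := by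
    rw [setAverage_eq, intervalIntegral.integral_of_le hab.le, integral_Icc_eq_integral_Ioc]
    simp [smul_smul, (sub_pos.2 hab).ne', measureReal_def, hab.le]
  rw [e, ← smul_sub, norm_smul, Real.norm_of_nonneg (sub_pos.2 hab).le]
  exact mul_le_mul_of_nonneg_left hν2.le (sub_pos.2 hab).le

end SlowObservableSystem

/-! ### Occupational measures and the realization of a measure by the perturbed system. -/

theorem integral_occupationalMeasure {Ω B : Type*} [TopologicalSpace Ω] [MeasurableSpace Ω]
    [BorelSpace Ω] [NormedAddCommGroup B] [NormedSpace ℝ B] [SecondCountableTopology B]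
    {K : Set Ω} (hK : MeasurableSet K) {φ : Ω → B} (hφ : ContinuousOn φ K) {w : ℝ → Ω} {S : ℝ}
    (hS : 0 < S) (hw : AEMeasurable w (volume.restrict (Icc 0 S))) (hwK : ∀ t ∈ Icc 0 S, w t ∈ K) :
    IsProbabilityMeasure (occupationalMeasure w S) ∧ (∀ᵐ q ∂(occupationalMeasure w S), q ∈ K) ∧
      S • ∫ q, φ q ∂(occupationalMeasure w S) = ∫ t in (0 : ℝ)..S, φ (w t) := by
  have hSne : ENNReal.ofReal S ≠ 0 := (ENNReal.ofReal_pos.2 hS).ne'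
  have hae : ∀ᵐ q ∂(Measure.map w (volume.restrict (Icc 0 S))), q ∈ K := by
    refine (ae_map_iff hw hK).2 ?_
    filter_upwards [ae_restrict_mem measurableSet_Icc] with t ht using hwK t ht
  have hφm : AEStronglyMeasurable φ (Measure.map w (volume.restrict (Icc 0 S))) :=
    aestronglyMeasurable_comp_of_continuousOn hφ hK aemeasurable_id hae
  refine ⟨⟨?_⟩, Measure.ae_smul_measure hae _, ?_⟩
  · rw [occupationalMeasure, Measure.smul_apply, Measure.map_apply_of_aemeasurable hw
      MeasurableSet.univ]
    simp [ENNReal.inv_mul_cancel hSne ENNReal.ofReal_ne_top]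
  · rw [occupationalMeasure, integral_smul_measure, integral_map hw hφm,
      intervalIntegral.integral_of_le hS.le, ← integral_Icc_eq_integral_Ioc, smul_smul,
      ENNReal.toReal_inv, ENNReal.toReal_ofReal hS.le, mul_inv_cancel₀ hS.ne', one_smul]

namespace SlowObservableSystem

variable {p m k : ℕ} (P : SlowObservableSystem p m k)

/-- Existence of trajectories of `y' = a f(u, y) + b g(u, y)`. -/
theorem exists_trajectory (α β : ℝ) {u : ℝ → EuclideanSpace ℝ (Fin p)} (hu : P.IsControl u)
    (y₀ : EuclideanSpace ℝ (Fin m)) :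
    ∃ y : ℝ → EuclideanSpace ℝ (Fin m), Continuous y ∧ ∀ t, 0 ≤ t →
      y t = y₀ + ∫ s in (0 : ℝ)..t, (α • P.f (u s) (y s) + β • P.g (u s) (y s)) := by
  obtain ⟨Kf, hKf⟩ := P.lipschitz_f
  obtain ⟨Kg, hKg⟩ := P.lipschitz_g
  have hU : ∀ s, u (max s 0) ∈ P.U := fun s => hu.2 _ (le_max_right _ _)
  have hum : Measurable fun s => u (max s 0) := hu.1.comp (by fun_prop)
  have hc := P.continuousOn_perturbed α β
  obtain ⟨B, hB⟩ := (P.isCompact_U.prod (isCompact_singleton (x := (0 : EuclideanSpace ℝ (Fin m))))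
    ).exists_bound_of_continuousOn (hc.mono (prod_mono_right (subset_univ _)))
  have hlip : ∀ s x y, ‖(α • P.f (u (max s 0)) x + β • P.g (u (max s 0)) x) -
      (α • P.f (u (max s 0)) y + β • P.g (u (max s 0)) y)‖ ≤ (|α| * Kf + |β| * Kg) * ‖x - y‖ := by
    intro s x y
    have h1 := (hKf _ (hU s)).dist_le_mul x y
    have h2 := (hKg _ (hU s)).dist_le_mul x y
    rw [dist_eq_norm, dist_eq_norm] at h1 h2
    rw [add_sub_add_comm, ← smul_sub, ← smul_sub]
    refine (norm_add_le _ _).trans ?_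
    rw [norm_smul, norm_smul, Real.norm_eq_abs, Real.norm_eq_abs, add_mul, mul_assoc, mul_assoc]
    gcongr
  have hint : ∀ x : ℝ → EuclideanSpace ℝ (Fin m), Continuous x → ∀ a b, IntervalIntegrable
      (fun s => α • P.f (u (max s 0)) (x s) + β • P.g (u (max s 0)) (x s)) volume a b := by
    intro x hx a b
    have hK : IsCompact (P.U ×ˢ (x '' uIcc a b)) := P.isCompact_U.prod (isCompact_uIcc.image hx)
    obtain ⟨M, hM⟩ := hK.exists_bound_of_continuousOn (hc.mono (prod_mono_right (subset_univ _)))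
    rw [intervalIntegrable_iff]
    refine IntegrableOn.of_bound measure_Ioc_lt_top (aestronglyMeasurable_comp_of_continuousOn
      (w := fun s => (u (max s 0), x s)) hc (P.isCompact_U.isClosed.prod isClosed_univ).measurableSet
      (hum.prodMk hx.measurable).aemeasurable
      (Eventually.of_forall fun s => ⟨hU s, mem_univ _⟩)) M ?_
    filter_upwards [ae_restrict_mem measurableSet_uIoc] with s hs
    exact hM (u (max s 0), x s) ⟨hU s, mem_image_of_mem x (uIoc_subset_uIcc hs)⟩
  obtain ⟨y, hy, hsol⟩ := exists_caratheodory_solution (by positivity) hlip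
    (fun s => hB (u (max s 0), 0) ⟨hU s, rfl⟩) hint y₀
  refine ⟨y, hy, fun t ht => ?_⟩
  rw [hsol t ht]
  congr 1
  refine intervalIntegral.integral_congr fun s hs => ?_
  rw [uIcc_of_le ht] at hs
  simp only [max_eq_left hs.1]

variable {P} in
/-- A reduced trajectory that starts on a level set with a neighbourhood in `Y` remains on it. -/
theorem IsReducedSolution.mem_level {z : EuclideanSpace ℝ (Fin k)} (hz : z ∈ P.Z) {σ : ℝ}
    (hσ : 0 < σ) (hzσ : ∀ y ∈ P.level z, Metric.ball y σ ⊆ P.Y)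
    {u : ℝ → EuclideanSpace ℝ (Fin p)} (hu : P.IsControl u) {y₀ : EuclideanSpace ℝ (Fin m)}
    (hy₀ : y₀ ∈ P.level z) {y : ℝ → EuclideanSpace ℝ (Fin m)}
    (hy : P.IsReducedSolution u y₀ y) {T : ℝ} (hT : 0 ≤ T) : y T ∈ P.level z := by
  have hcl : IsClosed ({t | y t ∈ P.level z} ∩ Icc 0 T) := by
    rw [inter_comm]
    exact (hy.1.mono fun t ht => ht.1).preimage_isClosed_of_isClosed isClosed_Icc
      (P.isClosed_level hz)
  -- Continuous induction. `F` is known to be conserved only inside `Y`, but from a point of the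
  -- level set the trajectory stays for a short time in a ball contained in `Y`, so the set of good
  -- times extends to the right.
  refine hcl.Icc_subset_of_forall_exists_gt (a := 0) (b := T) ?_ ?_ (right_mem_Icc.2 hT)
  · have : y 0 = y₀ := by simpa using hy.2 0 le_rfl
    rwa [mem_ofPred_eq, this]
  · rintro x ⟨hx, hx0⟩ t hxt
    have hc : Tendsto y (𝓝[≥] x) (𝓝 (y x)) :=
      (hy.1 x hx0.1).mono_left (nhdsWithin_mono _ (Ici_subset_Ici.2 hx0.1))
    obtain ⟨w, hw, hwI⟩ := mem_nhdsGE_iff_exists_Icc_subset.1 (hc (Metric.ball_mem_nhds _ hσ))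
    refine ⟨min w t, ?_, lt_min hw hxt, min_le_right _ _⟩
    have h1 := P.F_eq_of_reduced hu hy hx0.1 (lt_min hw hxt).le
      fun τ hτ => hzσ _ hx (hwI ⟨hτ.1, hτ.2.trans (min_le_left _ _)⟩)
    exact h1.trans hx

/-- The perturbed trajectory, in the fast time, is close to the reduced one on bounded intervals. -/
theorem norm_sub_le_of_reduced {Kf Kg : ℝ≥0} (hKf : ∀ u ∈ P.U, LipschitzWith Kf (P.f u))
    (hKg : ∀ u ∈ P.U, LipschitzWith Kg (P.g u)) {Mg : ℝ}
    (hMg : ∀ u ∈ P.U, ∀ y ∈ P.Y, ‖P.g u y‖ ≤ Mg) {u : ℝ → EuclideanSpace ℝ (Fin p)}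
    (hu : P.IsControl u) {y₀ : EuclideanSpace ℝ (Fin m)} {x y : ℝ → EuclideanSpace ℝ (Fin m)}
    {ε : ℝ} (hε : 0 ≤ ε) (hε1 : ε ≤ 1) (hx : Continuous x)
    (hxs : ∀ t, 0 ≤ t →
      x t = y₀ + ∫ s in (0 : ℝ)..t, ((1 : ℝ) • P.f (u s) (x s) + ε • P.g (u s) (x s)))
    (hy : P.IsReducedSolution u y₀ y) (hyY : ∀ t, 0 ≤ t → y t ∈ P.Y) {S : ℝ} :
    ∀ t ∈ Icc 0 S, ‖x t - y t‖ ≤ ε * Mg * S * Real.exp ((Kf + Kg) * t) := by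
  intro t ht
  have hyc : Continuous fun s => y (max s 0) :=
    hy.1.comp_continuous (by fun_prop) fun s => mem_Ici.2 (le_max_right _ _)
  have hD : Continuous fun s => ‖x s - y (max s 0)‖ := (hx.sub hyc).norm
  have hMg0 : 0 ≤ Mg := (norm_nonneg _).trans (hMg _ (hu.2 0 le_rfl) _ (hyY 0 le_rfl))
  have h := le_mul_exp_of_le_integral (c := ε * Mg * S) (κ := Kf + Kg) (S := S) (by positivity) hD
    ?_ t ht
  · simpa only [max_eq_left ht.1] using h
  intro t ht
  have hi1 : IntervalIntegrable (fun s => (1 : ℝ) • P.f (u s) (x s) + ε • P.g (u s) (x s))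
      volume 0 t :=
    hu.intervalIntegrable_comp (φ := fun u y => (1 : ℝ) • P.f u y + ε • P.g u y) isClosed_univ
      (P.continuousOn_perturbed 1 ε) le_rfl ht.1 hx.continuousOn fun _ _ => mem_univ _
  have hi2 : IntervalIntegrable (fun s => P.f (u s) (y s)) volume 0 t :=
    hu.intervalIntegrable_comp isClosed_univ P.continuousOn_f le_rfl ht.1 hy.1 fun _ _ => mem_univ _
  have hb : ∀ s ∈ Ioc 0 t, ‖(1 : ℝ) • P.f (u s) (x s) + ε • P.g (u s) (x s) - P.f (u s) (y s)‖ ≤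
      ε * Mg + (Kf + Kg) * ‖x s - y (max s 0)‖ := by
    intro s hs
    have hs0 : 0 ≤ s := hs.1.le
    have h1 := (hKf _ (hu.2 s hs0)).dist_le_mul (x s) (y s)
    have h2 := (hKg _ (hu.2 s hs0)).dist_le_mul (x s) (y s)
    have h3 := hMg _ (hu.2 s hs0) _ (hyY s hs0)
    rw [dist_eq_norm, dist_eq_norm] at h1 h2
    rw [max_eq_left hs0]
    -- The term `g` is compared at `y s`, which lies in `Y` and so satisfies the bound `Mg`; the
    -- trajectory `x` might leave `Y`, and the difference is left to the Lipschitz constant.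
    have e : (1 : ℝ) • P.f (u s) (x s) + ε • P.g (u s) (x s) - P.f (u s) (y s) =
      (P.f (u s) (x s) - P.f (u s) (y s)) + (ε • P.g (u s) (y s) +
        ε • (P.g (u s) (x s) - P.g (u s) (y s))) := by
      rw [smul_sub, one_smul]; abel
    rw [e]
    refine (norm_add_le _ _).trans ?_
    have h6 := norm_add_le (ε • P.g (u s) (y s)) (ε • (P.g (u s) (x s) - P.g (u s) (y s)))
    rw [norm_smul, norm_smul, Real.norm_of_nonneg hε] at h6
    have h4 : ε * ‖P.g (u s) (x s) - P.g (u s) (y s)‖ ≤ 1 * (Kg * ‖x s - y s‖) := by gcongr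
    have h5 : ε * ‖P.g (u s) (y s)‖ ≤ ε * Mg := by gcongr
    linarith
  have hi3 : IntervalIntegrable (fun s => (Kf + Kg : ℝ) * ‖x s - y (max s 0)‖) volume 0 t :=
    (continuous_const.mul hD).intervalIntegrable 0 t
  have e1 : x t - y t = ∫ s in (0 : ℝ)..t,
      ((1 : ℝ) • P.f (u s) (x s) + ε • P.g (u s) (x s) - P.f (u s) (y s)) := by
    rw [intervalIntegral.integral_sub hi1 hi2, hxs t ht.1, hy.2 t ht.1, add_sub_add_left_eq_sub]
  rw [max_eq_left ht.1, e1]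
  refine (intervalIntegral.norm_integral_le_of_norm_le ht.1 (Eventually.of_forall hb)
    (intervalIntegrable_const.add hi3)).trans ?_
  rw [intervalIntegral.integral_add intervalIntegrable_const hi3, intervalIntegral.integral_const,
    intervalIntegral.integral_const_mul, sub_zero, smul_eq_mul, mul_comm t]
  gcongr
  exact ht.2

/-- Realization of a measure `ν ∈ W(z)` by the perturbed system on a short interval. -/
theorem exists_perturbed_near_measure (hA : P.OccupationalApproximation) {σ : ℝ} (hσ : 0 < σ)
    {η : ℝ} (hη : 0 < η) :
    ∃ S : ℝ, 0 < S ∧ ∀ᶠ ε in 𝓝[>] (0 : ℝ), ∀ z ∈ P.Z,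
      (∀ y ∈ P.level z, Metric.ball y σ ⊆ P.Y) → ∀ y₀ ∈ P.level z, ∀ ν ∈ P.W z,
      ∃ (u : ℝ → EuclideanSpace ℝ (Fin p)) (y : ℝ → EuclideanSpace ℝ (Fin m)),
        P.IsControl u ∧ P.IsPerturbedSolution ε u y₀ y ∧ (∀ t ∈ Icc 0 (ε * S), y t ∈ P.Y) ∧
        ‖(∫ t in (0 : ℝ)..ε * S, P.hr (u t) (y t)) - (ε * S) • P.hrAve ν‖ ≤ ε * S * η := by
  obtain ⟨β, hβ, hA⟩ := hA
  obtain ⟨Kf, hKf⟩ := P.lipschitz_f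
  obtain ⟨Kg, hKg⟩ := P.lipschitz_g
  obtain ⟨Mg, hMg⟩ := P.isCompact_prod.exists_bound_of_continuousOn
    (P.continuousOn_g.mono (prod_mono_right (subset_univ _)))
  have hMg' : ∀ u ∈ P.U, ∀ y ∈ P.Y, ‖P.g u y‖ ≤ Mg := fun u hu y hy => hMg (u, y) ⟨hu, hy⟩
  -- Half of `η` pays for the distance from `ν` to an occupational measure (`δ₁`), the other half
  -- for the distance between the perturbed and reduced trajectories (`δ₂`). Then `S` is fixed by `β
  -- S < δ₁`, and only afterwards `ε` is made small, so `S` depends neither on `ε` nor on `z`, `y₀`,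
  -- `ν`.
  obtain ⟨δ₁, hδ₁, hδ₁0⟩ := ((exists_levyProkhorov_modulus P.isCompact_prod P.continuousOn_hr
    (half_pos hη)).and (eventually_mem_nhdsWithin (s := Ioi (0 : ℝ)))).exists
  obtain ⟨δ₂, hδ₂0, hδ₂⟩ := Metric.uniformContinuousOn_iff.1
    (P.isCompact_prod.uniformContinuousOn_of_continuous P.continuousOn_hr) _ (half_pos hη)
  obtain ⟨S, hSβ, hS⟩ := ((hβ.eventually (gt_mem_nhds hδ₁0)).and (eventually_gt_atTop 0)).exists
  refine ⟨S, hS, ?_⟩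
  have hlim : Tendsto (fun ε : ℝ => ε * Mg * S * Real.exp ((Kf + Kg) * S)) (𝓝[>] 0) (𝓝 0) := by
    refine Tendsto.mono_left ?_ nhdsWithin_le_nhds
    exact (by fun_prop : Continuous fun ε : ℝ => ε * Mg * S * Real.exp ((Kf + Kg) * S)).tendsto'
      0 0 (by simp)
  filter_upwards [hlim.eventually (gt_mem_nhds (lt_min hδ₂0 hσ)), Ioo_mem_nhdsGT one_pos]
    with ε hεS hε z hz hzσ y₀ hy₀ ν hν
  have hε0 : 0 < ε := hε.1
  have hlt : ENNReal.ofReal (β S) < ENNReal.ofReal δ₁ := (ENNReal.ofReal_lt_ofReal_iff hδ₁0).2 hSβ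
  have hdist := (hA S hS z hz y₀ hy₀ ν hν).trans_lt hlt
  rw [distToSet] at hdist
  simp only [iInf_lt_iff] at hdist
  obtain ⟨_, ⟨v, x₀, hv, hx₀, rfl⟩, hLP⟩ := hdist
  have hx₀l : ∀ t, 0 ≤ t → x₀ t ∈ P.level z := fun t ht => hx₀.mem_level hz hσ hzσ hv hy₀ ht
  have hx₀Y : ∀ t, 0 ≤ t → x₀ t ∈ P.Y := fun t ht => P.level_subset z hz (hx₀l t ht)
  have hsub : Icc 0 S ⊆ Ici (0 : ℝ) := fun t ht => ht.1
  obtain ⟨ho1, ho2, ho3⟩ := integral_occupationalMeasure P.measurableSet_prod P.continuousOn_hr hS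
    (w := fun t => (v t, x₀ t))
    (hv.1.aemeasurable.prodMk ((hx₀.1.mono hsub).aemeasurable measurableSet_Icc))
    fun t ht => ⟨hv.2 t ht.1, hx₀Y t ht.1⟩
  have hνp := ((P.mem_W_iff hz).1 hν).1
  have hνK := ae_mem_prod_of_mem_W hz hν
  have hclose := hδ₁ _ _ hνp ho1 hνK ho2 hLP
  rw [← P.hrAve_eq hνK] at hclose
  -- The perturbed system in the fast time `t / ε`, with the control of the reduced trajectory.
  -- Staying within `σ` of `x₀` keeps `x` in `Y`.
  obtain ⟨x, hxc, hxs⟩ := P.exists_trajectory 1 ε hv y₀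
  have hxd : ∀ t ∈ Icc 0 S, ‖x t - x₀ t‖ < min δ₂ σ := by
    intro t ht
    refine (P.norm_sub_le_of_reduced hKf hKg hMg' hv hε0.le hε.2.le hxc hxs hx₀ hx₀Y t ht).trans_lt
      (lt_of_le_of_lt ?_ hεS)
    have hMg0 : 0 ≤ Mg := (norm_nonneg _).trans (hMg' _ (hv.2 0 le_rfl) _ (hx₀Y 0 le_rfl))
    gcongr
    exact ht.2
  have hxY : ∀ t ∈ Icc 0 S, x t ∈ P.Y := fun t ht => hzσ _ (hx₀l t ht.1) (by
    rw [Metric.mem_ball, dist_eq_norm]; exact (hxd t ht).trans_le (min_le_right _ _))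
  have hdivI : ∀ t ∈ Icc 0 (ε * S), t / ε ∈ Icc 0 S := fun t ht =>
    ⟨div_nonneg ht.1 hε0.le, (div_le_iff₀' hε0).2 ht.2⟩
  refine ⟨fun t => v (t / ε), fun t => x (t / ε), ⟨hv.1.comp (measurable_id.div_const ε),
    fun t ht => hv.2 _ (div_nonneg ht hε0.le)⟩, ⟨(hxc.comp (continuous_id.div_const ε)).continuousOn,
    fun t ht => ?_⟩, fun t ht => hxY _ (hdivI t ht), ?_⟩
  · have h1 := intervalIntegral.integral_comp_div (a := 0) (b := t)
      (fun s => ε⁻¹ • P.f (v s) (x s) + P.g (v s) (x s)) hε0.ne'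
    change x (t / ε) = _
    rw [h1, zero_div, ← intervalIntegral.integral_smul, hxs _ (div_nonneg ht hε0.le)]
    simp only [smul_add, smul_smul, mul_inv_cancel₀ hε0.ne']
  · have h1 := intervalIntegral.integral_comp_div (a := 0) (b := ε * S)
      (fun s => P.hr (v s) (x s)) hε0.ne'
    rw [h1, zero_div, mul_div_cancel_left₀ _ hε0.ne', mul_smul, ← smul_sub, norm_smul,
      Real.norm_of_nonneg hε0.le, mul_assoc]
    refine mul_le_mul_of_nonneg_left ?_ hε0.le
    have hi1 : IntervalIntegrable (fun s => P.hr (v s) (x s)) volume 0 S :=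
      hv.intervalIntegrable_comp P.isCompact_Y.isClosed P.continuousOn_hr le_rfl hS.le
        hxc.continuousOn hxY
    have hi2 : IntervalIntegrable (fun s => P.hr (v s) (x₀ s)) volume 0 S :=
      hv.intervalIntegrable_comp P.isCompact_Y.isClosed P.continuousOn_hr le_rfl hS.le
        hx₀.1 fun t ht => hx₀Y t ht.1
    have h2 : ‖(∫ s in (0 : ℝ)..S, P.hr (v s) (x s)) - ∫ s in (0 : ℝ)..S, P.hr (v s) (x₀ s)‖ ≤
        η / 2 * |S - 0| := by
      rw [← intervalIntegral.integral_sub hi1 hi2]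
      refine intervalIntegral.norm_integral_le_of_norm_le_const fun s hs => ?_
      rw [uIoc_of_le hS.le] at hs
      have hsI : s ∈ Icc 0 S := Ioc_subset_Icc_self hs
      have h3 := hδ₂ (v s, x s) ⟨hv.2 s hsI.1, hxY s hsI⟩ (v s, x₀ s) ⟨hv.2 s hsI.1, hx₀Y s hsI.1⟩
        (by
          rw [Prod.dist_eq, dist_self, max_eq_right dist_nonneg, dist_eq_norm]
          exact (hxd s hsI).trans_le (min_le_left _ _))
      rw [dist_eq_norm] at h3
      exact h3.le
    have h4 : ‖(∫ s in (0 : ℝ)..S, P.hr (v s) (x₀ s)) - S • P.hrAve ν‖ ≤ S * (η / 2) := by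
      have h5 : ∫ s in (0 : ℝ)..S, P.hr (v s) (x₀ s) = _ := ho3.symm
      rw [h5, ← smul_sub, norm_smul, Real.norm_of_nonneg hS.le, norm_sub_rev]
      exact mul_le_mul_of_nonneg_left hclose hS.le
    rw [sub_zero, abs_of_pos hS] at h2
    calc _ ≤ _ := norm_sub_le_norm_sub_add_norm_sub _ (∫ s in (0 : ℝ)..S, P.hr (v s) (x₀ s)) _
      _ ≤ η / 2 * S + S * (η / 2) := add_le_add h2 h4
      _ = S * η := by ring

end SlowObservableSystem

/-! ### Concatenation of trajectories and discounting over a short interval. -/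

/-- Follow `c₁` until time `a` and then `c₂`, started at time `a`. -/
noncomputable def concat {B : Type*} (a : ℝ) (c₁ c₂ : ℝ → B) (t : ℝ) : B :=
  if t < a then c₁ t else c₂ (t - a)

theorem concat_of_lt {B : Type*} {a t : ℝ} (h : t < a) (c₁ c₂ : ℝ → B) :
    concat a c₁ c₂ t = c₁ t := if_pos h

theorem concat_of_le {B : Type*} {a t : ℝ} (h : a ≤ t) (c₁ c₂ : ℝ → B) :
    concat a c₁ c₂ t = c₂ (t - a) := if_neg (not_lt.2 h)

theorem concat_comp₂ {A B D : Type*} (a : ℝ) (φ : A → B → D) (u₁ u₂ : ℝ → A) (y₁ y₂ : ℝ → B)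
    (t : ℝ) : φ (concat a u₁ u₂ t) (concat a y₁ y₂ t) =
      concat a (fun s => φ (u₁ s) (y₁ s)) (fun s => φ (u₂ s) (y₂ s)) t := by
  simp only [concat]; split_ifs <;> rfl

theorem integral_mul_concat_of_le {B : Type*} [NormedAddCommGroup B] [NormedSpace ℝ B] {a t : ℝ}
    (ht : 0 ≤ t) (hta : t ≤ a) (ψ : ℝ → ℝ) (c₁ c₂ : ℝ → B) :
    ∫ s in (0 : ℝ)..t, ψ s • concat a c₁ c₂ s = ∫ s in (0 : ℝ)..t, ψ s • c₁ s := by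
  refine intervalIntegral.integral_congr_ae ?_
  -- At `s = a` the concatenation already follows `c₂`; this single point is null.
  filter_upwards [compl_mem_ae_iff.2 (measure_singleton a)] with s hs hst
  rw [uIoc_of_le ht] at hst
  rw [concat_of_lt (lt_of_le_of_ne (hst.2.trans hta) hs)]

theorem integral_concat_of_le {B : Type*} [NormedAddCommGroup B] [NormedSpace ℝ B] {a t : ℝ}
    (ht : 0 ≤ t) (hta : t ≤ a) (c₁ c₂ : ℝ → B) :
    ∫ s in (0 : ℝ)..t, concat a c₁ c₂ s = ∫ s in (0 : ℝ)..t, c₁ s := by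
  simpa using integral_mul_concat_of_le ht hta (fun _ => 1) c₁ c₂

theorem integral_concat_add {B : Type*} [NormedAddCommGroup B] [NormedSpace ℝ B] {a b : ℝ}
    (hb : 0 ≤ b) (c₁ c₂ : ℝ → B) :
    ∫ s in a..a + b, concat a c₁ c₂ s = ∫ s in (0 : ℝ)..b, c₂ s := by
  have h : ∫ s in a..a + b, concat a c₁ c₂ s = ∫ s in a..a + b, c₂ (s - a) := by
    refine intervalIntegral.integral_congr fun s hs => ?_
    rw [uIcc_of_le (by linarith)] at hs
    exact concat_of_le hs.1 _ _
  rw [h, intervalIntegral.integral_comp_sub_right]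
  simp

/-- Over `[a, b]` the discount factor differs from `e^{-Ca} ≤ 1` by at most `C (b - a)`. The main
term must be the norm of the integral and not the integral of the norm: closeness of statistics
makes `ξ` small only on average. -/
theorem norm_integral_exp_mul_le {C a b B : ℝ} (hC : 0 ≤ C) (ha : 0 ≤ a) (hab : a ≤ b) {ξ : ℝ → ℝ}
    (hξ : IntervalIntegrable ξ volume a b)
    (hB : ∀ᵐ t ∂(volume.restrict (Ioc a b)), ‖ξ t‖ ≤ B) :
    ‖∫ t in a..b, Real.exp (-C * t) * ξ t‖ ≤ ‖∫ t in a..b, ξ t‖ + C * (b - a) * B * (b - a) := by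
  have hc : Continuous fun t => Real.exp (-C * t) := by fun_prop
  have hc' : Continuous fun t => Real.exp (-C * t) - Real.exp (-C * a) := by fun_prop
  have e : ∫ t in a..b, Real.exp (-C * t) * ξ t = Real.exp (-C * a) * (∫ t in a..b, ξ t) +
      ∫ t in a..b, (Real.exp (-C * t) - Real.exp (-C * a)) * ξ t := by
    rw [← intervalIntegral.integral_const_mul, ← intervalIntegral.integral_add (hξ.const_mul _)
      (hξ.continuousOn_mul hc'.continuousOn)]
    refine intervalIntegral.integral_congr fun t _ => ?_
    ring
  have hexp1 : Real.exp (-C * a) ≤ 1 := Real.exp_le_one_iff.2 (by nlinarith)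
  have h2 : ‖∫ t in a..b, (Real.exp (-C * t) - Real.exp (-C * a)) * ξ t‖ ≤
      C * (b - a) * B * |b - a| := by
    refine intervalIntegral.norm_integral_le_of_norm_le_const_ae ?_
    rw [uIoc_of_le hab, ← ae_restrict_iff' measurableSet_Ioc]
    filter_upwards [hB, ae_restrict_mem measurableSet_Ioc] with t ht htI
    rw [norm_mul]
    have hB0 : 0 ≤ B := (norm_nonneg _).trans ht
    refine mul_le_mul ?_ ht (norm_nonneg _) (by have := sub_nonneg.2 hab; positivity)
    have h3 : Real.exp (-C * t) = Real.exp (-C * a) * Real.exp (-(C * (t - a))) := by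
      rw [← Real.exp_add]; ring_nf
    have h4 := Real.one_sub_le_exp_neg (C * (t - a))
    have h5 : Real.exp (-(C * (t - a))) ≤ 1 :=
      Real.exp_le_one_iff.2 (neg_nonpos.2 (mul_nonneg hC (sub_nonneg.2 htI.1.le)))
    have h6 : C * (t - a) ≤ C * (b - a) := by gcongr; exact htI.2
    rw [h3, Real.norm_eq_abs, abs_le]
    have h7 := Real.exp_pos (-C * a)
    constructor <;> nlinarith
  rw [e]
  refine (norm_add_le _ _).trans (add_le_add ?_ (by rwa [abs_of_nonneg (sub_nonneg.2 hab)] at h2))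
  rw [norm_mul, Real.norm_of_nonneg (Real.exp_pos _).le]
  exact mul_le_of_le_one_left (norm_nonneg _) hexp1

namespace SlowObservableSystem

variable {p m k : ℕ} {P : SlowObservableSystem p m k}

theorem IsControl.concat {a : ℝ} {u₁ u₂ : ℝ → EuclideanSpace ℝ (Fin p)} (h₁ : P.IsControl u₁)
    (h₂ : P.IsControl u₂) : P.IsControl (concat a u₁ u₂) := by
  refine ⟨Measurable.ite measurableSet_Iio h₁.1 (h₂.1.comp (measurable_id.sub_const a)),
    fun t ht => ?_⟩
  rcases lt_or_ge t a with h | h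
  · rw [concat_of_lt h]; exact h₁.2 t ht
  · rw [concat_of_le h]; exact h₂.2 _ (sub_nonneg.2 h)

theorem IsPerturbedSolution.concat {ε a : ℝ} (ha : 0 ≤ a) {u₁ u₂ : ℝ → EuclideanSpace ℝ (Fin p)}
    (hu₁ : P.IsControl u₁) (hu₂ : P.IsControl u₂) {y₀ : EuclideanSpace ℝ (Fin m)}
    {y₁ y₂ : ℝ → EuclideanSpace ℝ (Fin m)} (h₁ : P.IsPerturbedSolution ε u₁ y₀ y₁)
    (h₂ : P.IsPerturbedSolution ε u₂ (y₁ a) y₂) :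
    P.IsPerturbedSolution ε (concat a u₁ u₂) y₀ (concat a y₁ y₂) := by
  -- On the half-line the concatenation equals `y₁ (min t a) + y₂ (max (t - a) 0) - y₁ a`, since `y₂
  -- 0 = y₁ a`.
  have hc : ContinuousOn (_root_.concat a y₁ y₂) (Ici 0) := by
    have h1 : ContinuousOn (fun t => y₁ (min t a)) (Ici 0) :=
      h₁.1.comp (by fun_prop) fun t ht => le_min ht ha
    have h2 : ContinuousOn (fun t => y₂ (max (t - a) 0)) (Ici 0) :=
      h₂.1.comp (by fun_prop) fun t _ => mem_Ici.2 (le_max_right _ _)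
    refine ((h1.add h2).sub (continuousOn_const (c := y₁ a))).congr fun t _ => ?_
    rcases lt_or_ge t a with h | h
    · simp [concat_of_lt h, h.le, h₂.apply_zero]
    · simp [concat_of_le h, h]
  refine ⟨hc, fun t ht => ?_⟩
  set v : EuclideanSpace ℝ (Fin p) → EuclideanSpace ℝ (Fin m) → EuclideanSpace ℝ (Fin m) :=
    fun u y => ε⁻¹ • P.f u y + P.g u y with hv
  have hvc : ContinuousOn (Function.uncurry v) (P.U ×ˢ univ) := by
    simpa only [one_smul] using P.continuousOn_perturbed ε⁻¹ 1
  have hint : ∀ b c, 0 ≤ b → b ≤ c → IntervalIntegrable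
      (fun s => v (_root_.concat a u₁ u₂ s) (_root_.concat a y₁ y₂ s)) volume b c :=
    fun b c hb hbc => (hu₁.concat hu₂).intervalIntegrable_comp isClosed_univ hvc hb hbc hc
      fun _ _ => mem_univ _
  change _ = y₀ + ∫ s in (0 : ℝ)..t, v (_root_.concat a u₁ u₂ s) (_root_.concat a y₁ y₂ s)
  rcases lt_or_ge t a with h | h
  · simp only [concat_comp₂]
    rw [concat_of_lt h, integral_concat_of_le ht h.le, h₁.2 t ht]
  · rw [← intervalIntegral.integral_add_adjacent_intervals (hint 0 a le_rfl ha) (hint a t ha h)]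
    simp only [concat_comp₂]
    have h3 := integral_concat_add (a := a) (sub_nonneg.2 h) (fun s => v (u₁ s) (y₁ s))
      (fun s => v (u₂ s) (y₂ s))
    rw [add_sub_cancel] at h3
    rw [concat_of_le h, integral_concat_of_le ha le_rfl, h3, h₂.2 _ (sub_nonneg.2 h), h₁.2 a ha,
      add_assoc]

theorem concat_mem {a : ℝ} {D : Set (EuclideanSpace ℝ (Fin m))}
    {y₁ y₂ : ℝ → EuclideanSpace ℝ (Fin m)} (h₁ : ∀ t ∈ Icc 0 a, y₁ t ∈ D) {b : ℝ}
    (h₂ : ∀ t ∈ Icc 0 b, y₂ t ∈ D) : ∀ t ∈ Icc 0 (a + b), concat a y₁ y₂ t ∈ D := by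
  intro t ht
  rcases lt_or_ge t a with h | h
  · rw [concat_of_lt h]; exact h₁ t ⟨ht.1, h.le⟩
  · rw [concat_of_le h]; exact h₂ _ ⟨sub_nonneg.2 h, by linarith [ht.2]⟩

/-! ### Tracking an averaged solution: the error in one step. -/

variable (P) in
/-- On `[0, a]` the perturbed system has a trajectory in `Y` whose observables and cost are within
`e` of those of the averaged solution `(μ, z)` at time `a`. -/
def Tracks (ε : ℝ) (y₀ : EuclideanSpace ℝ (Fin m))
    (μ : ℝ → Measure (EuclideanSpace ℝ (Fin p) × EuclideanSpace ℝ (Fin m)))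
    (z : ℝ → EuclideanSpace ℝ (Fin k)) (a e : ℝ) : Prop :=
  ∃ (u : ℝ → EuclideanSpace ℝ (Fin p)) (y : ℝ → EuclideanSpace ℝ (Fin m)),
    P.IsControl u ∧ P.IsPerturbedSolution ε u y₀ y ∧ (∀ t ∈ Icc 0 a, y t ∈ P.Y) ∧
    ‖P.F (y a) - z a‖ ≤ e ∧
    ‖(∫ t in (0 : ℝ)..a, Real.exp (-P.C * t) * P.r (u t) (y t)) -
      ∫ t in (0 : ℝ)..a, Real.exp (-P.C * t) * P.rAve (μ t)‖ ≤ e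

/-- One step of the tracking construction. -/
theorem Tracks.step {L : ℝ≥0}
    (hL : ∀ z' ∈ P.Z, ∀ z'' ∈ P.Z,
      Metric.hausdorffEDist (P.V z') (P.V z'') ≤ L * edist z' z'')
    {M : ℝ} (hM : ∀ u ∈ P.U, ∀ y ∈ P.Y, ‖P.hr u y‖ ≤ M) {z₀ : EuclideanSpace ℝ (Fin k)}
    {μ : ℝ → Measure (EuclideanSpace ℝ (Fin p) × EuclideanSpace ℝ (Fin m))}
    {z : ℝ → EuclideanSpace ℝ (Fin k)} (hav : P.IsAveragedSolution z₀ μ z)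
    {ε Δ η a e : ℝ} (hΔ : 0 < Δ) (hη : 0 < η) (ha : 0 ≤ a) (haZ : ∀ z', ‖z' - z a‖ ≤ e → z' ∈ P.Z)
    (hstep : ∀ z', ‖z' - z a‖ ≤ e → ∀ y₀ ∈ P.level z', ∀ ν ∈ P.W z',
      ∃ (u : ℝ → EuclideanSpace ℝ (Fin p)) (y : ℝ → EuclideanSpace ℝ (Fin m)),
        P.IsControl u ∧ P.IsPerturbedSolution ε u y₀ y ∧ (∀ t ∈ Icc 0 Δ, y t ∈ P.Y) ∧
        ‖(∫ t in (0 : ℝ)..Δ, P.hr (u t) (y t)) - Δ • P.hrAve ν‖ ≤ Δ * η)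
    {y₀ : EuclideanSpace ℝ (Fin m)} (h : P.Tracks ε y₀ μ z a e) :
    P.Tracks ε y₀ μ z (a + Δ)
      (e + Δ * (L * (e + M * Δ) + η + η) + P.C * Δ * (M + M) * Δ) := by
  obtain ⟨u, y, hu, hy, hyY, hyz, hcost⟩ := h
  have hab : a < a + Δ := lt_add_of_pos_right a hΔ
  have hbound := hav.ae_norm_hrAve_le hM
  have hiav : ∀ b c, 0 ≤ b → b ≤ c → IntervalIntegrable (fun t => P.hrAve (μ t)) volume b c :=
    fun b c hb hbc => hav.intervalIntegrable_hrAve hb hbc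
  have hzd : ∀ b c, 0 ≤ b → b ≤ c → z c - z b = ∫ t in b..c, P.hAve (μ t) := by
    intro b c hb hbc
    rw [hav.2.2.2.2 c (hb.trans hbc), hav.2.2.2.2 b hb, add_sub_add_left_eq_sub,
      intervalIntegral.integral_interval_sub_left]
    · exact ⟨(hiav 0 c le_rfl (hb.trans hbc)).1.fst, (hiav 0 c le_rfl (hb.trans hbc)).2.fst⟩
    · exact ⟨(hiav 0 b le_rfl hb).1.fst, (hiav 0 b le_rfl hb).2.fst⟩
  have hM0 : 0 ≤ M := (norm_nonneg _).trans (hM _ (hu.2 0 le_rfl) _ (hyY 0 ⟨le_rfl, ha⟩))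
  -- The initial mismatch `e` plus the motion of `z`, whose speed is at most `M`.
  have hd : ∀ t ∈ Icc a (a + Δ), ‖z t - P.F (y a)‖ ≤ e + M * Δ := by
    intro t ht
    have h1 : ‖z t - z a‖ ≤ M * |t - a| := by
      rw [hzd a t ha ht.1]
      refine intervalIntegral.norm_integral_le_of_norm_le_const_ae ?_
      rw [ae_restrict_iff' measurableSet_Ici] at hbound
      filter_upwards [hbound] with s hs hst
      rw [uIoc_of_le ht.1] at hst
      exact (norm_fst_le _).trans (hs (ha.trans hst.1.le))
    rw [abs_of_nonneg (sub_nonneg.2 ht.1)] at h1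
    have h2 : M * (t - a) ≤ M * Δ := by
      gcongr
      linarith [ht.2]
    rw [norm_sub_rev] at hyz
    linarith [norm_sub_le_norm_sub_add_norm_sub (z t) (z a) (P.F (y a))]
  have hz'Z := haZ _ hyz
  -- The measure is chosen in `W(F (y a))` and not in `W(z a)`, because the next piece starts at `y
  -- a`, on the level set of its own observables. One `η` is spent here and one in `hstep`.
  obtain ⟨ν, hν, hν2⟩ := P.exists_mem_W_near_average hL hav ha hab hz'Z hd hη
  obtain ⟨v, x, hv, hx, hxY, hxν⟩ := hstep _ hyz (y a) rfl ν hν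
  rw [add_sub_cancel_left] at hν2
  have hmain : ‖(∫ t in (0 : ℝ)..Δ, P.hr (v t) (x t)) - ∫ t in a..a + Δ, P.hrAve (μ t)‖ ≤
      Δ * (L * (e + M * Δ) + η + η) := by
    have := norm_sub_le_norm_sub_add_norm_sub (∫ t in (0 : ℝ)..Δ, P.hr (v t) (x t))
      (Δ • P.hrAve ν) (∫ t in a..a + Δ, P.hrAve (μ t))
    linarith
  have hix : IntervalIntegrable (fun t => P.hr (v t) (x t)) volume 0 Δ :=
    hv.intervalIntegrable_comp P.isCompact_Y.isClosed P.continuousOn_hr le_rfl hΔ.le hx.1 hxY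
  have hsol := hy.concat ha hu hv hx
  have hYnew := concat_mem hyY hxY
  refine ⟨_, _, hu.concat hv, hsol, hYnew, ?_, ?_⟩
  · have h1 := hx.F_sub_eq hv le_rfl hΔ.le hxY
    have h2 := hzd a (a + Δ) ha hab.le
    have h3 : (∫ t in (0 : ℝ)..Δ, P.h (v t) (x t)) - (∫ t in a..a + Δ, P.hAve (μ t)) =
        ((∫ t in (0 : ℝ)..Δ, P.hr (v t) (x t)) - ∫ t in a..a + Δ, P.hrAve (μ t)).1 := by
      have e1 := (ContinuousLinearMap.fst ℝ (EuclideanSpace ℝ (Fin k)) ℝ).intervalIntegral_comp_comm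
        hix
      have e2 := (ContinuousLinearMap.fst ℝ (EuclideanSpace ℝ (Fin k)) ℝ).intervalIntegral_comp_comm
        (hiav a (a + Δ) ha hab.le)
      rw [Prod.fst_sub]
      exact congrArg₂ (· - ·) e1 e2
    rw [concat_of_le hab.le, add_sub_cancel_left]
    have h4 : P.F (x Δ) - z (a + Δ) = (P.F (y a) - z a) +
        ((∫ t in (0 : ℝ)..Δ, P.h (v t) (x t)) - (∫ t in a..a + Δ, P.hAve (μ t))) := by
      rw [← h1, ← h2, hx.apply_zero]; abel
    rw [h4, h3]
    have h5 := (norm_add_le _ _).trans (add_le_add hyz ((norm_fst_le _).trans hmain))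
    refine h5.trans (le_add_of_nonneg_right ?_)
    have := P.C_pos
    positivity
  · have hrc := P.continuousOn_r'
    set r' : ℝ → ℝ := fun t => P.r (_root_.concat a u v t) (_root_.concat a y x t) with hr'
    have hir : ∀ b c, 0 ≤ b → b ≤ c → c ≤ a + Δ → IntervalIntegrable r' volume b c :=
      fun b c hb hbc hc => (hu.concat hv).intervalIntegrable_comp P.isCompact_Y.isClosed hrc hb hbc
        hsol.1 fun t ht => hYnew t ⟨hb.trans ht.1, ht.2.trans hc⟩
    have hira : ∀ b c, 0 ≤ b → b ≤ c → IntervalIntegrable (fun t => P.rAve (μ t)) volume b c :=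
      fun b c hb hbc => ⟨(hiav b c hb hbc).1.snd, (hiav b c hb hbc).2.snd⟩
    have hexp : Continuous fun t => Real.exp (-P.C * t) := by fun_prop
    have e1 : ∫ t in (0 : ℝ)..a + Δ, Real.exp (-P.C * t) * r' t =
        (∫ t in (0 : ℝ)..a, Real.exp (-P.C * t) * P.r (u t) (y t)) +
        ∫ t in a..a + Δ, Real.exp (-P.C * t) * r' t := by
      rw [← intervalIntegral.integral_add_adjacent_intervals
        ((hir 0 a le_rfl ha hab.le).continuousOn_mul hexp.continuousOn)
        ((hir a (a + Δ) ha hab.le le_rfl).continuousOn_mul hexp.continuousOn)]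
      congr 1
      simp only [hr', concat_comp₂]
      exact integral_mul_concat_of_le ha le_rfl (fun t => Real.exp (-P.C * t)) _ _
    have e2 : ∫ t in (0 : ℝ)..a + Δ, Real.exp (-P.C * t) * P.rAve (μ t) =
        (∫ t in (0 : ℝ)..a, Real.exp (-P.C * t) * P.rAve (μ t)) +
        ∫ t in a..a + Δ, Real.exp (-P.C * t) * P.rAve (μ t) :=
      (intervalIntegral.integral_add_adjacent_intervals
        ((hira 0 a le_rfl ha).continuousOn_mul hexp.continuousOn)
        ((hira a (a + Δ) ha hab.le).continuousOn_mul hexp.continuousOn)).symm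
    have e3 : (∫ t in a..a + Δ, Real.exp (-P.C * t) * r' t) -
        (∫ t in a..a + Δ, Real.exp (-P.C * t) * P.rAve (μ t)) =
        ∫ t in a..a + Δ, Real.exp (-P.C * t) * (r' t - P.rAve (μ t)) := by
      rw [← intervalIntegral.integral_sub
        ((hir a (a + Δ) ha hab.le le_rfl).continuousOn_mul hexp.continuousOn)
        ((hira a (a + Δ) ha hab.le).continuousOn_mul hexp.continuousOn)]
      simp only [mul_sub]
    have h1 := norm_integral_exp_mul_le P.C_pos.le ha hab.le
      ((hir a (a + Δ) ha hab.le le_rfl).sub (hira a (a + Δ) ha hab.le)) (B := M + M) (by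
        filter_upwards [ae_restrict_of_ae_restrict_of_subset
          (fun t ht => ha.trans (le_of_lt ht.1)) hbound, ae_restrict_mem measurableSet_Ioc]
          with t ht htI
        have ht0 : 0 ≤ t := ha.trans htI.1.le
        refine (norm_sub_le _ _).trans (add_le_add ?_ ((norm_snd_le _).trans ht))
        exact (norm_snd_le (P.hr (_root_.concat a u v t) (_root_.concat a y x t))).trans
          (hM _ ((hu.concat hv).2 t ht0) _ (hYnew t ⟨ht0, htI.2⟩)))
    have h2 : ‖∫ t in a..a + Δ, (r' t - P.rAve (μ t))‖ ≤ Δ * (L * (e + M * Δ) + η + η) := by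
      rw [intervalIntegral.integral_sub (hir a (a + Δ) ha hab.le le_rfl) (hira a (a + Δ) ha hab.le)]
      have h3 : (∫ t in a..a + Δ, r' t) - (∫ t in a..a + Δ, P.rAve (μ t)) =
          ((∫ t in (0 : ℝ)..Δ, P.hr (v t) (x t)) - ∫ t in a..a + Δ, P.hrAve (μ t)).2 := by
        have e1 := (ContinuousLinearMap.snd ℝ (EuclideanSpace ℝ (Fin k))
          ℝ).intervalIntegral_comp_comm hix
        have e2 := (ContinuousLinearMap.snd ℝ (EuclideanSpace ℝ (Fin k))
          ℝ).intervalIntegral_comp_comm (hiav a (a + Δ) ha hab.le)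
        simp only [hr', concat_comp₂]
        rw [integral_concat_add hΔ.le, Prod.snd_sub]
        exact congrArg₂ (· - ·) e1 e2
      rw [h3]
      exact (norm_snd_le _).trans hmain
    rw [e1, e2, add_sub_add_comm, e3]
    rw [add_sub_cancel_left] at h1
    refine (norm_add_le _ _).trans ?_
    linarith

end SlowObservableSystem

/-! ### The upper bound: tracking on long intervals and discounting the tail. -/

namespace SlowObservableSystem

variable {p m k : ℕ} {P : SlowObservableSystem p m k}

/-- Uniform neighbourhoods of a trajectory of observables that stays in the interior. -/
theorem exists_uniform_neighbourhood {z : ℝ → EuclideanSpace ℝ (Fin k)}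
    {Zc : Set (EuclideanSpace ℝ (Fin k))} {Yc : Set (EuclideanSpace ℝ (Fin m))}
    (hZc : IsCompact Zc) (hZcZ : Zc ⊆ interior P.Z) (hYc : IsCompact Yc)
    (hYcY : Yc ⊆ interior P.Y) (hz : ∀ t, 0 ≤ t → z t ∈ Zc ∧ P.level (z t) ⊆ Yc) :
    ∃ ρ > 0, ∃ σ > 0, ∀ t, 0 ≤ t → ∀ z', ‖z' - z t‖ ≤ ρ →
      z' ∈ P.Z ∧ ∀ y ∈ P.level z', Metric.ball y σ ⊆ P.Y := by
  obtain ⟨δ, hδ, hδZ⟩ := hZc.exists_cthickening_subset_open isOpen_interior hZcZ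
  obtain ⟨τ, hτ, hτY⟩ := hYc.exists_cthickening_subset_open isOpen_interior hYcY
  obtain ⟨L, hL⟩ := P.level_lipschitz
  -- By the Lipschitz property of the level sets, this radius puts `Y_{z'}` within `τ / 2` of `Yc`;
  -- balls of radius `τ / 2` around its points then stay in the `τ`-thickening, inside `Y`.
  refine ⟨min δ (τ / 2 / (L + 1)), by positivity, τ / 2, by positivity, fun t ht z' hz' => ?_⟩
  obtain ⟨h1, h2⟩ := hz t ht
  have hzZ : z t ∈ P.Z := interior_subset (hZcZ h1)
  have hz'Z : z' ∈ P.Z := interior_subset (hδZ (Metric.mem_cthickening_of_dist_le z' (z t) δ Zc h1 (by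
    rw [dist_eq_norm]; exact hz'.trans (min_le_left _ _))))
  refine ⟨hz'Z, fun y hy w hw => ?_⟩
  have h3 : Metric.infEDist y (P.level (z t)) < ENNReal.ofReal (τ / 2) := by
    refine ((Metric.infEDist_le_hausdorffEDist_of_mem hy).trans (hL z' hz'Z (z t) hzZ)).trans_lt ?_
    rw [edist_dist, dist_eq_norm, ← ENNReal.ofReal_coe_nnreal, ← ENNReal.ofReal_mul L.coe_nonneg]
    rw [ENNReal.ofReal_lt_ofReal_iff (by positivity)]
    calc (L : ℝ) * ‖z' - z t‖ ≤ L * (τ / 2 / (L + 1)) := by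
          gcongr
          exact hz'.trans (min_le_right _ _)
      _ < τ / 2 := by
          rw [mul_div_assoc', div_lt_iff₀ (by positivity)]
          nlinarith
  obtain ⟨y', hy', hyy'⟩ := Metric.infEDist_lt_iff.1 h3
  rw [edist_dist, ENNReal.ofReal_lt_ofReal_iff (by positivity)] at hyy'
  refine interior_subset (hτY (Metric.mem_cthickening_of_dist_le w y' τ Yc (h2 hy') ?_))
  have := dist_triangle w y y'
  rw [Metric.mem_ball] at hw
  linarith

/-- The perturbed system tracks an interior averaged solution on bounded time intervals. -/
theorem eventually_tracks (hW : P.ContinuityOfW) (hA : P.OccupationalApproximation)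
    (hU : P.U.Nonempty) {y₀ : EuclideanSpace ℝ (Fin m)}
    {μ : ℝ → Measure (EuclideanSpace ℝ (Fin p) × EuclideanSpace ℝ (Fin m))}
    {z : ℝ → EuclideanSpace ℝ (Fin k)} (hav : P.IsAveragedSolution (P.F y₀) μ z)
    {ρ σ : ℝ} (hρ : 0 < ρ) (hσ : 0 < σ) (hρσ : ∀ t, 0 ≤ t → ∀ z', ‖z' - z t‖ ≤ ρ →
      z' ∈ P.Z ∧ ∀ y ∈ P.level z', Metric.ball y σ ⊆ P.Y) {T η : ℝ} (hT : 0 ≤ T) (hη : 0 < η) :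
    ∀ᶠ ε in 𝓝[>] (0 : ℝ), ∃ a, T ≤ a ∧ P.Tracks ε y₀ μ z a (min ρ η) := by
  obtain ⟨-, L, hL⟩ := hW
  obtain ⟨M, hM0, hM⟩ := P.exists_bound_hr
  have hC := P.C_pos
  -- Growth rate of the error, `e ↦ (1 + Λ Δ) e` per step: `L` from the Lipschitz bound on `V`, `2`
  -- from the two terms `η₁ ≤ e`, `1` from the terms quadratic in `Δ`, and a slack of `1`.
  set Λ : ℝ := L + 4 with hΛ
  have hΛ0 : 0 < Λ := by positivity
  -- Chosen so that the error stays below `min ρ η` up to time `T + 1`. The extra unit of time is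
  -- room for rounding `T / Δ` up to an integer, as `Δ < 1`. The bound by `ρ` keeps the observables
  -- where steps are possible.
  set η₁ : ℝ := min ρ η * Real.exp (-(Λ * (T + 1))) with hη₁
  have hη₁0 : 0 < η₁ := mul_pos (lt_min hρ hη) (Real.exp_pos _)
  have hle : ∀ t, t ≤ T + 1 → η₁ * Real.exp (Λ * t) ≤ min ρ η := by
    intro t ht
    rw [hη₁, mul_assoc, ← Real.exp_add]
    refine mul_le_of_le_one_right (lt_min hρ hη).le (Real.exp_le_one_iff.2 ?_)
    nlinarith
  obtain ⟨S, hS, hstep⟩ := P.exists_perturbed_near_measure hA hσ hη₁0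
  have hlim : Tendsto (fun ε : ℝ => (L * M + P.C * (M + M)) * (ε * S)) (𝓝[>] 0) (𝓝 0) :=
    Tendsto.mono_left (Continuous.tendsto' (by fun_prop) 0 0 (by simp)) nhdsWithin_le_nhds
  have hlim' : Tendsto (fun ε : ℝ => ε * S) (𝓝[>] 0) (𝓝 0) :=
    Tendsto.mono_left (Continuous.tendsto' (by fun_prop) 0 0 (by simp)) nhdsWithin_le_nhds
  filter_upwards [hstep, hlim.eventually (gt_mem_nhds hη₁0), hlim'.eventually (gt_mem_nhds one_pos),
    eventually_mem_nhdsWithin] with ε hε hεL hεS hε0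
  set Δ : ℝ := ε * S with hΔdef
  have hΔ : 0 < Δ := mul_pos hε0 hS
  have hz0 : z 0 = P.F y₀ := by simpa using hav.2.2.2.2 0 le_rfl
  have main : ∀ l : ℕ, (l : ℝ) * Δ ≤ T + 1 →
      P.Tracks ε y₀ μ z (l * Δ) (η₁ * Real.exp (Λ * (l * Δ))) := by
    intro l
    induction l with
    | zero =>
      intro _
      obtain ⟨u₀, hu₀⟩ := hU
      -- At time `0` any control will do: the interval is a single point and both errors vanish.
      have hu : P.IsControl fun _ => u₀ := ⟨measurable_const, fun _ _ => hu₀⟩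
      obtain ⟨y, hy, hys⟩ := P.exists_trajectory ε⁻¹ 1 hu y₀
      have hsol : P.IsPerturbedSolution ε (fun _ => u₀) y₀ y :=
        ⟨hy.continuousOn, by simpa only [one_smul] using hys⟩
      refine ⟨_, y, hu, hsol, fun t ht => ?_, ?_, ?_⟩
      · have ht0 : t = 0 := by
          refine le_antisymm ?_ ht.1
          simpa using ht.2
        rw [ht0, hsol.apply_zero]
        exact P.level_subset (z 0) (hav.2.2.1 0 le_rfl) hz0.symm
      · simp [hsol.apply_zero, hz0, hη₁0.le]
      · simp [hη₁0.le]
    | succ l ih =>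
      intro hl
      push_cast at hl ⊢
      have hlT : (l : ℝ) * Δ ≤ T + 1 := by linarith
      have ha : 0 ≤ (l : ℝ) * Δ := by positivity
      set e : ℝ := η₁ * Real.exp (Λ * (l * Δ)) with he
      have heρ : e ≤ ρ := (hle _ hlT).trans (min_le_left _ _)
      have heη : η₁ ≤ e := le_mul_of_one_le_right hη₁0.le (Real.one_le_exp (by positivity))
      have hstep' := (ih hlT).step hL hM hav hΔ hη₁0 ha
        (fun z' hz' => (hρσ _ ha z' (hz'.trans heρ)).1)
        (fun z' hz' => hε z' (hρσ _ ha z' (hz'.trans heρ)).1 (hρσ _ ha z' (hz'.trans heρ)).2)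
      obtain ⟨u, y, h1, h2, h3, h4, h5⟩ := hstep'
      have hfin : e + Δ * (L * (e + M * Δ) + η₁ + η₁) + P.C * Δ * (M + M) * Δ ≤
          η₁ * Real.exp (Λ * ((l + 1) * Δ)) := by
        have h6 : e * (Λ * Δ + 1) ≤ e * Real.exp (Λ * Δ) :=
          mul_le_mul_of_nonneg_left (Real.add_one_le_exp _) (hη₁0.le.trans heη)
        have h7 : η₁ * Real.exp (Λ * ((l + 1) * Δ)) = e * Real.exp (Λ * Δ) := by
          rw [show Λ * ((l + 1) * Δ) = Λ * (l * Δ) + Λ * Δ by ring, Real.exp_add, he, ← mul_assoc]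
        have h8 : Δ * ((L * M + P.C * (M + M)) * Δ) ≤ Δ * e :=
          mul_le_mul_of_nonneg_left (hεL.le.trans heη) hΔ.le
        have h9 : Δ * η₁ ≤ Δ * e := mul_le_mul_of_nonneg_left heη hΔ.le
        rw [h7]
        refine le_trans ?_ h6
        rw [hΛ]
        nlinarith
      rw [add_one_mul (l : ℝ) Δ] at hfin ⊢
      exact ⟨u, y, h1, h2, h3, h4.trans hfin, h5.trans hfin⟩
  have hN1 : T ≤ (⌈T / Δ⌉₊ : ℝ) * Δ := (div_le_iff₀ hΔ).1 (Nat.le_ceil _)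
  have hN2 : (⌈T / Δ⌉₊ : ℝ) * Δ ≤ T + 1 := by
    have h1 := Nat.ceil_lt_add_one (div_nonneg hT hΔ.le)
    have h2 : (⌈T / Δ⌉₊ : ℝ) * Δ ≤ (T / Δ + 1) * Δ := mul_le_mul_of_nonneg_right h1.le hΔ.le
    rw [add_mul, div_mul_cancel₀ _ hΔ.ne'] at h2
    linarith
  obtain ⟨u, y, h1, h2, h3, h4, h5⟩ := main _ hN2
  exact ⟨_, hN1, u, y, h1, h2, h3, h4.trans (hle _ hN2), h5.trans (hle _ hN2)⟩

theorem norm_integral_Ioi_exp_mul_le {C M a : ℝ} (hC : 0 < C) (ha : 0 ≤ a) {c : ℝ → ℝ}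
    (hc : ∀ᵐ t ∂(volume.restrict (Ioi (0 : ℝ))), ‖c t‖ ≤ M) :
    ‖∫ t in Ioi a, Real.exp (-C * t) * c t‖ ≤ M * (Real.exp (-C * a) / C) := by
  have hexp : IntegrableOn (fun t => Real.exp (-C * t)) (Ioi a) :=
    integrableOn_exp_mul_Ioi (by linarith) a
  have h1 : ∫ t in Ioi a, M * Real.exp (-C * t) = M * (Real.exp (-C * a) / C) := by
    rw [integral_const_mul, integral_exp_mul_Ioi (by linarith), neg_div_neg_eq]
  rw [← h1]
  refine norm_integral_le_of_norm_le (hexp.const_mul M) ?_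
  filter_upwards [ae_restrict_of_ae_restrict_of_subset (Ioi_subset_Ioi ha) hc] with t ht
  rw [norm_mul, Real.norm_of_nonneg (Real.exp_pos _).le, mul_comm]
  exact mul_le_mul_of_nonneg_right ht (Real.exp_pos _).le

/-- The upper bound: the perturbed values are asymptotically at most the cost of an averaged
solution that stays in the interior. -/
theorem eventually_perturbedValue_le (hW : P.ContinuityOfW) (hA : P.OccupationalApproximation)
    (hV : P.AugmentedViable) (hU : P.U.Nonempty) {y₀ : EuclideanSpace ℝ (Fin m)}
    {μ : ℝ → Measure (EuclideanSpace ℝ (Fin p) × EuclideanSpace ℝ (Fin m))}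
    {z : ℝ → EuclideanSpace ℝ (Fin k)} (hav : P.IsAveragedSolution (P.F y₀) μ z)
    {ρ σ : ℝ} (hρ : 0 < ρ) (hσ : 0 < σ) (hρσ : ∀ t, 0 ≤ t → ∀ z', ‖z' - z t‖ ≤ ρ →
      z' ∈ P.Z ∧ ∀ y ∈ P.level z', Metric.ball y σ ⊆ P.Y) {η : ℝ} (hη : 0 < η) :
    ∀ᶠ ε in 𝓝[>] (0 : ℝ), P.perturbedValue ε y₀ ≤
      (((∫ t in Ioi (0 : ℝ), Real.exp (-P.C * t) * P.rAve (μ t)) + η : ℝ) : EReal) := by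
  obtain ⟨M, hM0, hM⟩ := P.exists_bound_hr
  have hC := P.C_pos
  have hexplim : Tendsto (fun T : ℝ => M * (Real.exp (-P.C * T) / P.C)) atTop (𝓝 0) := by
    have h1 : Tendsto (fun T : ℝ => Real.exp (-P.C * T)) atTop (𝓝 0) :=
      Real.tendsto_exp_atBot.comp (tendsto_id.const_mul_atTop_of_neg (by linarith))
    simpa using (h1.div_const P.C).const_mul M
  -- Each of the two tails costs less than `η / 4`, and tracking up to time `a ≥ T` costs at most `η
  -- / 2`.
  obtain ⟨T, hTη, hT⟩ := ((hexplim.eventually (gt_mem_nhds (show 0 < η / 4 by positivity))).and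
    (eventually_ge_atTop 0)).exists
  have hravb : ∀ᵐ t ∂(volume.restrict (Ioi (0 : ℝ))), ‖P.rAve (μ t)‖ ≤ M := by
    filter_upwards [ae_restrict_of_ae_restrict_of_subset Ioi_subset_Ici_self
      (hav.ae_norm_hrAve_le hM)] with t ht using (norm_snd_le (P.hrAve (μ t))).trans ht
  have hrai : IntegrableOn (fun t => Real.exp (-P.C * t) * P.rAve (μ t)) (Ioi 0) :=
    integrableOn_exp_mul_of_bounded hC
      (P.stronglyMeasurable_hrAve hav.1).snd.aestronglyMeasurable hravb
  filter_upwards [hV, eventually_tracks hW hA hU hav hρ hσ hρσ hT (half_pos hη)] with ε hεV hε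
  obtain ⟨a, hTa, u, y, hu, hy, hyY, hyz, hcost⟩ := hε
  have ha : 0 ≤ a := hT.trans hTa
  -- Tracking leaves `y a` in `Y` with observables in `Z`, so a viable trajectory can be attached.
  -- It stays in `Y`, where the running cost is at most `M`, which makes the tail estimate
  -- available.
  obtain ⟨v, x, zx, hv, hx, -, hxY⟩ := hεV (y a) (hyY a (right_mem_Icc.2 ha))
    (hρσ a ha _ (hyz.trans (min_le_left _ _))).1
  have hsol := hy.concat ha hu hv hx
  have hYnew : ∀ t, 0 ≤ t → concat a y x t ∈ P.Y := fun t ht =>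
    concat_mem hyY (b := t) (fun s hs => (hxY s hs.1).1) t ⟨ht, by linarith⟩
  have hrb : ∀ t, 0 ≤ t → ‖P.r (concat a u v t) (concat a y x t)‖ ≤ M := fun t ht =>
    (norm_snd_le (P.hr (concat a u v t) (concat a y x t))).trans
      (hM _ ((hu.concat hv).2 t ht) _ (hYnew t ht))
  have hrb' : ∀ᵐ t ∂(volume.restrict (Ioi (0 : ℝ))),
      ‖P.r (concat a u v t) (concat a y x t)‖ ≤ M := by
    filter_upwards [ae_restrict_mem measurableSet_Ioi] with t ht using hrb t (le_of_lt ht)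
  have hri : IntegrableOn (fun t => Real.exp (-P.C * t) * P.r (concat a u v t) (concat a y x t))
      (Ioi 0) :=
    integrableOn_exp_mul_of_bounded hC ((hu.concat hv).aestronglyMeasurable_comp
      P.isCompact_Y.isClosed P.continuousOn_r' measurableSet_Ioi Ioi_subset_Ici_self hsol.1
      fun t ht => hYnew t (le_of_lt ht)) hrb'
  have hle : P.perturbedValue ε y₀ ≤ ((∫ t in Ioi (0 : ℝ),
      Real.exp (-P.C * t) * P.r (concat a u v t) (concat a y x t) : ℝ) : EReal) :=
    sInf_le ⟨_, _, hu.concat hv, hsol, hasDiscountedCost_integral hri⟩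
  refine hle.trans ?_
  rw [EReal.coe_le_coe_iff]
  have hsplit : ∀ c : ℝ → ℝ, IntegrableOn c (Ioi 0) →
      ∫ t in Ioi (0 : ℝ), c t = (∫ t in (0 : ℝ)..a, c t) + ∫ t in Ioi a, c t := by
    intro c hc
    rw [intervalIntegral.integral_interval_add_Ioi hc (hc.mono_set (Ioi_subset_Ioi ha))]
  rw [hsplit _ hri, hsplit _ hrai]
  have e1 : ∫ t in (0 : ℝ)..a, Real.exp (-P.C * t) * P.r (concat a u v t) (concat a y x t) =
      ∫ t in (0 : ℝ)..a, Real.exp (-P.C * t) * P.r (u t) (y t) := by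
    simp only [concat_comp₂]
    exact integral_mul_concat_of_le ha le_rfl (fun t => Real.exp (-P.C * t)) _ _
  have h1 := norm_integral_Ioi_exp_mul_le hC ha hrb'
  have h2 := norm_integral_Ioi_exp_mul_le hC ha hravb
  have h3 : M * (Real.exp (-P.C * a) / P.C) ≤ M * (Real.exp (-P.C * T) / P.C) := by
    gcongr M * (Real.exp ?_ / P.C)
    nlinarith
  have h4 := hcost.trans (min_le_right _ _)
  rw [Real.norm_eq_abs] at h1 h2 h4
  rw [e1]
  have h5 := le_of_abs_le h1
  have h6 := neg_le_of_abs_le h2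
  have h7 := le_of_abs_le h4
  linarith

end SlowObservableSystem

/-! ### The theorem. -/

theorem mainTheorem3 {p m k : ℕ} (P : SlowObservableSystem p m k)
    (y₀ : EuclideanSpace ℝ (Fin m))
    (hW : P.ContinuityOfW) (hZ : P.AveragedViable) (hu : P.HasAsymptoticMinimizer y₀) :
    P.averagedValue y₀ ≤ liminf (fun ε : ℝ => P.perturbedValue ε y₀) (𝓝[>] (0 : ℝ)) ∧
    (P.OccupationalApproximation → P.AugmentedViable → P.HasInteriorOptimalSolution y₀ →
      ∃ R : ℝ, P.averagedValue y₀ = (R : EReal) ∧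
        Tendsto (fun ε : ℝ => P.perturbedValue ε y₀) (𝓝[>] (0 : ℝ)) (𝓝 (R : EReal))) := by
  have hlow := P.averagedValue_le_liminf hu
  refine ⟨hlow, fun hA hV hO => ?_⟩
  obtain ⟨u, y, Zu, -, -, hev, -⟩ := hu
  have hU : P.U.Nonempty := by
    obtain ⟨ε, hε⟩ := hev.exists
    exact ⟨_, hε.1.2 0 le_rfl⟩
  obtain ⟨μ, z, Zc, Yc, hav, hopt, hZc, hZcZ, hYc, hYcY, hz⟩ := hO
  obtain ⟨ρ, hρ, σ, hσ, hρσ⟩ :=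
    SlowObservableSystem.exists_uniform_neighbourhood hZc hZcZ hYc hYcY hz
  obtain ⟨M, -, hM⟩ := P.exists_bound_hr
  have hravb : ∀ᵐ t ∂(volume.restrict (Ioi (0 : ℝ))), ‖P.rAve (μ t)‖ ≤ M := by
    filter_upwards [ae_restrict_of_ae_restrict_of_subset Ioi_subset_Ici_self
      (hav.ae_norm_hrAve_le hM)] with t ht using (norm_snd_le (P.hrAve (μ t))).trans ht
  -- The optimal cost is the limit of an absolutely convergent integral, so the averaged value is a
  -- real number.
  have hR := hopt.unique (hasDiscountedCost_integral (integrableOn_exp_mul_of_bounded P.C_pos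
    (P.stronglyMeasurable_hrAve hav.1).snd.aestronglyMeasurable hravb))
  refine ⟨_, hR, tendsto_of_le_liminf_of_limsup_le (hR ▸ hlow) ?_⟩
  -- It suffices to bound the upper limit by every real `x` above the averaged value; the gap serves
  -- as the tolerance `η` of the upper bound.
  refine EReal.le_of_forall_lt_iff_le.1 fun x hx => ?_
  have hη := sub_pos.2 (EReal.coe_lt_coe_iff.1 hx)
  refine limsup_le_of_le (by isBoundedDefault) ?_
  have h := SlowObservableSystem.eventually_perturbedValue_le hW hA hV hU hav hρ hσ hρσ hη
  rwa [add_sub_cancel] at h
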